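/- Let $G=(V=U\sqcup L,E,T)$ be a finite temporal bipartite graph: $E$ is a finite set of temporal edges $(u,v,t)$ with $u\in U$, $v\in L$ and a timestamp $t$ in a linearly ordered abelian group (e.g. $\mathbb Z$ or $\mathbb R$). Assume $E\neq\emptyset$ and that no vertex is isolated. Let $\delta$ be a duration threshold. Write $E(u)$ for the set of edges at $u$ and $|W(u)|=\sum_{(u,v,t)\in E(u),\,|E(v)|\le|E(u)|}|E(v)|$. A temporal butterfly is a sequence of four edges with strictly increasing timestamps, the last at most $\delta$ after the first, whose static edges form a $2\times2$ biclique. Its type $0,\dots,5$ is read off from its two wedges $u\to v\to w$, $u\to x\to w$ with $u,w\in U$: their time intervals are disjoint, intersecting or nested ($0,1,2$), plus $3$ if one wedge is forward and the other backward in time. The algorithm TBC$^+$ orders the vertices by the priority $(|E(u)|,\mathrm{id}(u))$ and sorts each $E(u)$ by it. For each start-vertex $u$ it enumerates the wedges $(u,v,t),(v,w,t')$ in which $v$ and $w$ have lower priority than $u$ and $t\ne t'$, $|t-t'|\le\delta$. It stores the pair $(\min(t,t'),\max(t,t'))=(t_s,t_a)$ in a nested hash map at $H[w][v]$, in a subset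 $A$ if the wedge is forward ($t<t'$) and in a subset $D$ if it is backward. For each $w$ with at least two middle-vertices it sorts the subsets by decreasing $t_s$, then increasing $t_a$, and merges the sets $H[w][v]$ recursively in pairs (as in merge sort, by halving the index range). In each merge of $S_i$ with $S_j$ it goes through the wedges by decreasing $t_s$. For each of the four subsets $A_i,D_i,A_j,D_j$ it maintains a hash map $HP$ whose entry $HP[t_s]$ is the ascending array of the values $t_a$ of the wedges already visited. Before the wedges with start time $t_s$ are processed, the elements $t_a>t_s+\delta$ are deleted, in constant time per deleted element. Each wedge of start time $t_s$ is then queried against the two hash maps of the other set: Query goes through all arrays of these hash maps and counts the butterflies of each type, in constant time for an array whose key is at least the $t_a$ of the wedge, and otherwise by binary search. Afterwards the wedges of start time $t_s$ are inserted. Cost is measured in elementary steps and machine words: comparisons, arithmetic, array accesses and hash map operations take constant time, a timestamp, vertex or counter is one word, and the input is counted in the space. For a vertex $u$ with $|W(u)|\geq 1$ let $Q(u)$ be the total number of arrays inspected by Query in the iteration for $u$, and let $\alpha(u)=\max\{1,\,Q(u)/|W(u)|\}$. Then TBC$^+$ outputs, for each of the six types, the number of temporal butterflies of that type; $1\le\alpha(u)\le|W(u)|$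 whenever $|W(u)|\ge1$; and, with an absolute implied constant, TBC$^+$ runs in time $$O\Big(\sum_{u\in V,\ |W(u)|\geq 1}|W(u)|\Big(\log(1+|E(u)|)+\alpha(u)\log\frac{|W(u)|}{\alpha(u)}\Big)\Big)$$ and in space $$O\Big(|E|+\max_{u\in V}|W(u)|\Big).$$ -/

import Mathlib

namespace TemporalButterfly

/-! ### Temporal bipartite graphs and temporal butterflies -/

/-- A temporal bipartite graph on the vertex set `V = U ∪ L` with timestamps in `T`. A temporal
edge is a triple `(u, v, t)` with `u ∈ U` and `v ∈ L`. The order on `V` plays the role of the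
unique vertex IDs. -/
structure TemporalBipartiteGraph (V : Type*) (T : Type*) where
  U : Finset V
  L : Finset V
  disj : Disjoint U L
  cover : ∀ v, v ∈ U ∨ v ∈ L
  E : Finset (V × V × T)
  bip : ∀ e ∈ E, e.1 ∈ U ∧ e.2.1 ∈ L

namespace TemporalBipartiteGraph

variable {V T : Type*} [LinearOrder V]

/-- `E(u)`: the temporal edges adjacent to `u`. -/
def incident (G : TemporalBipartiteGraph V T) (u : V) : Finset (V × V × T) :=
  G.E.filter fun e => e.1 = u ∨ e.2.1 = u

/-- `|E(u)|`. -/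
def deg (G : TemporalBipartiteGraph V T) (u : V) : ℕ := (G.incident u).card

/-- The endpoint of `e` other than `u`. -/
def other (u : V) (e : V × V × T) : V := if e.1 = u then e.2.1 else e.1

/-- `|W(u)| = ∑ |E(v)|` over the edges `(u, v, t) ∈ E(u)` with `|E(v)| ≤ |E(u)|`. -/
def W (G : TemporalBipartiteGraph V T) (u : V) : ℕ :=
  ∑ e ∈ (G.incident u).filter (fun e => G.deg (other u e) ≤ G.deg u), G.deg (other u e)

end TemporalBipartiteGraph

section Butterflies

variable {V T : Type*} [AddCommGroup T] [LinearOrder T]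

/-- A temporal butterfly with duration threshold `δ`: four temporal edges with strictly increasing
timestamps, all within duration `δ`, whose static edges form a `2 × 2` biclique. -/
def IsTemporalButterfly (G : TemporalBipartiteGraph V T) (δ : T) (e : Fin 4 → V × V × T) : Prop :=
  (∀ k, e k ∈ G.E) ∧
  ((e 0).2.2 < (e 1).2.2 ∧ (e 1).2.2 < (e 2).2.2 ∧ (e 2).2.2 < (e 3).2.2) ∧
  (e 3).2.2 - (e 0).2.2 ≤ δ ∧
  ∃ u ∈ G.U, ∃ w ∈ G.U, ∃ v ∈ G.L, ∃ x ∈ G.L, u ≠ w ∧ v ≠ x ∧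
    Set.range (fun k => ((e k).1, (e k).2.1)) = {(u, v), (w, v), (u, x), (w, x)}

/-- The type of two wedges `(u, v, w)` and `(u, x, w)`, `u, w ∈ U`, with times `(p, q)` and `(r, s)`,
the first wedge being the one with the earliest edge. The coverage pattern of the two time arcs is
non-overlap (`0`), intersecting (`1`) or covering (`2`); `3` is added if one wedge is forward and the
other one backward. -/
def arcType (p q r s : T) : Fin 6 :=
  if (p < q ↔ r < s) then
    if max p q < min r s then 0 else if max p q < max r s then 1 else 2
  else
    if max p q < min r s then 3 else if max p q < max r s then 4 else 5

/-- The butterfly formed by the four edges `e` has type `i`, seen from the layer `U`. -/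
def HasType (e : Fin 4 → V × V × T) (i : Fin 6) : Prop :=
  ∃ (u w v x : V) (p q r s : T), u ≠ w ∧ v ≠ x ∧
    Set.range e = {(u, v, p), (w, v, q), (u, x, r), (w, x, s)} ∧
    min p q < min r s ∧ arcType p q r s = i

/-- The number of temporal butterflies of type `i`. -/
noncomputable def butterflyCount (G : TemporalBipartiteGraph V T) (δ : T) (i : Fin 6) : ℕ :=
  Set.ncard {e : Fin 4 → V × V × T | IsTemporalButterfly G δ e ∧ HasType e i}

end Butterflies

/-! ### The cost model

A program is a state transformer on a meter that records the number of elementary steps, the number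
of words in use, the largest number of words in use so far, and the number of arrays of a hash map
`HP` that have been inspected by `Query`. Timestamps, vertices and counters are words. Arithmetic,
comparisons, array accesses and hash map operations are elementary. -/

structure Meter where
  time : ℕ
  live : ℕ
  peak : ℕ
  probes : ℕ

abbrev Prog := StateM Meter

/-- `n` elementary steps. -/
def tick (n : ℕ) : Prog Unit := modify fun m => { m with time := m.time + n }

/-- Take `n` words of memory into use, in `n` steps. -/
def alloc (n : ℕ) : Prog Unit := modify fun m =>
  { m with time := m.time + n, live := m.live + n, peak := max m.peak (m.live + n) }

/-- Give back `n` words of memory, in `n` steps. -/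
def release (n : ℕ) : Prog Unit := modify fun m =>
  { m with time := m.time + n, live := m.live - n }

/-- Inspect one array of a hash map `HP` in `Query`. -/
def probe : Prog Unit := modify fun m =>
  { m with time := m.time + 1, probes := m.probes + 1 }

/-- A hash map with at most one entry for each key, listed in the order of insertion. An entry
occupies two words in addition to the contents of its value. -/
abbrev HMap (κ ν : Type) := List (κ × ν)

namespace HMap

variable {κ ν : Type} [DecidableEq κ]

/-- The value at `k`, or `d` if there is none. -/
def valueD (h : HMap κ ν) (k : κ) (d : ν) : ν :=
  ((h.find? fun p => decide (p.1 = k)).map Prod.snd).getD d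

def get (h : HMap κ ν) (k : κ) (d : ν) : Prog ν := do
  tick 1
  pure (h.valueD k d)

def put (h : HMap κ ν) (k : κ) (x : ν) : Prog (HMap κ ν) := do
  tick 1
  if k ∈ h.map Prod.fst then
    pure (h.map fun p => if p.1 = k then (k, x) else p)
  else do
    alloc 2
    pure (h ++ [(k, x)])

def remove (h : HMap κ ν) (k : κ) : Prog (HMap κ ν) := do
  tick 1
  if k ∈ h.map Prod.fst then release 2
  pure (h.filter fun p => decide (p.1 ≠ k))

end HMap

section Sorting

variable {β : Type}

/-- Merge two sorted arrays whose entries have `k` words, through a scratch array. -/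
def mergeOp (k : ℕ) (le : β → β → Bool) (xs ys : List β) : Prog (List β) := do
  alloc (k * (xs.length + ys.length))
  tick (xs.length + ys.length)
  release (k * (xs.length + ys.length))
  pure (xs.merge ys le)

/-- Merge sort. The two halves are index ranges of the same array. -/
def mergeSortOp (k : ℕ) (le : β → β → Bool) (xs : List β) : Prog (List β) := do
  alloc 3
  let ys ←
    if h : xs.length ≤ 1 then pure xs
    else do
      let a ← mergeSortOp k le (xs.take (xs.length / 2))
      let b ← mergeSortOp k le (xs.drop (xs.length / 2))
      mergeOp k le a b
  release 3
  pure ys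
termination_by xs.length
decreasing_by
  all_goals simp only [List.length_take, List.length_drop]
  all_goals omega

/-- Binary search in positions `lo ≤ i < hi` of `arr` for the first entry that violates `p`. -/
def binarySearch (arr : List β) (p : β → Bool) (lo hi : ℕ) : Prog ℕ :=
  if _h : lo < hi then do
    tick 1
    match arr[(lo + hi) / 2]? with
    | some y =>
      if p y then binarySearch arr p ((lo + hi) / 2 + 1) hi
      else binarySearch arr p lo ((lo + hi) / 2)
    | none => pure lo
  else do
    tick 1
    pure lo
termination_by hi - lo
decreasing_by
  all_goals omega

end Sorting

/-! ### The algorithm -/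

/-- The input of the algorithm: an array of the vertices, the layer of each vertex, and an array
of the pairs `(v, t)`, `(u, v, t) ∈ E(u)`, for each vertex `u`. -/
structure Input (V T : Type) where
  vertices : List V
  isUpper : V → Bool
  adj : V → List (V × T)

/-- The input describes the graph `G`. The order within the arrays is arbitrary. -/
def Input.Represents {V T : Type} (inp : Input V T) (G : TemporalBipartiteGraph V T) : Prop :=
  inp.vertices.Nodup ∧ (∀ v, v ∈ inp.vertices) ∧ (∀ v, inp.isUpper v = true ↔ v ∈ G.U) ∧
  ∀ u, (inp.adj u).Nodup ∧ ∀ v t, (v, t) ∈ inp.adj u ↔ ((u, v, t) ∈ G.E ∨ (v, u, t) ∈ G.E)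

/-- The number of words of the input: vertex, layer, `|E(u)|`, array reference, array. -/
def Input.words {V T : Type} (inp : Input V T) : ℕ :=
  (inp.vertices.map fun u => 4 + 2 * (inp.adj u).length).sum

/-- The counters `C[0], …, C[5]`. -/
abbrev Counts := Fin 6 → ℕ

/-- The index `i ⊕ l`, where `l = 0` if the start-vertex is in `U` and `l = 1` otherwise. -/
def convert (upper : Bool) (i : Fin 6) : Fin 6 := if upper then i else ![1, 0, 3, 2, 5, 4] i

/-- `C[i ⊕ l] += n`. -/
def bump (upper : Bool) (i : Fin 6) (n : ℕ) (C : Counts) : Prog Counts := do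
  tick 1
  pure (Function.update C (convert upper i) (C (convert upper i) + n))

/-- `P_V(u) > P_V(w)`. -/
def higher {V T : Type} [LinearOrder V] (inp : Input V T) (u w : V) : Bool :=
  decide ((inp.adj w).length < (inp.adj u).length ∨
    ((inp.adj w).length = (inp.adj u).length ∧ w < u))

section Combine

variable {T : Type} [LinearOrder T]

/-- A wedge set `S_v = (A, D)`. Each wedge is stored as a pair `(t_s, t_a)` with `t_s < t_a`. -/
structure WedgeSet (T : Type) where
  A : List (T × T)
  D : List (T × T)

/-- The order of increasing wedge priority: `t_s` decreasing, then `t_a` increasing. -/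
def priorityLe (x y : T × T) : Bool := decide (y.1 < x.1 ∨ (x.1 = y.1 ∧ x.2 ≤ y.2))

/-- The order of decreasing `t_a`. -/
def arrivalGe (x y : T × T) : Bool := decide (y.2 ≤ x.2)

/-- A subset `A` or `D` of a wedge set in wedge priority order, together with a copy of it in the
order of decreasing `t_a`, by which `Delete` finds the wedges to be deleted. -/
structure SortedSubset (T : Type) where
  pri : List (T × T)
  arr : List (T × T)

structure SortedSet (T : Type) where
  A : SortedSubset T
  D : SortedSubset T

def sortSubset (b : List (T × T)) : Prog (SortedSubset T) := do
  let p ← mergeSortOp 2 priorityLe b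
  alloc (2 * b.length)
  let a ← mergeSortOp 2 arrivalGe b
  pure ⟨p, a⟩

/-- `HP[t]` is the array of the values `t_a` of the stored wedges with `t_s = t`. -/
abbrev HP (T : Type) := HMap T (List T)

def HP.words (hp : HP T) : ℕ := (hp.map fun p => 2 + p.2.length).sum

/-- `HP[t_s].append(t_a)`. -/
def insert (x : T × T) (hp : HP T) : Prog (HP T) := do
  let a ← HMap.get hp x.1 []
  alloc 1
  HMap.put hp x.1 (a ++ [x.2])

/-- Pop all elements `> bound` from the arrays of `HP` and erase the empty arrays. The wedges of the
subset that have not been deleted yet are listed by decreasing `t_a`, so that only deleted wedges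
are touched; since the arrays are ascending, the element to be popped is always the last one. -/
def delete (bound : T) : List (T × T) → HP T → Prog (List (T × T) × HP T)
  | [], hp => do
    tick 1
    pure ([], hp)
  | y :: ys, hp => do
    tick 1
    if bound < y.2 then do
      let a ← HMap.get hp y.1 []
      release 1
      let hp' ← if a.dropLast = [] then HMap.remove hp y.1 else HMap.put hp y.1 a.dropLast
      delete bound ys hp'
    else pure (y :: ys, hp)

/-- One half of `Query`: the butterflies that the wedge `x` forms with the wedges stored in `hp`.
The counters are `C[c₁ ⊕ l]` (non-overlap), `C[c₂ ⊕ l]` (intersecting), `C[c₃ ⊕ l]` (covering). -/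
def queryHP (upper : Bool) (c₁ c₂ c₃ : Fin 6) (x : T × T) (hp : HP T) (C : Counts) :
    Prog Counts :=
  hp.foldlM (fun C p => do
    probe
    tick 1
    if x.2 < p.1 then bump upper c₁ p.2.length C
    else if p.1 < x.2 then do
      let m ← binarySearch p.2 (fun y => decide (y ≤ x.2)) 0 p.2.length
      let C ← bump upper c₂ (p.2.length - m) C
      let n ← binarySearch p.2 (fun y => decide (y < x.2)) 0 p.2.length
      bump upper c₃ n C
    else pure C) C

/-- `Query`: `same` holds wedges of the same direction as `x`, `opp` those of the other one. -/
def query (upper : Bool) (x : T × T) (same opp : HP T) (C : Counts) : Prog Counts := do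
  tick 1
  let C ← queryHP upper 0 1 2 x same C
  queryHP upper 3 4 5 x opp C

/-- Query the unprocessed wedges with `t_s = s`; the result contains the remaining ones. -/
def queryBatch (upper : Bool) (s : T) (same opp : HP T) :
    List (T × T) → Counts → Prog (List (T × T) × Counts)
  | [], C => do
    tick 1
    pure ([], C)
  | x :: xs, C => do
    tick 1
    if x.1 = s then do
      let C ← query upper x same opp C
      queryBatch upper s same opp xs C
    else pure (x :: xs, C)

/-- Insert the unprocessed wedges with `t_s = s`. -/
def insertBatch (s : T) : List (T × T) → HP T → Prog (HP T)
  | [], hp => do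
    tick 1
    pure hp
  | x :: xs, hp => do
    tick 1
    if x.1 = s then do
      let hp ← insert x hp
      insertBatch s xs hp
    else pure hp

/-- The state of `SetCross` for one subset `b`: the wedges from `ptr_b` on, the wedges that have not
been deleted by decreasing `t_a`, and `HP_b`. -/
structure Lane (T : Type) where
  todo : List (T × T)
  kept : List (T × T)
  hp : HP T

def Lane.start (b : SortedSubset T) : Lane T := ⟨b.pri, b.arr, []⟩

def Lane.delete (bound : T) (b : Lane T) : Prog (Lane T) := do
  let r ← TemporalButterfly.delete bound b.kept b.hp
  pure ⟨b.todo, r.1, r.2⟩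

/-- `maxn`: the maximal `t_s` of the unprocessed wedges, if there is one. -/
def maxStart (bs : List (Lane T)) : Option T :=
  (bs.filterMap fun b => b.todo.head?.map Prod.fst).max?

variable [AddCommGroup T]

/-- The main loop of `SetCross`. Each round processes at least one wedge, so the number of wedges
plus one is enough as the first argument, which bounds the number of rounds. -/
def crossLoop (upper : Bool) (δ : T) :
    ℕ → Lane T → Lane T → Lane T → Lane T → Counts → Prog Counts
  | 0, _, _, _, _, C => pure C
  | fuel + 1, Ai, Di, Aj, Dj, C => do
    tick 4
    match maxStart [Ai, Di, Aj, Dj] with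
    | none => do
      release (Ai.hp.words + Di.hp.words + Aj.hp.words + Dj.hp.words)
      pure C
    | some maxn => do
      let Ai ← Ai.delete (maxn + δ)
      let Di ← Di.delete (maxn + δ)
      let Aj ← Aj.delete (maxn + δ)
      let Dj ← Dj.delete (maxn + δ)
      let (todoAi, C) ← queryBatch upper maxn Aj.hp Dj.hp Ai.todo C
      let (todoDi, C) ← queryBatch upper maxn Dj.hp Aj.hp Di.todo C
      let (todoAj, C) ← queryBatch upper maxn Ai.hp Di.hp Aj.todo C
      let (todoDj, C) ← queryBatch upper maxn Di.hp Ai.hp Dj.todo C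
      let hpAi ← insertBatch maxn Ai.todo Ai.hp
      let hpDi ← insertBatch maxn Di.todo Di.hp
      let hpAj ← insertBatch maxn Aj.todo Aj.hp
      let hpDj ← insertBatch maxn Dj.todo Dj.hp
      crossLoop upper δ fuel ⟨todoAi, Ai.kept, hpAi⟩ ⟨todoDi, Di.kept, hpDi⟩
        ⟨todoAj, Aj.kept, hpAj⟩ ⟨todoDj, Dj.kept, hpDj⟩ C

def mergeSubset (a b : SortedSubset T) : Prog (SortedSubset T) := do
  let p ← mergeOp 2 priorityLe a.pri b.pri
  let q ← mergeOp 2 arrivalGe a.arr b.arr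
  pure ⟨p, q⟩

def setCross (upper : Bool) (δ : T) (Si Sj : SortedSet T) (C : Counts) :
    Prog (SortedSet T × Counts) := do
  alloc 12
  let C ← crossLoop upper δ
    (Si.A.pri.length + Si.D.pri.length + Sj.A.pri.length + Sj.D.pri.length + 1)
    (Lane.start Si.A) (Lane.start Si.D) (Lane.start Sj.A) (Lane.start Sj.D) C
  release 12
  let A ← mergeSubset Si.A Sj.A
  let D ← mergeSubset Si.D Sj.D
  pure (⟨A, D⟩, C)

/-- `Recur` on the index range `p, …, q - 1` of the array of the sets, given as a list; the result
contains the merged set, which takes the place of `S_p`. -/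
def recur (upper : Bool) (δ : T) (S : List (SortedSet T)) (C : Counts) :
    Prog (SortedSet T × Counts) := do
  alloc 3
  let r ←
    if _h : S.length ≤ 1 then pure (S.headD ⟨⟨[], []⟩, ⟨[], []⟩⟩, C)
    else do
      let (Sp, C) ← recur upper δ (S.take (S.length / 2)) C
      let (Sm, C) ← recur upper δ (S.drop (S.length / 2)) C
      setCross upper δ Sp Sm C
  release 3
  pure r
termination_by S.length
decreasing_by
  all_goals simp only [List.length_take, List.length_drop]
  all_goals omega

end Combine

section Main

variable {V T : Type} [LinearOrder V] [AddCommGroup T] [LinearOrder T]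

/-- The nested hash map `H`; `H[w][v]` is the wedge set with end-vertex `w`, middle-vertex `v`. -/
abbrev WedgeMap (V T : Type) := HMap V (HMap V (WedgeSet T))

def setsWords (h : HMap V (WedgeSet T)) : ℕ :=
  (h.map fun p => 4 + 2 * (p.2.A.length + p.2.D.length)).sum

def WedgeMap.words (H : WedgeMap V T) : ℕ := (H.map fun p => 2 + setsWords p.2).sum

/-- Append the wedge with start-time `t` and arrival time `t'` to `H[w][v]`. -/
def appendWedge (H : WedgeMap V T) (w v : V) (t t' : T) : Prog (WedgeMap V T) := do
  let inner ← HMap.get H w []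
  tick 1
  if v ∉ inner.map Prod.fst then alloc 2
  let S ← HMap.get inner v ⟨[], []⟩
  alloc 2
  tick 1
  let S' : WedgeSet T := if t < t' then ⟨S.A ++ [(t, t')], S.D⟩ else ⟨S.A, S.D ++ [(t', t)]⟩
  let inner' ← HMap.put inner v S'
  HMap.put H w inner'

/-- The wedges with start-vertex `u`, without those with `t = t'` or `|t' - t| > δ`. -/
def collectWedges (inp : Input V T) (adj : V → List (V × T)) (δ : T) (u : V) :
    Prog (WedgeMap V T) :=
  (adj u).foldlM (fun H e => do
    tick 2
    if higher inp u e.1 then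
      (adj e.1).foldlM (fun H e' => do
        tick 4
        if higher inp u e'.1 ∧ e.2 ≠ e'.2 ∧ |e'.2 - e.2| ≤ δ then
          appendWedge H e'.1 e.1 e.2 e'.2
        else pure H) H
    else pure H) []

def sortSets : List (WedgeSet T) → Prog (List (SortedSet T))
  | [] => do
    tick 1
    pure []
  | S :: Ss => do
    alloc 6
    let A ← sortSubset S.A
    let D ← sortSubset S.D
    let rest ← sortSets Ss
    pure (⟨A, D⟩ :: rest)

/-- Reindex and sort the sets in `H[w]`, combine them, and release the temporary arrays. -/
def combineSets (upper : Bool) (δ : T) (Hw : HMap V (WedgeSet T)) (C : Counts) :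
    Prog Counts := do
  let S ← sortSets (Hw.map Prod.snd)
  let r ← recur upper δ S C
  release (6 * S.length + 2 * (r.1.A.arr.length + r.1.D.arr.length))
  pure r.2

/-- The iteration of the main loop for the start-vertex `u`. -/
def startVertex (inp : Input V T) (adj : V → List (V × T)) (δ : T) (u : V) (C : Counts) :
    Prog Counts := do
  tick 1
  let H ← collectWedges inp adj δ u
  let C ← H.foldlM (fun C p => do
    tick 1
    if 1 < p.2.length then combineSets (inp.isUpper u) δ p.2 C else pure C) C
  release (WedgeMap.words H)
  pure C

/-- Sort each `E(u)` by the priority of the neighbour. -/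
def sortEdges (inp : Input V T) : Prog (V → List (V × T)) :=
  inp.vertices.foldlM (fun adj u => do
    tick 1
    let l ← mergeSortOp 2 (fun x y => !(higher inp x.1 y.1)) (adj u)
    pure (Function.update adj u l)) inp.adj

/-- The algorithm TBC⁺. -/
def tbcPlus (inp : Input V T) (δ : T) : Prog Counts := do
  alloc 6
  let adj ← sortEdges inp
  inp.vertices.foldlM (fun C u => startVertex inp adj δ u C) (fun _ => 0)

/-- The result and the final meter of a program that is started when the input, and nothing else,
is in memory. -/
def runOn {α : Type} (inp : Input V T) (p : Prog α) : α × Meter :=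
  p.run ⟨0, inp.words, inp.words, 0⟩

def output (inp : Input V T) (δ : T) : Counts := (runOn inp (tbcPlus inp δ)).1

/-- The number of steps of the run. -/
def runTime (inp : Input V T) (δ : T) : ℕ := (runOn inp (tbcPlus inp δ)).2.time

/-- The largest number of words in use during the run, including the input. -/
def runSpace (inp : Input V T) (δ : T) : ℕ := (runOn inp (tbcPlus inp δ)).2.peak

/-- The number of arrays of hash maps `HP` that `Query` inspects in the iteration for `u`. -/
def probes (inp : Input V T) (δ : T) (u : V) : ℕ :=
  (runOn inp (do
    let adj ← sortEdges inp
    startVertex inp adj δ u (fun _ => 0))).2.probes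

/-- The coefficient `α` for `u`: the average number, over the `|W(u)|` wedges, of arrays that `Query`
inspects for a wedge, but at least `1`. -/
noncomputable def alpha (G : TemporalBipartiteGraph V T) (inp : Input V T) (δ : T) (u : V) : ℝ :=
  max 1 ((probes inp δ u : ℝ) / (G.W u : ℝ))

end Main

end TemporalButterfly

/-! Every piece of the program is described by one predicate, `Runs`, which composes along `bind`.
It records the value, the time, the memory and, separately, the sizes of the arrays that `Query`
inspects. Counters never influence the control flow, so costs are stated uniformly in the counters;
hence the arrays probed for `u` in the full run are those measured by `probes`.

Correctness. When the wedges of start time `s` are queried, the stored wedges are exactly those of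
the other set that start after `s` and arrive by `s + δ`. Summed over the rounds (`cross_round`),
each pair of wedges from the two sets contributes the value `meet`, and the halving recursion
combines every two different sets once (`pairs_append`). So the iteration for `u` sums over the
pairs of wedges with equal end-vertex and different middle-vertices (`vertexCount_flat`), and
`meet_orient` identifies the summand as the indicator of a butterfly of the right type. Conversely,
a butterfly has a unique vertex of highest priority; cutting it there gives two wedges, whose order
is fixed by their start times (`injOn_doubleEdges`, `IsButterflySet.exists_double`). If that vertex
lies in `L`, the butterfly is seen from the wrong layer, which permutes the types by `convert`
(`pairType_transpose`).

Time. Sorting the adjacency lists costs a sum of `d log (1 + d)` over the degrees, which is charged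
edge by edge to the endpoint of larger degree (`sum_deg_mul_log_le`). A start-vertex of degree `d`
has at most `min (W, d ^ 2)` wedges, so all logarithms from sorting and merging its wedges are
`O(log (1 + d))`. For the searches, an entry of an inspected array is a pair of a queried and a
stored wedge, and no unordered pair occurs twice. The sizes therefore add up to at most `n (n - 1) /
2` for `n` wedges, hence to at most `W ^ 2 / 2`. With at most `W α` arrays, the tangent line of the
logarithm at `c = W / α` bounds the search time by `O(W α log (W / α))` (`searchCost_le`). Since
arrays are nonempty, the same bound on the sizes gives `α ≤ W`.

Space. Everything built for one start-vertex is linear in its number of wedges and is released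
afterwards, so the peaks of the iterations enter through their maximum. -/

namespace TemporalButterfly

set_option linter.unusedSectionVars false

/-! ### Resource accounting -/

/-- Time spent on inspecting arrays of the sizes `L` by binary search. -/
def searchCost (L : List ℕ) : ℕ := (L.map fun a => 8 + 2 * Nat.log 2 a).sum

lemma searchCost_append (L L' : List ℕ) : searchCost (L ++ L') = searchCost L + searchCost L' := by
  simp [searchCost]

@[simp] lemma searchCost_nil : searchCost [] = 0 := rfl

/-- `p` returns `a`, in time at most `t` apart from the search in arrays of the sizes `L`, which are
the arrays that it probes. If it starts with `x` words, it ends with at most `y` words and never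
uses more than `s` words. -/
def Runs {α : Type} (p : Prog α) (a : α) (t : ℕ) (L : List ℕ) (x y s : ℕ) : Prop :=
  ∀ m : Meter, (p m).1 = a ∧ (p m).2.time ≤ m.time + t + searchCost L ∧
    (p m).2.probes = m.probes + L.length ∧
    ∀ B, m.live ≤ B + x → (p m).2.live ≤ B + y ∧ (p m).2.peak ≤ max m.peak (B + s)

section Runs

variable {α β : Type}

/-- The frame `B` of words that belong to the surrounding program is universally quantified in
`Runs`, so the same `B` serves both halves; times add, peaks are maximised. -/
lemma Runs.bind {p : Prog α} {f : α → Prog β} {a : α} {b : β} {t₁ t₂ : ℕ} {L₁ L₂ : List ℕ}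
    {x y z s₁ s₂ : ℕ} (h₁ : Runs p a t₁ L₁ x y s₁) (h₂ : Runs (f a) b t₂ L₂ y z s₂) :
    Runs (p >>= f) b (t₁ + t₂) (L₁ ++ L₂) x z (max s₁ s₂) := by
  intro m
  obtain ⟨ha, ht, hq, hm⟩ := h₁ m
  obtain ⟨hb, ht', hq', hm'⟩ := h₂ (p m).2
  have e : (p >>= f) m = f a (p m).2 := by rw [← ha]; rfl
  rw [e, searchCost_append, List.length_append]
  refine ⟨hb, by omega, by omega, fun B hB => ?_⟩
  obtain ⟨h1, h2⟩ := hm B hB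
  obtain ⟨h3, h4⟩ := hm' B h1
  refine ⟨h3, h4.trans ?_⟩
  omega

lemma Runs.mono {p : Prog α} {a : α} {t t' : ℕ} {L : List ℕ} {x y s y' s' : ℕ}
    (h : Runs p a t L x y s) (ht : t ≤ t') (hy : y ≤ y') (hs : s ≤ s') :
    Runs p a t' L x y' s' := by
  intro m
  obtain ⟨ha, ht1, hq, hm⟩ := h m
  refine ⟨ha, by omega, hq, fun B hB => ?_⟩
  obtain ⟨h1, h2⟩ := hm B hB
  exact ⟨by omega, h2.trans (by omega)⟩

lemma Runs.congr {p : Prog α} {a a' : α} {t t' : ℕ} {L L' : List ℕ} {x y s y' s' : ℕ}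
    (h : Runs p a t L x y s) (ha : a = a') (hL : L = L') (ht : t ≤ t') (hy : y ≤ y')
    (hs : s ≤ s') : Runs p a' t' L' x y' s' := by
  subst ha hL
  exact h.mono ht hy hs

lemma Runs.weaken_left {p : Prog α} {a : α} {t : ℕ} {L : List ℕ} {x x' y s : ℕ}
    (h : Runs p a t L x y s) (hx : x' ≤ x) : Runs p a t L x' y s := by
  intro m
  obtain ⟨ha, ht1, hq, hm⟩ := h m
  exact ⟨ha, ht1, hq, fun B hB => hm B (by omega)⟩

lemma Runs.pure (a : α) (x : ℕ) : Runs (pure a) a 0 [] x x 0 := by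
  intro m
  refine ⟨rfl, by simp only [searchCost_nil]; exact le_rfl, rfl, fun B hB => ⟨hB, le_max_left _ _⟩⟩

lemma Runs.tick (n x : ℕ) : Runs (tick n) () n [] x x 0 := by
  intro m
  exact ⟨rfl, le_rfl, rfl, fun B hB => ⟨hB, le_max_left _ _⟩⟩

lemma Runs.alloc (n x : ℕ) : Runs (alloc n) () n [] x (x + n) (x + n) := by
  intro m
  refine ⟨rfl, le_rfl, rfl, fun B hB => ⟨?_, ?_⟩⟩
  · change m.live + n ≤ _
    omega
  · change max m.peak (m.live + n) ≤ _
    omega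

lemma Runs.release (n x : ℕ) : Runs (release n) () n [] x (x - n) 0 := by
  intro m
  refine ⟨rfl, le_rfl, rfl, fun B hB => ⟨?_, le_max_left _ _⟩⟩
  change m.live - n ≤ _
  omega

lemma Runs.ite {c : Prop} [Decidable c] {p q : Prog α} {a : α} {t : ℕ} {L : List ℕ}
    {x y s : ℕ} (hp : c → Runs p a t L x y s) (hq : ¬ c → Runs q a t L x y s) :
    Runs (if c then p else q) a t L x y s := by
  split_ifs with h
  · exact hp h
  · exact hq h

/-- This matches the way in which `do` notation copies the continuation into both branches of a
conditional. -/
lemma Runs.ite_bind {c : Prop} [Decidable c] {p q : Prog α} {f : α → Prog β} {a : α} {b : β}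
    {t₁ t₂ : ℕ} {L₁ L₂ : List ℕ} {x y z s₁ s₂ : ℕ} (h₁ : Runs (if c then p else q) a t₁ L₁ x y s₁)
    (h₂ : Runs (f a) b t₂ L₂ y z s₂) :
    Runs (if c then p >>= f else q >>= f) b (t₁ + t₂) (L₁ ++ L₂) x z (max s₁ s₂) := by
  have : (if c then p >>= f else q >>= f) = (if c then p else q) >>= f := by split_ifs <;> rfl
  rw [this]
  exact h₁.bind h₂

end Runs

/-! ### Hash maps -/

namespace HMap

variable {κ ν : Type} [DecidableEq κ]

/-- The map with the value `x` at `k`. -/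
def set (h : HMap κ ν) (k : κ) (x : ν) : HMap κ ν :=
  if k ∈ h.map Prod.fst then h.map fun p => if p.1 = k then (k, x) else p else h ++ [(k, x)]

def erase (h : HMap κ ν) (k : κ) : HMap κ ν := h.filter fun p => decide (p.1 ≠ k)

lemma runs_get (h : HMap κ ν) (k : κ) (d : ν) (x : ℕ) :
    Runs (HMap.get h k d) (h.valueD k d) 1 [] x x 0 :=
  Runs.congr ((Runs.tick 1 x).bind (Runs.pure _ x)) rfl rfl le_rfl le_rfl le_rfl

lemma runs_put (h : HMap κ ν) (k : κ) (v : ν) (x : ℕ) :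
    Runs (HMap.put h k v) (h.set k v) 3 [] x (x + if k ∈ h.map Prod.fst then 0 else 2)
      (x + if k ∈ h.map Prod.fst then 0 else 2) := by
  unfold HMap.put HMap.set
  split_ifs with hk
  · exact Runs.congr ((Runs.tick 1 x).bind (Runs.pure _ x)) rfl rfl (by omega) (by omega) (by omega)
  · exact Runs.congr ((Runs.tick 1 x).bind ((Runs.alloc 2 x).bind (Runs.pure _ _))) rfl rfl (by omega)
      (by omega) (by omega)

lemma runs_remove (h : HMap κ ν) (k : κ) (x : ℕ) :
    Runs (HMap.remove h k) (h.erase k) 3 [] x (x - if k ∈ h.map Prod.fst then 2 else 0) 0 := by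
  unfold HMap.remove HMap.erase
  split_ifs with hk
  · exact Runs.congr ((Runs.tick 1 x).bind ((Runs.release 2 x).bind (Runs.pure _ _))) rfl rfl (by omega)
      (by omega) (by omega)
  · exact Runs.congr ((Runs.tick 1 x).bind (Runs.pure _ x)) rfl rfl (by omega) (by omega) (by omega)

/-- The sum of `g k v` over the entries. -/
def total {M : Type*} [AddCommMonoid M] (g : κ → ν → M) (h : HMap κ ν) : M :=
  (h.map fun p => g p.1 p.2).sum

section Total

variable {M : Type*} [AddCommMonoid M] (g : κ → ν → M)

@[simp] lemma total_nil : total g ([] : HMap κ ν) = 0 := rfl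

@[simp] lemma total_cons (p : κ × ν) (h : HMap κ ν) :
    total g (p :: h) = g p.1 p.2 + total g h := by simp [total]

lemma valueD_of_notMem {h : HMap κ ν} {k : κ} (hk : k ∉ h.map Prod.fst) (d : ν) :
    h.valueD k d = d := by
  have : h.find? (fun p => decide (p.1 = k)) = none := by
    rw [List.find?_eq_none]
    intro p hp hpk
    exact hk (List.mem_map.2 ⟨p, hp, by simpa using hpk⟩)
  simp [valueD, this]

lemma valueD_cons (p : κ × ν) (h : HMap κ ν) (k : κ) (d : ν) :
    valueD (p :: h) k d = if p.1 = k then p.2 else valueD h k d := by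
  unfold valueD
  by_cases hp : p.1 = k <;> simp [hp]

lemma mem_valueD {h : HMap κ ν} {k : κ} (hk : k ∈ h.map Prod.fst) (d : ν) :
    (k, h.valueD k d) ∈ h := by
  induction h with
  | nil => simp at hk
  | cons p h ih =>
    rw [valueD_cons]
    split_ifs with hp
    · subst hp; simp
    · simp only [List.map_cons, List.mem_cons] at hk
      exact List.mem_cons_of_mem _ (ih (hk.resolve_left (Ne.symm hp)))

lemma map_replace_of_notMem {h : HMap κ ν} {k : κ} (hk : k ∉ h.map Prod.fst) (x : ν) :
    (h.map fun p => if p.1 = k then (k, x) else p) = h := by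
  conv_rhs => rw [← List.map_id h]
  refine List.map_congr_left fun p hp => ?_
  have : p.1 ≠ k := fun e => hk (e ▸ List.mem_map_of_mem hp)
  simp [this]

lemma map_fst_set (h : HMap κ ν) (k : κ) (x : ν) :
    (h.set k x).map Prod.fst =
      if k ∈ h.map Prod.fst then h.map Prod.fst else h.map Prod.fst ++ [k] := by
  unfold set
  split_ifs with hk
  · rw [List.map_map]
    refine List.map_congr_left fun p _ => ?_
    by_cases hp : p.1 = k <;> simp [hp]
  · simp

lemma nodup_set {h : HMap κ ν} (hn : (h.map Prod.fst).Nodup) (k : κ) (x : ν) :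
    ((h.set k x).map Prod.fst).Nodup := by
  rw [map_fst_set]
  split_ifs with hk
  · exact hn
  · rw [List.nodup_append]
    exact ⟨hn, by simp, fun a ha b hb => by
      rw [List.mem_singleton] at hb
      rintro rfl
      exact hk (hb ▸ ha)⟩

lemma nodup_erase {h : HMap κ ν} (hn : (h.map Prod.fst).Nodup) (k : κ) :
    ((h.erase k).map Prod.fst).Nodup :=
  hn.sublist (List.filter_sublist.map _)

lemma mem_set {h : HMap κ ν} {k : κ} {x : ν} {p : κ × ν} (hp : p ∈ h.set k x) :
    p = (k, x) ∨ p ∈ h := by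
  unfold set at hp
  split_ifs at hp with hk
  · obtain ⟨q, hq, rfl⟩ := List.mem_map.1 hp
    split_ifs with hqk
    · exact Or.inl rfl
    · exact Or.inr hq
  · simpa [or_comm] using hp

lemma total_set_of_notMem {h : HMap κ ν} {k : κ} (hk : k ∉ h.map Prod.fst) (x : ν) :
    total g (h.set k x) = total g h + g k x := by
  simp [set, hk, total]

lemma total_set_of_mem {h : HMap κ ν} (hn : (h.map Prod.fst).Nodup) {k : κ}
    (hk : k ∈ h.map Prod.fst) (x d : ν) :
    total g (h.set k x) + g k (h.valueD k d) = total g h + g k x := by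
  rw [set, if_pos hk]
  induction h with
  | nil => simp at hk
  | cons p h ih =>
    rw [List.map_cons, List.nodup_cons] at hn
    rw [List.map_cons, total_cons, total_cons, valueD_cons]
    by_cases hp : p.1 = k
    · subst hp
      rw [map_replace_of_notMem hn.1]
      simp only [if_true]
      abel
    · simp only [List.map_cons, List.mem_cons] at hk
      simp only [hp, if_false]
      rw [add_assoc, ih hn.2 (hk.resolve_left (Ne.symm hp)), add_assoc]

/-- Both sides are sums because `M` may be a type of multisets, where nothing can be subtracted. The
same functional `total` measures memory (`M = ℕ`) and contents (`M` multisets); `hd` says that the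
default value of a missing key contributes nothing. -/
lemma total_set {h : HMap κ ν} (hn : (h.map Prod.fst).Nodup) (k : κ) (x d : ν)
    (hd : g k d = 0) :
    total g (h.set k x) + g k (h.valueD k d) = total g h + g k x := by
  by_cases hk : k ∈ h.map Prod.fst
  · exact total_set_of_mem g hn hk x d
  · rw [total_set_of_notMem g hk, valueD_of_notMem hk, hd, add_zero]

lemma total_erase {h : HMap κ ν} (hn : (h.map Prod.fst).Nodup) {k : κ}
    (hk : k ∈ h.map Prod.fst) (d : ν) :
    total g (h.erase k) + g k (h.valueD k d) = total g h := by
  induction h with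
  | nil => simp at hk
  | cons p h ih =>
    rw [List.map_cons, List.nodup_cons] at hn
    rw [total_cons, valueD_cons, erase, List.filter_cons]
    by_cases hp : p.1 = k
    · subst hp
      have : h.filter (fun q => decide (q.1 ≠ p.1)) = h := by
        rw [List.filter_eq_self]
        intro q hq
        simp only [decide_eq_true_eq]
        exact fun e => hn.1 (e ▸ List.mem_map_of_mem hq)
      rw [this, if_pos rfl]
      simp [add_comm]
    · simp only [List.map_cons, List.mem_cons] at hk
      have := ih hn.2 (hk.resolve_left (Ne.symm hp))
      rw [erase] at this
      simp only [hp, ne_eq, not_false_eq_true, decide_true, if_true, total_cons, if_false]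
      rw [← this, ← add_assoc]

end Total

end HMap

/-! ### Sorting and searching -/

section Sorting

variable {β : Type}

lemma runs_mergeOp (k : ℕ) (le : β → β → Bool) (xs ys : List β) (x : ℕ) :
    Runs (mergeOp k le xs ys) (xs.merge ys le) ((2 * k + 1) * (xs.length + ys.length)) [] x x
      (x + k * (xs.length + ys.length)) := by
  unfold mergeOp
  refine Runs.congr ((Runs.alloc _ x).bind ((Runs.tick _ _).bind
    ((Runs.release _ _).bind (Runs.pure _ _)))) rfl rfl ?_ ?_ ?_
  · apply le_of_eq; ring
  · omega
  · omega

lemma clog_half {n : ℕ} (h : 2 ≤ n) :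
    Nat.clog 2 (n / 2) + 1 ≤ Nat.clog 2 n ∧ Nat.clog 2 (n - n / 2) + 1 ≤ Nat.clog 2 n := by
  rw [Nat.clog_of_two_le one_lt_two h]
  constructor <;> apply Nat.succ_le_succ <;> apply Nat.clog_mono_right <;> omega

/-- The recursion tree of a nonempty list has `2 n - 1` nodes with `6` steps each for taking and
releasing `3` words. Merging costs `5` steps per element on each level, and `Nat.clog` drops by at
least one under halving (`clog_half`). -/
lemma exists_runs_mergeSortOp (le : β → β → Bool)
    (trans : ∀ a b c, le a b = true → le b c = true → le a c = true)
    (tot : ∀ a b, (le a b || le b a) = true) (xs : List β) :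
    ∃ ys, ys.Perm xs ∧ ys.Pairwise (fun a b => le a b = true) ∧
      ∀ x, Runs (mergeSortOp 2 le xs) ys (6 + 12 * (xs.length - 1) + 5 * xs.length * Nat.clog 2 xs.length)
        [] x x (x + 3 + 5 * xs.length) := by
  induction hn : xs.length using Nat.strong_induction_on generalizing xs with
  | _ n ih =>
  subst hn
  rw [mergeSortOp]
  by_cases h : xs.length ≤ 1
  · refine ⟨xs, List.Perm.refl _, ?_, fun x => ?_⟩
    · match xs, h with
      | [], _ => simp
      | [a], _ => simp
    · simp only [h, dite_true]
      refine Runs.congr ((Runs.alloc 3 x).bind ((Runs.pure _ _).bind ((Runs.release 3 _).bind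
        (Runs.pure _ _)))) rfl rfl ?_ ?_ ?_ <;> omega
  · have h2 : 2 ≤ xs.length := by omega
    have l1 : (xs.take (xs.length / 2)).length = xs.length / 2 := by
      rw [List.length_take]; omega
    have l2 : (xs.drop (xs.length / 2)).length = xs.length - xs.length / 2 := by
      rw [List.length_drop]
    obtain ⟨ys, hys, sys, rys⟩ := ih _ (by rw [l1]; omega) (xs.take (xs.length / 2)) rfl
    obtain ⟨zs, hzs, szs, rzs⟩ := ih _ (by rw [l2]; omega) (xs.drop (xs.length / 2)) rfl
    refine ⟨ys.merge zs le, ?_, List.pairwise_merge trans tot _ _ sys szs, fun x => ?_⟩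
    · refine (List.merge_perm_append le).trans ((hys.append hzs).trans ?_)
      rw [List.take_append_drop]
    · simp only [h, dite_false]
      have c := clog_half h2
      have hl : ys.length + zs.length = xs.length := by
        rw [hys.length_eq, hzs.length_eq, l1, l2]; omega
      have r := runs_mergeOp 2 le ys zs (x + 3)
      rw [hl] at r
      refine Runs.congr ((Runs.alloc 3 x).bind ((rys _).bind ((rzs _).bind (r.bind ((Runs.release 3 _).bind
        (Runs.pure _ _)))))) rfl rfl ?_ ?_ ?_
      · rw [l1, l2]
        have e : xs.length * Nat.clog 2 xs.length = (xs.length / 2) * Nat.clog 2 xs.length +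
            (xs.length - xs.length / 2) * Nat.clog 2 xs.length := by
          rw [← add_mul]; congr 1; omega
        have e1 := Nat.mul_le_mul_left (xs.length / 2) c.1
        have e2 := Nat.mul_le_mul_left (xs.length - xs.length / 2) c.2
        rw [mul_add_one] at e1 e2
        simp only [mul_assoc]
        omega
      · omega
      · rw [l1, l2]; omega

/-- By `hp` the entries satisfying `p` form a prefix, whose length is `arr.countP p`; the loop
invariant is that this number stays between `lo` and `hi`. -/
lemma exists_runs_binarySearch (arr : List β) (p : β → Bool)
    (hp : arr.Pairwise fun a b => p b = true → p a = true) (lo hi : ℕ) (hlo : lo ≤ arr.countP p)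
    (hhi : arr.countP p ≤ hi) (hl : hi ≤ arr.length) (x : ℕ) :
    Runs (binarySearch arr p lo hi) (arr.countP p) (2 + Nat.log 2 (hi - lo)) [] x x 0 := by
  have key : ∀ i (h : i < arr.length), p arr[i] = true ↔ i < arr.countP p := by
    clear hhi hlo hl
    induction arr with
    | nil => simp
    | cons a arr ih =>
      rw [List.pairwise_cons] at hp
      intro i h
      by_cases ha : p a = true
      · rw [List.countP_cons_of_pos ha]
        cases i with
        | zero => simpa using ha
        | succ i => simpa using ih hp.2 i (by simpa using h)
      · have h0 : (a :: arr).countP p = 0 := by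
          rw [List.countP_eq_zero]
          intro b hb hpb
          rcases List.mem_cons.1 hb with rfl | hb
          · exact ha hpb
          · exact ha (hp.1 b hb hpb)
        rw [h0]
        simp only [not_lt_zero, iff_false]
        cases i with
        | zero => simpa using ha
        | succ i => exact fun hb => ha (hp.1 _ (List.getElem_mem _) hb)
  induction hn : hi - lo using Nat.strong_induction_on generalizing lo hi with
  | _ n ih =>
  rw [binarySearch]
  by_cases h : lo < hi
  · simp only [h, dite_true]
    have hm : (lo + hi) / 2 < arr.length := by omega
    have kk := key _ hm
    rw [List.getElem?_eq_getElem hm]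
    have hlog : ∀ d, d < n → (d ≤ n / 2) → 1 ≤ d → Nat.log 2 d + 1 ≤ Nat.log 2 n := by
      intro d _ h2 h3
      rw [Nat.log_of_one_lt_of_le one_lt_two (by omega : 2 ≤ n)]
      exact Nat.succ_le_succ (Nat.log_mono_right h2)
    -- An empty interval is treated directly: it takes a single step, whereas the general bound `2 +
    -- Nat.log 2 0` would be one too large when `n = 1`.
    have step : ∀ lo' hi', hi' - lo' < n → hi' - lo' ≤ n / 2 → lo' ≤ arr.countP p →
        arr.countP p ≤ hi' → hi' ≤ arr.length →
        Runs (binarySearch arr p lo' hi') (arr.countP p) (1 + Nat.log 2 n) [] x x 0 := by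
      intro lo' hi' h1 h2 h3 h4 h5
      by_cases hd : 1 ≤ hi' - lo'
      · refine (ih _ h1 lo' hi' h3 h4 h5 rfl).mono ?_ le_rfl le_rfl
        have := hlog _ h1 h2 hd
        omega
      · rw [binarySearch]
        have : ¬ lo' < hi' := by omega
        simp only [this, dite_false]
        exact Runs.congr ((Runs.tick 1 x).bind (Runs.pure _ _)) (by omega) rfl (by omega) le_rfl le_rfl
    refine Runs.congr ((Runs.tick 1 x).bind (Runs.ite (fun hpm => ?_) (fun hpm => ?_))) rfl rfl
      (t := 1 + (1 + Nat.log 2 n)) (by omega) le_rfl le_rfl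
    · rw [kk] at hpm
      exact step _ _ (by omega) (by omega) (by omega) hhi hl
    · rw [kk] at hpm
      exact step _ _ (by omega) (by omega) hlo (by omega) (by omega)
  · simp only [h, dite_false]
    exact Runs.congr ((Runs.tick 1 x).bind (Runs.pure _ _)) (by omega) rfl (by omega) le_rfl le_rfl

end Sorting

/-! ### The hash maps of start times -/

section HashMaps

variable {T : Type} [LinearOrder T]

/-- The stored pairs `(t_s, t_a)`. -/
def HP.flat (hp : HP T) : Multiset (T × T) :=
  HMap.total (fun k (a : List T) => (a : Multiset T).map (Prod.mk k)) hp

/-- Nonempty arrays make the memory at most `3` words per stored wedge and every probed size at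
least `1`; ascending arrays justify both the binary searches and popping from the end. -/
structure HP.WF (hp : HP T) : Prop where
  nodup : (hp.map Prod.fst).Nodup
  ne_nil : ∀ p ∈ hp, p.2 ≠ []
  sorted : ∀ p ∈ hp, p.2.Pairwise (· ≤ ·)

lemma HP.words_eq (hp : HP T) :
    hp.words = HMap.total (fun _ (a : List T) => 2 + a.length) hp := rfl

lemma HP.WF.nil : HP.WF ([] : HP T) := ⟨by simp, by simp, by simp⟩

@[simp] lemma HP.flat_nil : HP.flat ([] : HP T) = 0 := rfl

lemma HP.flat_cons (p : T × List T) (hp : HP T) :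
    HP.flat (p :: hp) = (p.2 : Multiset T).map (Prod.mk p.1) + HP.flat hp :=
  HMap.total_cons _ p hp

lemma HP.mem_flat {hp : HP T} {y : T × T} : y ∈ hp.flat ↔ ∃ p ∈ hp, p.1 = y.1 ∧ y.2 ∈ p.2 := by
  induction hp with
  | nil => simp
  | cons p hp ih =>
    rw [HP.flat_cons, Multiset.mem_add, ih]
    simp only [List.mem_cons, exists_eq_or_imp, Multiset.mem_map, Multiset.mem_coe]
    refine or_congr ⟨?_, ?_⟩ Iff.rfl
    · rintro ⟨a, ha, rfl⟩
      exact ⟨rfl, ha⟩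
    · rintro ⟨h, h'⟩
      exact ⟨y.2, h', by rw [h]⟩

lemma HP.WF.words_le {hp : HP T} (h : hp.WF) : hp.words ≤ 3 * Multiset.card hp.flat := by
  replace h := h.ne_nil
  rw [HP.words_eq]
  induction hp with
  | nil => simp
  | cons p hp ih =>
    have ih := ih fun q hq => h q (List.mem_cons_of_mem _ hq)
    have := List.length_pos_iff.2 (h p List.mem_cons_self)
    rw [HP.flat_cons, HMap.total_cons, Multiset.card_add, Multiset.card_map, Multiset.coe_card]
    omega

lemma HP.WF.length_pos {hp : HP T} (h : hp.WF) :
    ∀ a ∈ hp.map fun p => p.2.length, 1 ≤ a := by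
  intro a ha
  obtain ⟨p, hp, rfl⟩ := List.mem_map.1 ha
  exact List.length_pos_iff.2 (h.ne_nil p hp)

lemma HP.sum_length (hp : HP T) :
    (hp.map fun p => p.2.length).sum = Multiset.card hp.flat := by
  induction hp with
  | nil => rfl
  | cons p hp ih => simp [HP.flat_cons, ih]

/-- The array at `x.1` stays ascending because `hx` makes the appended value its maximum. -/
lemma exists_runs_insert {hp : HP T} (h : hp.WF) (x : T × T)
    (hx : ∀ y ∈ hp.flat, y.1 = x.1 → y.2 ≤ x.2) :
    ∃ hp' : HP T, hp'.WF ∧ hp'.flat = x ::ₘ hp.flat ∧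
      ∀ k, Runs (insert x hp) hp' 5 [] (k + hp.words) (k + hp'.words) (k + hp'.words) := by
  refine ⟨HMap.set hp x.1 (hp.valueD x.1 [] ++ [x.2]), ⟨HMap.nodup_set h.nodup _ _, ?_, ?_⟩, ?_,
    fun k => ?_⟩
  · intro p hp'
    rcases HMap.mem_set hp' with rfl | hp'
    · simp
    · exact h.ne_nil p hp'
  · intro p hp'
    rcases HMap.mem_set hp' with rfl | hp'
    · rw [List.pairwise_append]
      by_cases hk : x.1 ∈ hp.map Prod.fst
      · have hm := HMap.mem_valueD hk []
        refine ⟨h.sorted _ hm, by simp, fun a ha b hb => ?_⟩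
        rw [List.mem_singleton.1 hb]
        exact hx (x.1, a) (HP.mem_flat.2 ⟨_, hm, rfl, ha⟩) rfl
      · rw [HMap.valueD_of_notMem hk]
        simp
    · exact h.sorted p hp'
  · have := HMap.total_set (fun k (a : List T) => (a : Multiset T).map (Prod.mk k)) h.nodup x.1
      (hp.valueD x.1 [] ++ [x.2]) [] (by simp)
    rw [← Multiset.coe_add, Multiset.map_add, add_left_comm, add_comm] at this
    rw [HP.flat, add_left_cancel this, HP.flat]
    simp [← Multiset.singleton_add, add_comm]
  · have e : HP.words (HMap.set hp x.1 (hp.valueD x.1 [] ++ [x.2])) =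
        hp.words + 1 + if x.1 ∈ hp.map Prod.fst then 0 else 2 := by
      rw [HP.words_eq, HP.words_eq]
      split_ifs with hk
      · have := HMap.total_set_of_mem (fun _ (a : List T) => 2 + a.length) h.nodup hk
          (hp.valueD x.1 [] ++ [x.2]) []
        rw [List.length_append, List.length_singleton] at this
        omega
      · rw [HMap.total_set_of_notMem _ hk, HMap.valueD_of_notMem hk]
        simp
    refine Runs.congr ((HMap.runs_get _ _ _ _).bind ((Runs.alloc 1 _).bind
      (HMap.runs_put _ _ _ _))) rfl rfl ?_ ?_ ?_
    · omega
    · rw [e]; omega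
    · rw [e]; omega

/-- `R` stands for the wedges that are listed in `kept` but not yet stored. They arrive by `bound`,
so an expired head of `kept` must be stored; since `kept` is sorted by decreasing arrival, all
expired wedges come first and each costs a constant number of steps. -/
lemma exists_runs_delete (bound : T) (kept : List (T × T)) {hp : HP T} (h : hp.WF)
    (hs : kept.Pairwise fun a b => arrivalGe a b = true) (R : Multiset (T × T))
    (hk : (kept : Multiset (T × T)) = hp.flat + R) (hR : ∀ y ∈ R, y.2 ≤ bound) :
    ∃ (kept' : List (T × T)) (hp' : HP T) (D : Multiset (T × T)), hp'.WF ∧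
      (kept'.Pairwise fun a b => arrivalGe a b = true) ∧
      (kept' : Multiset (T × T)) = hp'.flat + R ∧ hp.flat = hp'.flat + D ∧
      (∀ y ∈ D, bound < y.2) ∧ (∀ y ∈ hp'.flat, y.2 ≤ bound) ∧
      ∀ k, Runs (delete bound kept hp) (kept', hp') (1 + 6 * Multiset.card D) []
        (k + hp.words) (k + hp'.words) (k + hp.words) := by
  induction kept generalizing hp with
  | nil =>
    have h0 : hp.flat = 0 := by
      have := congrArg Multiset.card hk
      rw [Multiset.card_add, Multiset.coe_card, List.length_nil] at this
      exact Multiset.card_eq_zero.1 (by omega)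
    refine ⟨[], hp, 0, h, hs, hk, by simp, by simp, by simp [h0], fun k => ?_⟩
    exact Runs.congr ((Runs.tick 1 _).bind (Runs.pure _ _)) rfl rfl (by omega) (by omega) (by omega)
  | cons y ys ih =>
    rw [List.pairwise_cons] at hs
    by_cases hb : bound < y.2
    · have hy : y ∈ hp.flat := by
        have : y ∈ hp.flat + R := by rw [← hk]; simp
        rcases Multiset.mem_add.1 this with h' | h'
        · exact h'
        · exact absurd (hR y h') (not_le.2 hb)
      have hmax : ∀ z ∈ hp.flat, z.2 ≤ y.2 := by
        intro z hz
        have : z ∈ (↑(y :: ys) : Multiset (T × T)) := by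
          rw [hk]; exact Multiset.mem_add.2 (Or.inl hz)
        rcases List.mem_cons.1 (Multiset.mem_coe.1 this) with rfl | hz
        · exact le_rfl
        · simpa [arrivalGe] using hs.1 z hz
      have hkey : y.1 ∈ hp.map Prod.fst := by
        obtain ⟨p, hp1, hp2, _⟩ := HP.mem_flat.1 hy
        exact List.mem_map.2 ⟨p, hp1, hp2⟩
      set a := hp.valueD y.1 [] with ha
      have hm : (y.1, a) ∈ hp := HMap.mem_valueD hkey []
      have hya : y.2 ∈ a := by
        obtain ⟨p, hp1, hp2, hp3⟩ := HP.mem_flat.1 hy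
        have : p = (y.1, a) := List.inj_on_of_nodup_map h.nodup hp1 hm hp2
        rwa [this] at hp3
      have hane : a ≠ [] := List.ne_nil_of_mem hya
      -- The head of `kept` has the largest arrival among all stored wedges, so it equals the last
      -- entry of its own ascending array.
      have hlast : a = a.dropLast ++ [y.2] := by
        have e := List.dropLast_append_getLast hane
        have hsrt : (a.dropLast ++ [a.getLast hane]).Pairwise (· ≤ ·) := by
          rw [e]; exact h.sorted _ hm
        have h1 : a.getLast hane ≤ y.2 :=
          hmax (y.1, a.getLast hane) (HP.mem_flat.2 ⟨_, hm, rfl, List.getLast_mem hane⟩)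
        have h2 : y.2 ≤ a.getLast hane := by
          rw [← e] at hya
          rcases List.mem_append.1 hya with h' | h'
          · exact (List.pairwise_append.1 hsrt).2.2 _ h' _ (by simp)
          · rw [List.mem_singleton.1 h']
        rw [← le_antisymm h1 h2]
        exact e.symm
      have hlen : a.length = a.dropLast.length + 1 := by
        conv_lhs => rw [hlast]
        simp
      obtain ⟨hp₁, w₁, f₁, wd₁, r₁⟩ : ∃ hp₁ : HP T, hp₁.WF ∧ hp.flat = y ::ₘ hp₁.flat ∧
          hp₁.words + 1 ≤ hp.words ∧ ∀ k, Runs (if a.dropLast = [] then HMap.remove hp y.1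
            else HMap.put hp y.1 a.dropLast) hp₁ 3 [] (k + hp.words - 1) (k + hp₁.words)
            (k + hp.words - 1) := by
        have hsplit : (a : Multiset T).map (Prod.mk y.1) =
            (a.dropLast : Multiset T).map (Prod.mk y.1) + {y} := by
          conv_lhs => rw [hlast]
          rw [← Multiset.coe_add, Multiset.map_add]
          rfl
        by_cases hd : a.dropLast = []
        · rw [if_pos hd]
          have e1 := HMap.total_erase (fun k (a : List T) => (a : Multiset T).map (Prod.mk k))
            h.nodup hkey []
          have e2 := HMap.total_erase (fun _ (a : List T) => 2 + a.length) h.nodup hkey []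
          rw [← ha] at e1 e2
          have e3 : HP.words (HMap.erase hp y.1) = _ := HP.words_eq _
          rw [← e3, ← HP.words_eq] at e2
          rw [hd, List.length_nil] at hlen
          refine ⟨HMap.erase hp y.1, ⟨HMap.nodup_erase h.nodup _, fun p hp' =>
            h.ne_nil p (List.mem_of_mem_filter hp'), fun p hp' =>
            h.sorted p (List.mem_of_mem_filter hp')⟩, ?_, by omega, fun k => ?_⟩
          · rw [HP.flat, ← e1, hsplit, hd]
            simp [← Multiset.singleton_add, add_comm, HP.flat]
          · refine Runs.congr (HMap.runs_remove hp y.1 _) rfl rfl le_rfl ?_ (by omega)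
            rw [if_pos hkey]
            omega
        · rw [if_neg hd]
          have e1 := HMap.total_set (fun k (a : List T) => (a : Multiset T).map (Prod.mk k))
            h.nodup y.1 a.dropLast [] (by simp)
          have e2 := HMap.total_set_of_mem (fun _ (a : List T) => 2 + a.length) h.nodup hkey
            a.dropLast []
          rw [← ha] at e1 e2
          have e3 : HP.words (HMap.set hp y.1 a.dropLast) = _ := HP.words_eq _
          rw [← e3, ← HP.words_eq] at e2
          refine ⟨HMap.set hp y.1 a.dropLast, ⟨HMap.nodup_set h.nodup _ _, fun p hp' => ?_,
            fun p hp' => ?_⟩, ?_, by omega, fun k => ?_⟩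
          · rcases HMap.mem_set hp' with rfl | hp'
            · exact hd
            · exact h.ne_nil p hp'
          · rcases HMap.mem_set hp' with rfl | hp'
            · exact (h.sorted _ hm).sublist (List.dropLast_sublist _)
            · exact h.sorted p hp'
          · rw [hsplit, add_left_comm, add_comm (HMap.total _ hp)] at e1
            have := add_left_cancel e1
            rw [HP.flat, ← this, add_comm, Multiset.singleton_add, HP.flat]
          · refine Runs.congr (HMap.runs_put hp y.1 _ _) rfl rfl le_rfl ?_ ?_ <;>
            rw [if_pos hkey] <;> omega
      have hk₁ : (ys : Multiset (T × T)) = hp₁.flat + R := by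
        rw [f₁, ← Multiset.cons_coe, Multiset.cons_add] at hk
        exact (Multiset.cons_inj_right y).1 hk
      obtain ⟨kept', hp', D, w', s', k', f', d', b', r'⟩ := ih w₁ hs.2 hk₁
      refine ⟨kept', hp', y ::ₘ D, w', s', k', ?_, ?_, b', fun k => ?_⟩
      · rw [f₁, f', Multiset.add_cons]
      · intro z hz
        rcases Multiset.mem_cons.1 hz with rfl | hz
        · exact hb
        · exact d' z hz
      · rw [delete]
        refine Runs.congr ((Runs.tick 1 _).bind (Runs.ite (fun _ =>
          (HMap.runs_get _ _ _ _).bind ((Runs.release 1 _).bind (Runs.ite_bind (r₁ k) (r' k))))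
          (fun h' => absurd hb h'))) rfl rfl ?_ le_rfl ?_
        · rw [Multiset.card_cons]; omega
        · omega
    · have hle : ∀ z ∈ hp.flat, z.2 ≤ bound := by
        intro z hz
        have : z ∈ (↑(y :: ys) : Multiset (T × T)) := by
          rw [hk]; exact Multiset.mem_add.2 (Or.inl hz)
        rcases List.mem_cons.1 (Multiset.mem_coe.1 this) with rfl | hz
        · exact not_lt.1 hb
        · have : z.2 ≤ y.2 := by simpa [arrivalGe] using hs.1 z hz
          exact this.trans (not_lt.1 hb)
      refine ⟨y :: ys, hp, 0, h, List.pairwise_cons.2 hs, hk, by simp, by simp, hle, fun k => ?_⟩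
      rw [delete]
      refine Runs.congr ((Runs.tick 1 _).bind (Runs.ite (fun h' => absurd h' hb)
        (fun _ => Runs.pure _ _))) rfl rfl ?_ ?_ ?_ <;> omega

end HashMaps

/-! ### Queries -/

section Queries

variable {T : Type} [LinearOrder T]

/-- The contribution to the counters of the pair of a queried wedge `x` and a stored wedge `y`. -/
def hit (upper : Bool) (c₁ c₂ c₃ : Fin 6) (x y : T × T) : Counts :=
  if x.2 < y.1 then Pi.single (convert upper c₁) 1
  else if y.1 < x.2 then
    if x.2 < y.2 then Pi.single (convert upper c₂) 1
    else if y.2 < x.2 then Pi.single (convert upper c₃) 1 else 0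
  else 0

lemma runs_bump (upper : Bool) (i : Fin 6) (n : ℕ) (C : Counts) (x : ℕ) :
    Runs (bump upper i n C) (C + Pi.single (convert upper i) n) 1 [] x x 0 := by
  refine Runs.congr ((Runs.tick 1 x).bind (Runs.pure _ x)) ?_ rfl le_rfl le_rfl le_rfl
  funext j
  by_cases h : j = convert upper i
  · subst h; simp
  · simp [h]

/-- The whole time spent on one array is absorbed into its entry in the list of probed sizes. The
term `8 + 2 log a` covers two binary searches of `2 + log a` steps, two updates of counters, the
probe and one comparison. -/
lemma Runs.probe_bind {β : Type} {p : Prog β} {b : β} {t x y s a : ℕ} (h : Runs p b t [] x y s)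
    (ht : t + 1 ≤ 8 + 2 * Nat.log 2 a) : Runs (probe >>= fun _ => p) b 0 [a] x y s := by
  intro m
  obtain ⟨h1, h2, h3, h4⟩ := h ⟨m.time + 1, m.live, m.peak, m.probes + 1⟩
  refine ⟨h1, ?_, ?_, h4⟩
  · refine h2.trans ?_
    simp only [searchCost, List.map_nil, List.sum_nil, List.map_cons, List.sum_cons]
    omega
  · exact h3

lemma sum_single_map (i : Fin 6) (l : List T) (p : T → Prop) [DecidablePred p] :
    (l.map fun y => if p y then (Pi.single i 1 : Counts) else 0).sum =
      Pi.single i (l.countP fun y => decide (p y)) := by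
  induction l with
  | nil => simp
  | cons a l ih =>
    rw [List.map_cons, List.sum_cons, ih, List.countP_cons]
    by_cases h : p a <;> simp [h, ← Pi.single_add, add_comm]

/-- The time is `0` because everything is charged to the arrays, which are all inspected. -/
lemma runs_queryHP (upper : Bool) (c₁ c₂ c₃ : Fin 6) (x : T × T) {hp : HP T} (h : hp.WF)
    (C : Counts) (k : ℕ) :
    Runs (queryHP upper c₁ c₂ c₃ x hp C) (C + (hp.flat.map (hit upper c₁ c₂ c₃ x)).sum) 0
      (hp.map fun p => p.2.length) k k 0 := by
  replace h := h.sorted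
  unfold queryHP
  induction hp generalizing C with
  | nil => exact (Runs.pure C k).congr (by simp) rfl le_rfl le_rfl le_rfl
  | cons p hp ih =>
    have hs := h p List.mem_cons_self
    have ih := fun C => ih C fun q hq => h q (List.mem_cons_of_mem _ hq)
    rw [List.foldlM_cons]
    have body : Runs (do
        probe
        tick 1
        if x.2 < p.1 then bump upper c₁ p.2.length C
        else if p.1 < x.2 then do
          let m ← binarySearch p.2 (fun y => decide (y ≤ x.2)) 0 p.2.length
          let C ← bump upper c₂ (p.2.length - m) C
          let n ← binarySearch p.2 (fun y => decide (y < x.2)) 0 p.2.length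
          bump upper c₃ n C
        else pure C)
        (C + (p.2.map fun a => hit upper c₁ c₂ c₃ x (p.1, a)).sum) 0 [p.2.length] k k 0 := by
      refine Runs.probe_bind (t := 7 + 2 * Nat.log 2 p.2.length) ?_ (by omega)
      refine Runs.congr ((Runs.tick 1 k).bind (Runs.ite (t := 6 + 2 * Nat.log 2 p.2.length)
        (s := 0) (L := []) (y := k) (fun h1 => ?_) (fun h1 =>
        Runs.ite (fun h2 => ?_) (fun h2 => ?_)))) rfl rfl (by omega) le_rfl (by omega)
      · refine (runs_bump _ _ _ _ _).congr ?_ rfl (by omega) le_rfl le_rfl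
        simp only [hit, h1, if_true, List.map_const', List.sum_replicate]
        rw [← Pi.single_nsmul]
        simp
      · have b1 := exists_runs_binarySearch p.2 (fun y => decide (y ≤ x.2))
          (hs.imp fun {a b} hab hb => by simp only [decide_eq_true_eq] at *; exact hab.trans hb)
          0 p.2.length (Nat.zero_le _) List.countP_le_length le_rfl k
        have b2 := exists_runs_binarySearch p.2 (fun y => decide (y < x.2))
          (hs.imp fun {a b} hab hb => by simp only [decide_eq_true_eq] at *; exact hab.trans_lt hb)
          0 p.2.length (Nat.zero_le _) List.countP_le_length le_rfl k
        refine Runs.congr (b1.bind ((runs_bump _ _ _ _ _).bind (b2.bind (runs_bump _ _ _ _ _))))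
          ?_ rfl ?_ le_rfl ?_
        · rw [add_assoc]
          congr 1
          -- Both comparisons are strict: the entries after the first search arrive later than `x`,
          -- those before the second one earlier, and equal arrival times are counted by neither.
          have e : ∀ a : T, hit upper c₁ c₂ c₃ x (p.1, a) =
              (if x.2 < a then (Pi.single (convert upper c₂) 1 : Counts) else 0) +
              (if a < x.2 then (Pi.single (convert upper c₃) 1 : Counts) else 0) := by
            intro a
            simp only [hit, h1, h2, if_true, if_false]
            rcases lt_trichotomy x.2 a with h3 | h3 | h3
            · simp [h3, h3.le.not_gt]
            · simp [h3]
            · simp [h3, h3.le.not_gt]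
          simp only [e]
          rw [List.sum_map_add, sum_single_map, sum_single_map]
          congr 2
          have := List.length_eq_countP_add_countP (fun y => decide (y ≤ x.2)) (l := p.2)
          rw [this, Nat.add_sub_cancel_left]
          apply List.countP_congr
          intro a _
          simp
        · simp only [Nat.sub_zero]; omega
        · omega
      · refine (Runs.pure C k).congr ?_ rfl (by omega) le_rfl le_rfl
        simp [hit, h1, h2]
    refine Runs.congr (body.bind (ih _)) ?_ rfl le_rfl le_rfl le_rfl
    rw [HP.flat_cons, Multiset.map_add, Multiset.sum_add, Multiset.map_map, add_assoc]
    rfl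

/-- The contribution of a queried wedge `x` and the wedges `M` and `N` stored in the two hash maps
of the other set. -/
def hits (upper : Bool) (M N : Multiset (T × T)) (x : T × T) : Counts :=
  (M.map (hit upper 0 1 2 x)).sum + (N.map (hit upper 3 4 5 x)).sum

/-- Each queried wedge inspects all arrays of both hash maps, so the sizes add up exactly to the
number of pairs of a queried and a stored wedge. -/
lemma exists_runs_queryBatch (upper : Bool) (s : T) {same opp : HP T} (hs : same.WF)
    (ho : opp.WF) (todo : List (T × T)) :
    ∃ L : List ℕ, (∀ a ∈ L, 1 ≤ a) ∧
      L.sum = (todo.takeWhile fun x => decide (x.1 = s)).length *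
        (Multiset.card same.flat + Multiset.card opp.flat) ∧
      ∀ C k, Runs (queryBatch upper s same opp todo C)
        (todo.dropWhile fun x => decide (x.1 = s),
          C + ((todo.takeWhile fun x => decide (x.1 = s)).map
            (hits upper same.flat opp.flat)).sum)
        (1 + 2 * (todo.takeWhile fun x => decide (x.1 = s)).length) L k k 0 := by
  induction todo with
  | nil =>
    refine ⟨[], by simp, by simp, fun C k => ?_⟩
    exact Runs.congr ((Runs.tick 1 k).bind (Runs.pure _ k)) (by simp) rfl (by simp) le_rfl le_rfl
  | cons x xs ih =>
    by_cases hx : x.1 = s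
    · obtain ⟨L, hL1, hL2, hL⟩ := ih
      refine ⟨(same.map fun p => p.2.length) ++ ((opp.map fun p => p.2.length) ++ L), ?_, ?_,
        fun C k => ?_⟩
      · intro a ha
        rcases List.mem_append.1 ha with h | h
        · exact hs.length_pos a h
        · rcases List.mem_append.1 h with h | h
          · exact ho.length_pos a h
          · exact hL1 a h
      · rw [List.takeWhile_cons_of_pos (by simpa using hx), List.length_cons, List.sum_append,
          List.sum_append, hL2, HP.sum_length, HP.sum_length]
        ring
      · rw [queryBatch, List.takeWhile_cons_of_pos (by simpa using hx), List.dropWhile_cons_of_pos (by simpa using hx)]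
        have q : Runs (query upper x same opp C) _ _ _ k k _ := (Runs.tick 1 k).bind
          ((runs_queryHP upper 0 1 2 x hs C k).bind (runs_queryHP upper 3 4 5 x ho _ k))
        refine Runs.congr ((Runs.tick 1 k).bind (Runs.ite (fun _ => q.bind (hL _ k))
          (fun h => absurd hx h))) ?_ ?_ ?_ le_rfl ?_
        · rw [List.map_cons, List.sum_cons, hits]
          simp only [add_assoc]
        · simp
        · simp; omega
        · omega
    · refine ⟨[], by simp, ?_, fun C k => ?_⟩
      · rw [List.takeWhile_cons_of_neg (by simpa using hx)]
        simp
      · rw [queryBatch, List.takeWhile_cons_of_neg (by simpa using hx), List.dropWhile_cons_of_neg (by simpa using hx)]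
        exact Runs.congr ((Runs.tick 1 k).bind (Runs.ite (fun h => absurd h hx)
          (fun _ => Runs.pure _ k))) (by simp) rfl (by simp) le_rfl le_rfl

/-- Among equal start times the priority order is by increasing arrival, so successive insertions
append to ascending arrays; `hx` covers the wedges stored before. -/
lemma exists_runs_insertBatch (s : T) (todo : List (T × T)) {hp : HP T} (h : hp.WF)
    (hs : todo.Pairwise fun a b => priorityLe a b = true)
    (hx : ∀ y ∈ hp.flat, ∀ x ∈ todo, y.1 = x.1 → y.2 ≤ x.2) :
    ∃ hp' : HP T, hp'.WF ∧
      hp'.flat = hp.flat + (todo.takeWhile fun x => decide (x.1 = s) : List (T × T)) ∧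
      ∀ k, Runs (insertBatch s todo hp) hp'
        (1 + 6 * (todo.takeWhile fun x => decide (x.1 = s)).length) []
        (k + hp.words) (k + hp'.words) (k + 3 * Multiset.card hp'.flat) := by
  induction todo generalizing hp with
  | nil =>
    refine ⟨hp, h, by simp, fun k => ?_⟩
    exact Runs.congr ((Runs.tick 1 _).bind (Runs.pure _ _)) rfl rfl (by simp) le_rfl (by omega)
  | cons x xs ih =>
    rw [List.pairwise_cons] at hs
    by_cases hxs : x.1 = s
    · obtain ⟨hp₁, w₁, f₁, r₁⟩ := exists_runs_insert h x
        (fun y hy => hx y hy x List.mem_cons_self)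
      obtain ⟨hp₂, w₂, f₂, r₂⟩ := ih w₁ hs.2 (by
        intro y hy z hz hyz
        rw [f₁] at hy
        rcases Multiset.mem_cons.1 hy with rfl | hy
        · have := hs.1 z hz
          simp only [priorityLe, decide_eq_true_eq] at this
          rcases this with h' | h'
          · exact absurd hyz h'.ne'
          · exact h'.2
        · exact hx y hy z (List.mem_cons_of_mem _ hz) hyz)
      refine ⟨hp₂, w₂, ?_, fun k => ?_⟩
      · rw [f₂, f₁, List.takeWhile_cons_of_pos (by simpa using hxs), ← Multiset.cons_coe,
          Multiset.cons_add, Multiset.add_cons]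
      · rw [insertBatch, List.takeWhile_cons_of_pos (by simpa using hxs)]
        have c : Multiset.card hp₁.flat ≤ Multiset.card hp₂.flat := by
          rw [f₂, Multiset.card_add]; omega
        have := w₁.words_le
        refine Runs.congr ((Runs.tick 1 _).bind (Runs.ite (fun _ => (r₁ k).bind (r₂ k))
          (fun h => absurd hxs h))) rfl rfl ?_ le_rfl ?_
        · rw [List.length_cons]; omega
        · omega
    · refine ⟨hp, h, ?_, fun k => ?_⟩
      · rw [List.takeWhile_cons_of_neg (by simpa using hxs)]
        simp
      · rw [insertBatch, List.takeWhile_cons_of_neg (by simpa using hxs)]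
        exact Runs.congr ((Runs.tick 1 _).bind (Runs.ite (fun h => absurd h hxs)
          (fun _ => Runs.pure _ _))) rfl rfl (by simp) le_rfl (by omega)

end Queries

/-! ### Combining two wedge sets -/

section Cross

variable {α : Type}

/-- The sum of `f x y` over `x ∈ M` and `y ∈ N`. -/
def cross (f : α → α → Counts) (M N : Multiset α) : Counts :=
  (M.map fun x => (N.map (f x)).sum).sum

lemma cross_add_left (f : α → α → Counts) (M M' N : Multiset α) :
    cross f (M + M') N = cross f M N + cross f M' N := by simp [cross]

lemma cross_add_right (f : α → α → Counts) (M N N' : Multiset α) :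
    cross f M (N + N') = cross f M N + cross f M N' := by simp [cross, Multiset.sum_map_add]

lemma cross_congr {f g : α → α → Counts} {M N : Multiset α}
    (h : ∀ x ∈ M, ∀ y ∈ N, f x y = g x y) : cross f M N = cross g M N := by
  unfold cross
  refine congrArg _ (Multiset.map_congr rfl fun x hx => ?_)
  exact congrArg _ (Multiset.map_congr rfl fun y hy => h x hx y hy)

lemma cross_eq_zero {f : α → α → Counts} {M N : Multiset α}
    (h : ∀ x ∈ M, ∀ y ∈ N, f x y = 0) : cross f M N = 0 := by
  rw [cross_congr (g := fun _ _ => 0) h]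
  simp [cross]

@[simp] lemma cross_zero_left (f : α → α → Counts) (N : Multiset α) : cross f 0 N = 0 := by
  simp [cross]

@[simp] lemma cross_zero_right (f : α → α → Counts) (M : Multiset α) : cross f M 0 = 0 := by
  simp [cross]

end Cross

/-! ### Directions of wedges, batches of equal start time, and the balance of one round. -/

section Lanes

variable {T : Type} [LinearOrder T]

/-- The wedges of a set, with `true` for the forward and `false` for the backward ones. -/
def tag (A D : Multiset (T × T)) : Multiset (Bool × T × T) :=
  A.map (Prod.mk true) + D.map (Prod.mk false)

lemma tag_add (A A' D D' : Multiset (T × T)) : tag (A + A') (D + D') = tag A D + tag A' D' := by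
  simp only [tag, Multiset.map_add]
  abel

@[simp] lemma card_tag (A D : Multiset (T × T)) :
    Multiset.card (tag A D) = Multiset.card A + Multiset.card D := by simp [tag]

@[simp] lemma tag_zero : tag (0 : Multiset (T × T)) 0 = 0 := rfl

lemma mem_tag {A D : Multiset (T × T)} {x : Bool × T × T} (h : x ∈ tag A D) :
    x.2 ∈ A ∨ x.2 ∈ D := by
  rcases Multiset.mem_add.1 h with h | h <;> obtain ⟨y, hy, rfl⟩ := Multiset.mem_map.1 h
  · exact Or.inl hy
  · exact Or.inr hy

/-- The contribution of two wedges, the first of which has the earlier start time. -/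
def meetAny (upper : Bool) (x y : Bool × T × T) : Counts :=
  if x.1 = y.1 then hit upper 0 1 2 x.2 y.2 else hit upper 3 4 5 x.2 y.2

/-- The `Bool` tag replaces the four subsets: the choice between `same` and `opp` in a query becomes
a comparison of tags. -/
lemma cross_meetAny (upper : Bool) (A D A' D' : Multiset (T × T)) :
    cross (meetAny upper) (tag A D) (tag A' D') =
      (A.map (hits upper A' D')).sum + (D.map (hits upper D' A')).sum := by
  unfold cross tag
  rw [Multiset.map_add, Multiset.sum_add, Multiset.map_map, Multiset.map_map]
  congr 1
  · refine congrArg _ (Multiset.map_congr rfl fun x _ => ?_)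
    simp only [Function.comp, Multiset.map_add, Multiset.sum_add, Multiset.map_map, meetAny, hits,
      if_true]
    congr 1
  · refine congrArg _ (Multiset.map_congr rfl fun x _ => ?_)
    simp only [Function.comp, Multiset.map_add, Multiset.sum_add, Multiset.map_map, meetAny, hits,
      if_true]
    rw [add_comm]
    congr 1

/-- The next wedges to be processed, if they have the start time `s`. -/
def batch (s : T) (l : List (T × T)) : List (T × T) := l.takeWhile fun x => decide (x.1 = s)

def rest (s : T) (l : List (T × T)) : List (T × T) := l.dropWhile fun x => decide (x.1 = s)

lemma batch_add_rest (s : T) (l : List (T × T)) :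
    (l : Multiset (T × T)) = (batch s l : Multiset (T × T)) + (rest s l : Multiset (T × T)) := by
  rw [Multiset.coe_add, batch, rest, List.takeWhile_append_dropWhile]

lemma of_mem_batch {s : T} {l : List (T × T)} {x : T × T} (h : x ∈ batch s l) : x.1 = s := by
  simpa using List.mem_takeWhile_imp h

lemma lt_of_mem_rest {s : T} {l : List (T × T)}
    (hs : l.Pairwise fun a b => priorityLe a b = true) (hl : ∀ x ∈ l, x.1 ≤ s) :
    ∀ x ∈ rest s l, x.1 < s := by
  induction l with
  | nil => simp [rest]
  | cons a l ih =>
    rw [List.pairwise_cons] at hs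
    have hl' := fun x hx => hl x (List.mem_cons_of_mem _ hx)
    by_cases h : a.1 = s
    · rw [rest, List.dropWhile_cons_of_pos (by simpa using h)]
      exact ih hs.2 hl'
    · rw [rest, List.dropWhile_cons_of_neg (by simpa using h)]
      have ha := lt_of_le_of_ne (hl a List.mem_cons_self) h
      intro x hx
      rcases List.mem_cons.1 hx with rfl | hx
      · exact ha
      · have := hs.1 x hx
        simp only [priorityLe, decide_eq_true_eq] at this
        rcases this with h' | h'
        · exact h'.trans ha
        · exact h'.1 ▸ ha

variable [AddCommGroup T]

/-- The contribution of two wedges to the counters, if the first one has the earlier start time and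
both lie within duration `δ`. -/
def meet (upper : Bool) (δ : T) (x y : Bool × T × T) : Counts :=
  if x.2.1 < y.2.1 ∧ y.2.2 ≤ x.2.1 + δ then meetAny upper x y else 0

/-- The equation `kept` is the main invariant: the list ordered by arrival consists of the stored
wedges and the unprocessed ones. -/
structure Lane.WF (δ : T) (b : Lane T) : Prop where
  hp : b.hp.WF
  pri : b.todo.Pairwise fun x y => priorityLe x y = true
  arr : b.kept.Pairwise fun x y => arrivalGe x y = true
  kept : (b.kept : Multiset (T × T)) = b.hp.flat + (b.todo : Multiset (T × T))
  dur : ∀ y ∈ b.todo, y.2 ≤ y.1 + δ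

lemma Lane.WF.card_kept {δ : T} {b : Lane T} (h : b.WF δ) :
    b.kept.length = Multiset.card b.hp.flat + b.todo.length := by
  have := congrArg Multiset.card h.kept
  simpa using this

/-- An unprocessed wedge starts by `s` and lasts at most `δ`, so only stored wedges can expire at
the bound `s + δ`. -/
lemma exists_runs_laneDelete [IsOrderedAddMonoid T] {δ s : T} {b : Lane T} (h : b.WF δ)
    (hs : ∀ x ∈ b.todo, x.1 ≤ s) :
    ∃ (b' : Lane T) (D : Multiset (T × T)), b'.WF δ ∧ b'.todo = b.todo ∧
      b.hp.flat = b'.hp.flat + D ∧ (∀ y ∈ D, s + δ < y.2) ∧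
      (∀ y ∈ b'.hp.flat, y.2 ≤ s + δ) ∧
      ∀ k, Runs (b.delete (s + δ)) b' (1 + 6 * Multiset.card D) [] (k + b.hp.words)
        (k + b'.hp.words) (k + b.hp.words) := by
  obtain ⟨kept', hp', D, w, a, e, f, d, g, r⟩ := exists_runs_delete (s + δ) b.kept h.hp h.arr
    (b.todo : Multiset (T × T)) h.kept (fun y hy => (h.dur y hy).trans (by
      have := hs y hy
      gcongr))
  refine ⟨⟨b.todo, kept', hp'⟩, D, ⟨w, h.pri, a, e, h.dur⟩, rfl, f, d, g, fun k => ?_⟩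
  exact Runs.congr ((r k).bind (Runs.pure _ _)) rfl rfl (by omega) le_rfl (by omega)

lemma exists_runs_laneInsert {δ s : T} {b : Lane T} (h : b.WF δ)
    (hy : ∀ y ∈ b.hp.flat, ∀ x ∈ b.todo, x.1 < y.1) :
    ∃ hp' : HP T, Lane.WF δ ⟨rest s b.todo, b.kept, hp'⟩ ∧
      hp'.flat = b.hp.flat + (batch s b.todo : Multiset (T × T)) ∧
      ∀ k, Runs (insertBatch s b.todo b.hp) hp' (1 + 6 * (batch s b.todo).length) []
        (k + b.hp.words) (k + hp'.words) (k + 3 * b.kept.length) := by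
  obtain ⟨hp', w, f, r⟩ := exists_runs_insertBatch s b.todo h.hp h.pri
    (fun y hy' x hx e => absurd e (hy y hy' x hx).ne')
  have f' : hp'.flat = b.hp.flat + (batch s b.todo : Multiset (T × T)) := f
  have k' : (b.kept : Multiset (T × T)) = hp'.flat + (rest s b.todo : Multiset (T × T)) := by
    rw [h.kept, f', add_assoc, ← batch_add_rest]
  refine ⟨hp', ⟨w, h.pri.sublist (List.dropWhile_sublist _), h.arr, k',
    fun y hy => h.dur y ((List.dropWhile_sublist _).subset hy)⟩, f', fun k => ?_⟩
  refine (r k).congr rfl rfl le_rfl le_rfl ?_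
  have := congrArg Multiset.card k'
  simp only [Multiset.coe_card, Multiset.card_add] at this
  omega

lemma maxStart_eq_none {bs : List (Lane T)} (h : maxStart bs = none) :
    ∀ b ∈ bs, b.todo = [] := by
  intro b hb
  rw [maxStart, List.max?_eq_none_iff, List.filterMap_eq_nil_iff] at h
  simpa using h b hb

/-- The nonempty batch in the second claim makes the fuel decrease and pays for the constant cost of
a round. -/
lemma maxStart_eq_some {δ : T} {bs : List (Lane T)} {s : T} (h : maxStart bs = some s)
    (hw : ∀ b ∈ bs, b.WF δ) :
    (∀ b ∈ bs, ∀ x ∈ b.todo, x.1 ≤ s) ∧ ∃ b ∈ bs, 1 ≤ (batch s b.todo).length := by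
  rw [maxStart, List.max?_eq_some_iff] at h
  obtain ⟨h1, h2⟩ := h
  constructor
  · intro b hb x hx
    obtain ⟨a, l, e⟩ := List.exists_cons_of_ne_nil (List.ne_nil_of_mem hx)
    have ha : a.1 ≤ s := h2 _ (List.mem_filterMap.2 ⟨b, hb, by simp [e]⟩)
    have hp := (hw b hb).pri
    rw [e] at hx hp
    rcases List.mem_cons.1 hx with rfl | hx
    · exact ha
    · have := (List.pairwise_cons.1 hp).1 x hx
      simp only [priorityLe, decide_eq_true_eq] at this
      rcases this with h' | h'
      · exact h'.le.trans ha
      · exact h'.1 ▸ ha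
  · obtain ⟨b, hb, e⟩ := List.mem_filterMap.1 h1
    refine ⟨b, hb, ?_⟩
    cases e' : b.todo with
    | nil => rw [e'] at e; simp at e
    | cons a l =>
      rw [e'] at e
      have : a.1 = s := by simpa using e
      rw [batch, List.takeWhile_cons_of_pos (by simpa using this)]
      simp

/-- `B` are the wedges of the current start time `s`, `R` the remaining ones, `K` the stored ones
that survive deletion and `D` the deleted ones. A pair in `B × K` meets the conditions of `meet`.
Pairs with `D` are too long now and in all later rounds, and pairs from `B` with `B` or `R` fail the
strict inequality of start times. What is left is the same expression for the next round. -/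
lemma cross_round (upper : Bool) {δ s : T} {BI RI KI DI BJ RJ KJ DJ : Multiset (Bool × T × T)}
    (bI : ∀ x ∈ BI, x.2.1 = s) (bJ : ∀ x ∈ BJ, x.2.1 = s) (rI : ∀ x ∈ RI, x.2.1 < s)
    (rJ : ∀ x ∈ RJ, x.2.1 < s) (kI : ∀ x ∈ KI, s < x.2.1 ∧ x.2.2 ≤ s + δ)
    (kJ : ∀ x ∈ KJ, s < x.2.1 ∧ x.2.2 ≤ s + δ) (dI : ∀ x ∈ DI, s + δ < x.2.2)
    (dJ : ∀ x ∈ DJ, s + δ < x.2.2) [IsOrderedAddMonoid T] :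
    cross (meet upper δ) (BI + RI) ((KJ + DJ) + (BJ + RJ)) +
        cross (meet upper δ) (BJ + RJ) ((KI + DI) + (BI + RI)) =
      cross (meetAny upper) BI KJ + cross (meetAny upper) BJ KI +
        (cross (meet upper δ) RI ((KJ + BJ) + RJ) + cross (meet upper δ) RJ ((KI + BI) + RI)) := by
  have late : ∀ {B K : Multiset (Bool × T × T)}, (∀ x ∈ B, x.2.1 = s) →
      (∀ x ∈ K, s < x.2.1 ∧ x.2.2 ≤ s + δ) →
      cross (meet upper δ) B K = cross (meetAny upper) B K := by
    intro B K hB hK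
    refine cross_congr fun x hx y hy => ?_
    rw [meet, hB x hx, if_pos (hK y hy)]
  have gone : ∀ {B D : Multiset (Bool × T × T)}, (∀ x ∈ B, x.2.1 ≤ s) →
      (∀ x ∈ D, s + δ < x.2.2) → cross (meet upper δ) B D = 0 := by
    intro B D hB hD
    refine cross_eq_zero fun x hx y hy => ?_
    rw [meet, if_neg]
    rintro ⟨_, h⟩
    have := hB x hx
    have : x.2.1 + δ ≤ s + δ := by gcongr
    exact absurd (h.trans this) (not_le.2 (hD y hy))
  have early : ∀ {B R : Multiset (Bool × T × T)}, (∀ x ∈ B, x.2.1 = s) →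
      (∀ x ∈ R, x.2.1 ≤ s) → cross (meet upper δ) B R = 0 := by
    intro B R hB hR
    refine cross_eq_zero fun x hx y hy => ?_
    rw [meet, if_neg]
    rintro ⟨h, _⟩
    rw [hB x hx] at h
    exact absurd h (not_lt.2 (hR y hy))
  have bI' := fun x hx => (bI x hx).le
  have bJ' := fun x hx => (bJ x hx).le
  have rI' := fun x hx => (rI x hx).le
  have rJ' := fun x hx => (rJ x hx).le
  simp only [cross_add_left, cross_add_right, late bI kJ, late bJ kI, gone bI' dJ, gone bJ' dI,
    gone rI' dJ, gone rJ' dI, early bI bJ', early bJ bI', early bI rJ', early bJ rI']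
  abel

/-- The potential that bounds the sizes of the arrays to be inspected. -/
lemma mass_round {bi ri ki di bj rj kj dj : ℕ} :
    bi * kj + bj * ki + (ri * (kj + bj) + rj * (ki + bi) + ri * rj) ≤
      (bi + ri) * (kj + dj) + (bj + rj) * (ki + di) + (bi + ri) * (bj + rj) := by
  -- The surplus consists of the pairs with deleted wedges and of the pairs of equal start time,
  -- which are never inspected.
  have : (bi + ri) * (kj + dj) + (bj + rj) * (ki + di) + (bi + ri) * (bj + rj) =
      bi * kj + bj * ki + (ri * (kj + bj) + rj * (ki + bi) + ri * rj) +
      ((bi + ri) * dj + (bj + rj) * di + bi * bj) := by ring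
  omega

lemma mem_tag_of {p : T × T → Prop} {A D : Multiset (T × T)} (hA : ∀ x ∈ A, p x)
    (hD : ∀ x ∈ D, p x) : ∀ x ∈ tag A D, p x.2 := fun _ hx =>
  (mem_tag hx).elim (hA _) (hD _)

end Lanes

lemma Runs.conv {α : Type} {p : Prog α} {a : α} {t : ℕ} {L : List ℕ} {x y s x' y' s' : ℕ}
    (h : Runs p a t L x y s) (hx : x' ≤ x) (hy : y ≤ y') (hs : s ≤ s') :
    Runs p a t L x' y' s' := (h.weaken_left hx).mono le_rfl hy hs

/-! ### The main loop of `SetCross`. -/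

section CrossLoop

variable {T : Type} [LinearOrder T] [AddCommGroup T] [IsOrderedAddMonoid T]

lemma Lane.WF.words_le {δ : T} {b : Lane T} (h : b.WF δ) :
    b.hp.words + 3 * b.todo.length ≤ 3 * b.kept.length := by
  have h1 := h.hp.words_le
  have h2 := h.card_kept
  omega

set_option maxHeartbeats 1000000 in
-- The invariant `hlt` says that stored wedges start strictly after unprocessed ones. In the time
-- bound a round costs `16` steps plus `8` per wedge of its nonempty batch, hence `24` per wedge.
-- The `9` per element of `kept` covers `6` for its deletion or `3` for the final release of its
-- memory. The bound on `L.sum` is a potential: the pairs of an unprocessed with a stored wedge of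
-- the other set and those of two unprocessed wedges.
lemma exists_runs_crossLoop (upper : Bool) (δ : T) (fuel : ℕ) {Ai Di Aj Dj : Lane T}
    (hAi : Ai.WF δ) (hDi : Di.WF δ) (hAj : Aj.WF δ) (hDj : Dj.WF δ)
    (hlt : ∀ b ∈ [Ai, Di, Aj, Dj], ∀ b' ∈ [Ai, Di, Aj, Dj], ∀ y ∈ b.hp.flat, ∀ x ∈ b'.todo,
      x.1 < y.1)
    (hfuel : Ai.todo.length + Di.todo.length + Aj.todo.length + Dj.todo.length < fuel) :
    ∃ L : List ℕ, (∀ a ∈ L, 1 ≤ a) ∧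
      L.sum ≤ (Ai.todo.length + Di.todo.length) *
          (Multiset.card Aj.hp.flat + Multiset.card Dj.hp.flat) +
        (Aj.todo.length + Dj.todo.length) *
          (Multiset.card Ai.hp.flat + Multiset.card Di.hp.flat) +
        (Ai.todo.length + Di.todo.length) * (Aj.todo.length + Dj.todo.length) ∧
      ∀ C k, Runs (crossLoop upper δ fuel Ai Di Aj Dj C)
        (C + (cross (meet upper δ) (tag Ai.todo Di.todo)
            (tag Aj.hp.flat Dj.hp.flat + tag Aj.todo Dj.todo) +
          cross (meet upper δ) (tag Aj.todo Dj.todo)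
            (tag Ai.hp.flat Di.hp.flat + tag Ai.todo Di.todo)))
        (4 + 24 * (Ai.todo.length + Di.todo.length + Aj.todo.length + Dj.todo.length) +
          9 * (Ai.kept.length + Di.kept.length + Aj.kept.length + Dj.kept.length)) L
        (k + (Ai.hp.words + Di.hp.words + Aj.hp.words + Dj.hp.words)) k
        (k + 3 * (Ai.kept.length + Di.kept.length + Aj.kept.length + Dj.kept.length)) := by
  induction fuel generalizing Ai Di Aj Dj with
  | zero => omega
  | succ fuel ih =>
    cases hm : maxStart [Ai, Di, Aj, Dj] with
    | none =>
      have h := maxStart_eq_none hm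
      simp only [List.mem_cons, List.not_mem_nil, or_false, forall_eq_or_imp, forall_eq] at h
      obtain ⟨h1, h2, h3, h4⟩ := h
      refine ⟨[], by simp, by simp, fun C k => ?_⟩
      have := hAi.words_le
      have := hDi.words_le
      have := hAj.words_le
      have := hDj.words_le
      rw [crossLoop, hm]
      refine Runs.congr ((Runs.tick 4 _).bind ((Runs.release _ _).bind (Runs.pure _ _)))
        ?_ rfl ?_ ?_ ?_
      · simp [h1, h2, h3, h4]
      · omega
      · omega
      · omega
    | some s =>
      obtain ⟨hs, hbatch⟩ := maxStart_eq_some (δ := δ) hm (by simp [hAi, hDi, hAj, hDj])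
      -- The maximum `s` is attained by some unprocessed wedge, so `hlt` gives a strict inequality
      -- for all stored ones.
      have hstored : ∀ b ∈ [Ai, Di, Aj, Dj], ∀ y ∈ b.hp.flat, s < y.1 := by
        obtain ⟨b', hb', hb''⟩ := hbatch
        obtain ⟨x, hx⟩ := List.exists_mem_of_length_pos hb''
        intro b hb y hy
        rw [← of_mem_batch hx]
        exact hlt b hb b' hb' y hy x ((List.takeWhile_sublist _).subset hx)
      simp only [List.mem_cons, List.not_mem_nil, or_false, forall_eq_or_imp, forall_eq,
        exists_eq_or_imp, exists_eq_left] at hs hbatch hlt hstored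
      obtain ⟨oAi, oDi, oAj, oDj⟩ := hstored
      replace hbatch : 1 ≤ (batch s Ai.todo).length + (batch s Di.todo).length +
          (batch s Aj.todo).length + (batch s Dj.todo).length := by
        clear hfuel ih
        omega
      obtain ⟨sAi, sDi, sAj, sDj⟩ := hs
      obtain ⟨Ai', EAi, wAi, tAi, fAi, dAi, gAi, rAi⟩ := exists_runs_laneDelete hAi sAi
      obtain ⟨Di', EDi, wDi, tDi, fDi, dDi, gDi, rDi⟩ := exists_runs_laneDelete hDi sDi
      obtain ⟨Aj', EAj, wAj, tAj, fAj, dAj, gAj, rAj⟩ := exists_runs_laneDelete hAj sAj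
      obtain ⟨Dj', EDj, wDj, tDj, fDj, dDj, gDj, rDj⟩ := exists_runs_laneDelete hDj sDj
      have sub : ∀ {b b' : Lane T} {D : Multiset (T × T)}, b.hp.flat = b'.hp.flat + D →
          ∀ y ∈ b'.hp.flat, y ∈ b.hp.flat := fun h y hy => by
        rw [h]; exact Multiset.mem_add.2 (Or.inl hy)
      obtain ⟨hpAi, vAi, eAi, iAi⟩ := exists_runs_laneInsert (s := s) wAi
        (by rw [tAi]; exact fun y hy => hlt.1.1 y (sub fAi y hy))
      obtain ⟨hpDi, vDi, eDi, iDi⟩ := exists_runs_laneInsert (s := s) wDi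
        (by rw [tDi]; exact fun y hy => hlt.2.1.2.1 y (sub fDi y hy))
      obtain ⟨hpAj, vAj, eAj, iAj⟩ := exists_runs_laneInsert (s := s) wAj
        (by rw [tAj]; exact fun y hy => hlt.2.2.1.2.2.1 y (sub fAj y hy))
      obtain ⟨hpDj, vDj, eDj, iDj⟩ := exists_runs_laneInsert (s := s) wDj
        (by rw [tDj]; exact fun y hy => hlt.2.2.2.2.2.2 y (sub fDj y hy))
      obtain ⟨L₁, p₁, m₁, q₁⟩ := exists_runs_queryBatch upper s wAj.hp wDj.hp Ai'.todo
      obtain ⟨L₂, p₂, m₂, q₂⟩ := exists_runs_queryBatch upper s wDj.hp wAj.hp Di'.todo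
      obtain ⟨L₃, p₃, m₃, q₃⟩ := exists_runs_queryBatch upper s wAi.hp wDi.hp Aj'.todo
      obtain ⟨L₄, p₄, m₄, q₄⟩ := exists_runs_queryBatch upper s wDi.hp wAi.hp Dj'.todo
      have lAi := congrArg Multiset.card (batch_add_rest s Ai.todo)
      have lDi := congrArg Multiset.card (batch_add_rest s Di.todo)
      have lAj := congrArg Multiset.card (batch_add_rest s Aj.todo)
      have lDj := congrArg Multiset.card (batch_add_rest s Dj.todo)
      simp only [Multiset.card_add, Multiset.coe_card] at lAi lDi lAj lDj
      rw [tAi] at eAi iAi vAi q₁ m₁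
      rw [tDi] at eDi iDi vDi q₂ m₂
      rw [tAj] at eAj iAj vAj q₃ m₃
      rw [tDj] at eDj iDj vDj q₄ m₄
      change L₁.sum = (batch s Ai.todo).length * _ at m₁
      change L₂.sum = (batch s Di.todo).length * _ at m₂
      change L₃.sum = (batch s Aj.todo).length * _ at m₃
      change L₄.sum = (batch s Dj.todo).length * _ at m₄
      have ltAi := lt_of_mem_rest hAi.pri sAi
      have ltDi := lt_of_mem_rest hDi.pri sDi
      have ltAj := lt_of_mem_rest hAj.pri sAj
      have ltDj := lt_of_mem_rest hDj.pri sDj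
      have aft : ∀ {b b' : Lane T} {D : Multiset (T × T)} {hp : HP T} {l : List (T × T)},
          (∀ y ∈ b.hp.flat, s < y.1) → b.hp.flat = b'.hp.flat + D →
          hp.flat = b'.hp.flat + (batch s l : Multiset (T × T)) → ∀ y ∈ hp.flat, s ≤ y.1 := by
        intro b b' D hp l h1 h2 h3 y hy
        rw [h3] at hy
        rcases Multiset.mem_add.1 hy with hy | hy
        · exact (h1 y (sub h2 y hy)).le
        · exact (of_mem_batch (Multiset.mem_coe.1 hy)).ge
      have aAi := aft oAi fAi eAi
      have aDi := aft oDi fDi eDi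
      have aAj := aft oAj fAj eAj
      have aDj := aft oDj fDj eDj
      obtain ⟨L₅, p₅, m₅, q₅⟩ := ih vAi vDi vAj vDj (by
        simp only [List.mem_cons, List.not_mem_nil, or_false, forall_eq_or_imp, forall_eq]
        refine ⟨⟨?_, ?_, ?_, ?_⟩, ⟨?_, ?_, ?_, ?_⟩, ⟨?_, ?_, ?_, ?_⟩, ⟨?_, ?_, ?_, ?_⟩⟩ <;>
          intro y hy x hx <;>
          first
          | exact (ltAi x hx).trans_le (by first | exact aAi y hy | exact aDi y hy | exact aAj y hy
                                                 | exact aDj y hy)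
          | exact (ltDi x hx).trans_le (by first | exact aAi y hy | exact aDi y hy | exact aAj y hy
                                                 | exact aDj y hy)
          | exact (ltAj x hx).trans_le (by first | exact aAi y hy | exact aDi y hy | exact aAj y hy
                                                 | exact aDj y hy)
          | exact (ltDj x hx).trans_le (by first | exact aAi y hy | exact aDi y hy | exact aAj y hy
                                                 | exact aDj y hy)) (by
        simp only
        omega)
      have cAi := congrArg Multiset.card fAi
      have cDi := congrArg Multiset.card fDi
      have cAj := congrArg Multiset.card fAj
      have cDj := congrArg Multiset.card fDj
      have bAi := congrArg Multiset.card eAi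
      have bDi := congrArg Multiset.card eDi
      have bAj := congrArg Multiset.card eAj
      have bDj := congrArg Multiset.card eDj
      simp only [Multiset.card_add, Multiset.coe_card] at cAi cDi cAj cDj bAi bDi bAj bDj
      -- This is the balance `cross_round`, with the tagged multisets reassembled into the lanes
      -- before and after the round.
      have val : cross (meet upper δ) (tag Ai.todo Di.todo)
            (tag Aj.hp.flat Dj.hp.flat + tag Aj.todo Dj.todo) +
          cross (meet upper δ) (tag Aj.todo Dj.todo)
            (tag Ai.hp.flat Di.hp.flat + tag Ai.todo Di.todo) =
          ((batch s Ai.todo).map (hits upper Aj'.hp.flat Dj'.hp.flat)).sum +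
          ((batch s Di.todo).map (hits upper Dj'.hp.flat Aj'.hp.flat)).sum +
          ((batch s Aj.todo).map (hits upper Ai'.hp.flat Di'.hp.flat)).sum +
          ((batch s Dj.todo).map (hits upper Di'.hp.flat Ai'.hp.flat)).sum +
          (cross (meet upper δ) (tag (rest s Ai.todo) (rest s Di.todo))
            (tag hpAj.flat hpDj.flat + tag (rest s Aj.todo) (rest s Dj.todo)) +
          cross (meet upper δ) (tag (rest s Aj.todo) (rest s Dj.todo))
            (tag hpAi.flat hpDi.flat + tag (rest s Ai.todo) (rest s Di.todo))) := by
        have c1 := cross_meetAny upper (batch s Ai.todo) (batch s Di.todo) Aj'.hp.flat Dj'.hp.flat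
        have c2 := cross_meetAny upper (batch s Aj.todo) (batch s Dj.todo) Ai'.hp.flat Di'.hp.flat
        simp only [Multiset.map_coe, Multiset.sum_coe] at c1 c2
        have e := cross_round upper (s := s) (δ := δ)
          (mem_tag_of (p := fun x => x.1 = s) (A := batch s Ai.todo) (D := batch s Di.todo)
            (fun x hx => of_mem_batch hx) (fun x hx => of_mem_batch hx))
          (mem_tag_of (p := fun x => x.1 = s) (A := batch s Aj.todo) (D := batch s Dj.todo)
            (fun x hx => of_mem_batch hx) (fun x hx => of_mem_batch hx))
          (mem_tag_of (p := fun x => x.1 < s) (A := rest s Ai.todo) (D := rest s Di.todo)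
            ltAi ltDi)
          (mem_tag_of (p := fun x => x.1 < s) (A := rest s Aj.todo) (D := rest s Dj.todo)
            ltAj ltDj)
          (mem_tag_of (p := fun x => s < x.1 ∧ x.2 ≤ s + δ)
            (fun x hx => ⟨oAi x (sub fAi x hx), gAi x hx⟩)
            (fun x hx => ⟨oDi x (sub fDi x hx), gDi x hx⟩))
          (mem_tag_of (p := fun x => s < x.1 ∧ x.2 ≤ s + δ)
            (fun x hx => ⟨oAj x (sub fAj x hx), gAj x hx⟩)
            (fun x hx => ⟨oDj x (sub fDj x hx), gDj x hx⟩))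
          (mem_tag_of (p := fun x => s + δ < x.2) dAi dDi)
          (mem_tag_of (p := fun x => s + δ < x.2) dAj dDj)
        simp only [← tag_add, ← batch_add_rest, ← fAi, ← fDi, ← fAj, ← fDj, ← eAi, ← eDi, ← eAj,
          ← eDj, c1, c2] at e
        simp only [← tag_add]
        rw [e]
        simp only [add_assoc]
      refine ⟨L₁ ++ (L₂ ++ (L₃ ++ (L₄ ++ L₅))), ?_, ?_, fun C k => ?_⟩
      · intro a ha
        simp only [List.mem_append] at ha
        rcases ha with ha | ha | ha | ha | ha
        exacts [p₁ a ha, p₂ a ha, p₃ a ha, p₄ a ha, p₅ a ha]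
      · simp only [List.sum_append, m₁, m₂, m₃, m₄]
        simp only [bAi, bDi, bAj, bDj] at m₅
        rw [cAi, cDi, cAj, cDj, lAi, lDi, lAj, lDj]
        have key := @mass_round ((batch s Ai.todo).length + (batch s Di.todo).length)
          ((rest s Ai.todo).length + (rest s Di.todo).length)
          (Multiset.card Ai'.hp.flat + Multiset.card Di'.hp.flat)
          (Multiset.card EAi + Multiset.card EDi)
          ((batch s Aj.todo).length + (batch s Dj.todo).length)
          ((rest s Aj.todo).length + (rest s Dj.todo).length)
          (Multiset.card Aj'.hp.flat + Multiset.card Dj'.hp.flat)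
          (Multiset.card EAj + Multiset.card EDj)
        -- The four batch queries inspect `bi * kj + bj * ki` entries in total; the rest of the
        -- potential is the induction hypothesis.
        nlinarith only [key, m₅]
      · have wAi1 := hAi.words_le
        have wDi1 := hDi.words_le
        have wAj1 := hAj.words_le
        have wDj1 := hDj.words_le
        have wAi2 := wAi.words_le
        have wDi2 := wDi.words_le
        have wAj2 := wAj.words_le
        have wDj2 := wDj.words_le
        have wAi3 : hpAi.words + 3 * (rest s Ai.todo).length ≤ 3 * Ai'.kept.length := vAi.words_le
        have wDi3 : hpDi.words + 3 * (rest s Di.todo).length ≤ 3 * Di'.kept.length := vDi.words_le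
        have wAj3 : hpAj.words + 3 * (rest s Aj.todo).length ≤ 3 * Aj'.kept.length := vAj.words_le
        have wDj3 : hpDj.words + 3 * (rest s Dj.todo).length ≤ 3 * Dj'.kept.length := vDj.words_le
        have kAi := hAi.card_kept
        have kDi := hDi.card_kept
        have kAj := hAj.card_kept
        have kDj := hDj.card_kept
        have kAi' := wAi.card_kept
        have kDi' := wDi.card_kept
        have kAj' := wAj.card_kept
        have kDj' := wDj.card_kept
        rw [tAi] at kAi' wAi2
        rw [tDi] at kDi' wDi2
        rw [tAj] at kAj' wAj2
        rw [tDj] at kDj' wDj2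
        set S := k + 3 * (Ai.kept.length + Di.kept.length + Aj.kept.length + Dj.kept.length)
          with hS
        rw [crossLoop, hm]
        have R₁ := (rAi (k + (Di.hp.words + Aj.hp.words + Dj.hp.words))).conv (s' := S)
          (x' := k + (Ai.hp.words + Di.hp.words + Aj.hp.words + Dj.hp.words))
          (y' := k + (Ai'.hp.words + Di.hp.words + Aj.hp.words + Dj.hp.words))
          (by omega) (by omega) (by omega)
        have R₂ := (rDi (k + (Ai'.hp.words + Aj.hp.words + Dj.hp.words))).conv (s' := S)
          (x' := k + (Ai'.hp.words + Di.hp.words + Aj.hp.words + Dj.hp.words))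
          (y' := k + (Ai'.hp.words + Di'.hp.words + Aj.hp.words + Dj.hp.words))
          (by omega) (by omega) (by omega)
        have R₃ := (rAj (k + (Ai'.hp.words + Di'.hp.words + Dj.hp.words))).conv (s' := S)
          (x' := k + (Ai'.hp.words + Di'.hp.words + Aj.hp.words + Dj.hp.words))
          (y' := k + (Ai'.hp.words + Di'.hp.words + Aj'.hp.words + Dj.hp.words))
          (by omega) (by omega) (by omega)
        have R₄ := (rDj (k + (Ai'.hp.words + Di'.hp.words + Aj'.hp.words))).conv (s' := S)
          (x' := k + (Ai'.hp.words + Di'.hp.words + Aj'.hp.words + Dj.hp.words))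
          (y' := k + (Ai'.hp.words + Di'.hp.words + Aj'.hp.words + Dj'.hp.words))
          (by omega) (by omega) (by omega)
        have I₁ := (iAi (k + (Di'.hp.words + Aj'.hp.words + Dj'.hp.words))).conv (s' := S)
          (x' := k + (Ai'.hp.words + Di'.hp.words + Aj'.hp.words + Dj'.hp.words))
          (y' := k + (hpAi.words + Di'.hp.words + Aj'.hp.words + Dj'.hp.words))
          (by omega) (by omega) (by omega)
        have I₂ := (iDi (k + (hpAi.words + Aj'.hp.words + Dj'.hp.words))).conv (s' := S)
          (x' := k + (hpAi.words + Di'.hp.words + Aj'.hp.words + Dj'.hp.words))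
          (y' := k + (hpAi.words + hpDi.words + Aj'.hp.words + Dj'.hp.words))
          (by omega) (by omega) (by omega)
        have I₃ := (iAj (k + (hpAi.words + hpDi.words + Dj'.hp.words))).conv (s' := S)
          (x' := k + (hpAi.words + hpDi.words + Aj'.hp.words + Dj'.hp.words))
          (y' := k + (hpAi.words + hpDi.words + hpAj.words + Dj'.hp.words))
          (by omega) (by omega) (by omega)
        have I₄ := (iDj (k + (hpAi.words + hpDi.words + hpAj.words))).conv (s' := S)
          (x' := k + (hpAi.words + hpDi.words + hpAj.words + Dj'.hp.words))
          (y' := k + (hpAi.words + hpDi.words + hpAj.words + hpDj.words))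
          (by omega) (by omega) (by omega)
        rw [← tAi] at q₁ I₁
        rw [← tDi] at q₂ I₂
        rw [← tAj] at q₃ I₃
        rw [← tDj] at q₄ I₄
        rw [← tAi, ← tDi, ← tAj, ← tDj] at q₅
        refine Runs.congr (Runs.bind (Runs.tick 4 _) (R₁.bind (R₂.bind (R₃.bind (R₄.bind
          ((q₁ _ _).bind ((q₂ _ _).bind ((q₃ _ _).bind ((q₄ _ _).bind
          (I₁.bind (I₂.bind (I₃.bind (I₄.bind (q₅ _ k))))))))))))))
          ?_ ?_ ?_ ?_ ?_
        · rw [val, ← add_assoc, tAi, tDi, tAj, tDj]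
          simp only [← add_assoc]
          rfl
        · simp
        · rw [tAi, tDi, tAj, tDj]
          change 4 + (1 + 6 * Multiset.card EAi + (1 + 6 * Multiset.card EDi +
            (1 + 6 * Multiset.card EAj + (1 + 6 * Multiset.card EDj +
            (1 + 2 * (batch s Ai.todo).length + (1 + 2 * (batch s Di.todo).length +
            (1 + 2 * (batch s Aj.todo).length + (1 + 2 * (batch s Dj.todo).length +
            (1 + 6 * (batch s Ai.todo).length + (1 + 6 * (batch s Di.todo).length +
            (1 + 6 * (batch s Aj.todo).length + (1 + 6 * (batch s Dj.todo).length +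
            (4 + 24 * ((rest s Ai.todo).length + (rest s Di.todo).length +
              (rest s Aj.todo).length + (rest s Dj.todo).length) +
            9 * (Ai'.kept.length + Di'.kept.length + Aj'.kept.length +
              Dj'.kept.length)))))))))))))) ≤ _
          -- Here `hbatch` pays for the `16` steps that do not depend on the batch sizes.
          linarith only [hbatch, lAi, lDi, lAj, lDj, cAi, cDi, cAj, cDj, kAi, kDi, kAj, kDj, kAi',
            kDi', kAj', kDj']
        · exact le_rfl
        · simp only [max_le_iff, Nat.zero_le, le_refl, true_and]
          omega

end CrossLoop

/-! ### Sums over pairs of different sets. -/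

section Both

variable {α : Type}

/-- The sum of `f` over the pairs of elements of `M` and `N`, in both orders. -/
def both (f : α → α → Counts) (M N : Multiset α) : Counts := cross f M N + cross f N M

lemma both_add_left (f : α → α → Counts) (M M' N : Multiset α) :
    both f (M + M') N = both f M N + both f M' N := by
  simp only [both, cross_add_left, cross_add_right]
  abel

lemma both_add_right (f : α → α → Counts) (M N N' : Multiset α) :
    both f M (N + N') = both f M N + both f M N' := by
  simp only [both, cross_add_left, cross_add_right]
  abel

@[simp] lemma both_zero_right (f : α → α → Counts) (M : Multiset α) : both f M 0 = 0 := by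
  simp [both]

/-- The sum of `f` over the pairs of elements of two different sets of a list. -/
def pairs (f : α → α → Counts) : List (Multiset α) → Counts
  | [] => 0
  | M :: Ms => both f M Ms.sum + pairs f Ms

/-- This identity mirrors the recursion: pairs inside the first half, pairs inside the second half,
and the pairs across, which `setCross` counts. -/
lemma pairs_append (f : α → α → Counts) (l l' : List (Multiset α)) :
    pairs f (l ++ l') = pairs f l + pairs f l' + both f l.sum l'.sum := by
  induction l with
  | nil => simp [pairs, both]
  | cons M l ih =>
    rw [List.cons_append, pairs, pairs, ih, List.sum_append, List.sum_cons, both_add_right,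
      both_add_left]
    abel

end Both

/-! ### Merging, sorting and recursively combining wedge sets. -/

section Combine

variable {T : Type} [LinearOrder T]

lemma priorityLe_trans (a b c : T × T) (h : priorityLe a b = true) (h' : priorityLe b c = true) :
    priorityLe a c = true := by
  simp only [priorityLe, decide_eq_true_eq] at *
  rcases h with h | ⟨h, h1⟩ <;> rcases h' with h' | ⟨h', h1'⟩
  · exact Or.inl (h'.trans h)
  · exact Or.inl (h' ▸ h)
  · exact Or.inl (h ▸ h')
  · exact Or.inr ⟨h.trans h', h1.trans h1'⟩

lemma priorityLe_total (a b : T × T) : (priorityLe a b || priorityLe b a) = true := by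
  simp only [priorityLe, Bool.or_eq_true, decide_eq_true_eq]
  rcases lt_trichotomy a.1 b.1 with h | h | h
  · exact Or.inr (Or.inl h)
  · exact (le_total a.2 b.2).imp (fun h' => Or.inr ⟨h, h'⟩) (fun h' => Or.inr ⟨h.symm, h'⟩)
  · exact Or.inl (Or.inl h)

lemma arrivalGe_trans (a b c : T × T) (h : arrivalGe a b = true) (h' : arrivalGe b c = true) :
    arrivalGe a c = true := by
  simp only [arrivalGe, decide_eq_true_eq] at *
  exact h'.trans h

lemma arrivalGe_total (a b : T × T) : (arrivalGe a b || arrivalGe b a) = true := by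
  simp only [arrivalGe, Bool.or_eq_true, decide_eq_true_eq]
  exact le_total _ _

variable [AddCommGroup T]

structure SortedSubset.WF (δ : T) (b : SortedSubset T) : Prop where
  pri : b.pri.Pairwise fun x y => priorityLe x y = true
  arr : b.arr.Pairwise fun x y => arrivalGe x y = true
  perm : b.arr.Perm b.pri
  dur : ∀ y ∈ b.pri, y.2 ≤ y.1 + δ

structure SortedSet.WF (δ : T) (S : SortedSet T) : Prop where
  A : S.A.WF δ
  D : S.D.WF δ

def SortedSet.wedges (S : SortedSet T) : Multiset (Bool × T × T) := tag S.A.pri S.D.pri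

def WedgeSet.wedges (S : WedgeSet T) : Multiset (Bool × T × T) := tag S.A S.D

lemma exists_runs_mergeSubset {δ : T} {a b : SortedSubset T} (ha : a.WF δ) (hb : b.WF δ) :
    ∃ c : SortedSubset T, c.WF δ ∧ c.pri.Perm (a.pri ++ b.pri) ∧
      ∀ k, Runs (mergeSubset a b) c (10 * (a.pri.length + b.pri.length)) [] k k
        (k + 2 * (a.pri.length + b.pri.length)) := by
  have hp : (a.pri.merge b.pri priorityLe).Perm (a.pri ++ b.pri) := List.merge_perm_append _
  refine ⟨⟨a.pri.merge b.pri priorityLe, a.arr.merge b.arr arrivalGe⟩,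
    ⟨List.pairwise_merge priorityLe_trans priorityLe_total _ _ ha.pri hb.pri,
    List.pairwise_merge arrivalGe_trans arrivalGe_total _ _ ha.arr hb.arr,
    (List.merge_perm_append _).trans ((ha.perm.append hb.perm).trans hp.symm), fun y hy => ?_⟩,
    hp, fun k => ?_⟩
  · rcases List.mem_append.1 (hp.subset hy) with h | h
    · exact ha.dur y h
    · exact hb.dur y h
  · have h1 := ha.perm.length_eq
    have h2 := hb.perm.length_eq
    refine Runs.congr ((runs_mergeOp 2 _ _ _ k).bind ((runs_mergeOp 2 _ _ _ k).bind
      (Runs.pure _ k))) rfl rfl ?_ le_rfl ?_ <;> omega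

lemma Lane.WF.start {δ : T} {b : SortedSubset T} (h : b.WF δ) : (Lane.start b).WF δ :=
  ⟨HP.WF.nil, h.pri, h.arr, by simpa [Lane.start] using h.perm, h.dur⟩

/-- Both hash maps start empty, so only the product of the two sizes survives in the bound on
`L.sum`. The constants are `28 = 4 + 12 + 12`, and `43 = 24 + 9 + 10` from the loop and the merging.
-/
lemma exists_runs_setCross [IsOrderedAddMonoid T] (upper : Bool) {δ : T} {Si Sj : SortedSet T}
    (hi : Si.WF δ) (hj : Sj.WF δ) :
    ∃ R : SortedSet T, R.WF δ ∧ R.wedges = Si.wedges + Sj.wedges ∧ ∃ L : List ℕ,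
      (∀ a ∈ L, 1 ≤ a) ∧ L.sum ≤ Multiset.card Si.wedges * Multiset.card Sj.wedges ∧
      ∀ C k, Runs (setCross upper δ Si Sj C) (R, C + both (meet upper δ) Si.wedges Sj.wedges)
        (28 + 43 * (Multiset.card Si.wedges + Multiset.card Sj.wedges)) L k k
        (k + (12 + 3 * (Multiset.card Si.wedges + Multiset.card Sj.wedges))) := by
  obtain ⟨RA, wA, pA, rA⟩ := exists_runs_mergeSubset hi.A hj.A
  obtain ⟨RD, wD, pD, rD⟩ := exists_runs_mergeSubset hi.D hj.D
  obtain ⟨L, p, m, r⟩ := exists_runs_crossLoop upper δ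
    (Si.A.pri.length + Si.D.pri.length + Sj.A.pri.length + Sj.D.pri.length + 1)
    (Lane.WF.start hi.A) (Lane.WF.start hi.D) (Lane.WF.start hj.A) (Lane.WF.start hj.D)
    (by simp [Lane.start]) (by simp [Lane.start])
  have l1 := hi.A.perm.length_eq
  have l2 := hi.D.perm.length_eq
  have l3 := hj.A.perm.length_eq
  have l4 := hj.D.perm.length_eq
  refine ⟨⟨RA, RD⟩, ⟨wA, wD⟩, ?_, L, p, ?_, fun C k => ?_⟩
  · unfold SortedSet.wedges
    rw [← tag_add, Multiset.coe_add, Multiset.coe_add, Multiset.coe_eq_coe.2 pA,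
      Multiset.coe_eq_coe.2 pD]
  · refine m.trans (le_of_eq ?_)
    simp [Lane.start, SortedSet.wedges]
  · have r := r C (k + 12)
    simp only [Lane.start, HP.flat_nil, tag_zero, zero_add, l1, l2, l3, l4] at r
    simp only [SortedSet.wedges, card_tag, Multiset.coe_card]
    refine Runs.congr ((Runs.alloc 12 k).bind (r.bind ((Runs.release 12 _).bind
      ((rA _).bind ((rD _).bind (Runs.pure _ _)))))) rfl ?_ ?_ ?_ ?_
    · simp
    all_goals omega

/-- The recursion has `2 m - 1` nodes for `m` sets, with constant cost at most `34 = 6 + 28` each,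
and a wedge takes part in at most `Nat.clog 2 m` merges. The form `2 * L.sum + n ≤ n * n` says that
no unordered pair of different wedges is inspected twice. -/
lemma exists_runs_recur [IsOrderedAddMonoid T] (upper : Bool) {δ : T} (S : List (SortedSet T))
    (hS : ∀ s ∈ S, s.WF δ) (hne : S ≠ []) :
    ∃ R : SortedSet T, R.WF δ ∧ R.wedges = (S.map SortedSet.wedges).sum ∧ ∃ L : List ℕ,
      (∀ a ∈ L, 1 ≤ a) ∧ 2 * L.sum + Multiset.card R.wedges ≤
        Multiset.card R.wedges * Multiset.card R.wedges ∧
      ∀ C k, Runs (recur upper δ S C)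
        (R, C + pairs (meet upper δ) (S.map SortedSet.wedges))
        (34 * (2 * S.length - 1) + 43 * (Multiset.card R.wedges * Nat.clog 2 S.length)) L k k
        (k + (3 * S.length + 12 + 3 * Multiset.card R.wedges)) := by
  induction hn : S.length using Nat.strong_induction_on generalizing S with
  | _ n ih =>
  subst hn
  have hpos := List.length_pos_iff.2 hne
  by_cases h : S.length ≤ 1
  · match S, h, hne with
    | [s], _, _ =>
      refine ⟨s, hS s (by simp), by simp, [], by simp, ?_, fun C k => ?_⟩
      · rw [List.sum_nil, mul_zero, zero_add]
        exact Nat.le_mul_self _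
      · rw [recur]
        refine Runs.congr ((Runs.alloc 3 k).bind ((Runs.pure _ _).bind ((Runs.release 3 _).bind
          (Runs.pure _ _)))) ?_ rfl ?_ ?_ ?_
        · simp [pairs]
        · simp
        · omega
        · omega
  · have h2 : 2 ≤ S.length := by omega
    have l1 : (S.take (S.length / 2)).length = S.length / 2 := by
      rw [List.length_take]; omega
    have l2 : (S.drop (S.length / 2)).length = S.length - S.length / 2 := by
      rw [List.length_drop]
    obtain ⟨R₁, w₁, e₁, L₁, p₁, m₁, r₁⟩ := ih _ (by omega) (S.take (S.length / 2))
      (fun s hs => hS s (List.mem_of_mem_take hs)) (List.length_pos_iff.1 (by omega)) l1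
    obtain ⟨R₂, w₂, e₂, L₂, p₂, m₂, r₂⟩ := ih _ (by omega) (S.drop (S.length / 2))
      (fun s hs => hS s (List.mem_of_mem_drop hs)) (List.length_pos_iff.1 (by omega)) l2
    obtain ⟨R, w, e, L, p, m, r⟩ := exists_runs_setCross upper w₁ w₂
    have eS : S.map SortedSet.wedges = (S.take (S.length / 2)).map SortedSet.wedges ++
        (S.drop (S.length / 2)).map SortedSet.wedges := by
      rw [← List.map_append, List.take_append_drop]
    have eR : R.wedges = (S.map SortedSet.wedges).sum := by
      rw [eS, List.sum_append, ← e₁, ← e₂, e]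
    have cR := congrArg Multiset.card e
    rw [Multiset.card_add] at cR
    refine ⟨R, w, eR, L₁ ++ (L₂ ++ L), ?_, ?_, fun C k => ?_⟩
    · intro a ha
      simp only [List.mem_append] at ha
      rcases ha with ha | ha | ha
      exacts [p₁ a ha, p₂ a ha, p a ha]
    · rw [cR, List.sum_append, List.sum_append]
      -- This is the expansion of `(n₁ + n₂) ^ 2`: the mixed term `2 n₁ n₂` accounts for the final
      -- merge.
      nlinarith only [m₁, m₂, m]
    · rw [recur]
      simp only [h, dite_false]
      refine Runs.congr ((Runs.alloc 3 k).bind ((r₁ C _).bind ((r₂ _ _).bind ((r _ _).bind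
        ((Runs.release 3 _).bind (Runs.pure _ _)))))) ?_ ?_ ?_ ?_ ?_
      · rw [eS, pairs_append, ← e₁, ← e₂]
        simp only [add_assoc]
      · simp
      · have c := clog_half h2
        have e1 := Nat.mul_le_mul_left (Multiset.card R₁.wedges) c.1
        have e2 := Nat.mul_le_mul_left (Multiset.card R₂.wedges) c.2
        rw [mul_add_one] at e1 e2
        rw [cR, add_mul]
        omega
      · omega
      · rw [cR]
        simp only [max_le_iff]
        omega

/-- Both coordinates of each wedge lie within duration `δ`. -/
def WedgeSet.Dur (δ : T) (S : WedgeSet T) : Prop :=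
  (∀ y ∈ S.A, y.2 ≤ y.1 + δ) ∧ ∀ y ∈ S.D, y.2 ≤ y.1 + δ

lemma exists_runs_sortSubset {δ : T} (b : List (T × T)) (hb : ∀ y ∈ b, y.2 ≤ y.1 + δ) :
    ∃ c : SortedSubset T, c.WF δ ∧ c.pri.Perm b ∧
      ∀ k, Runs (sortSubset b) c (12 + 26 * b.length + 10 * (b.length * Nat.clog 2 b.length)) []
        k (k + 2 * b.length) (k + (3 + 7 * b.length)) := by
  obtain ⟨p, pp, sp, rp⟩ := exists_runs_mergeSortOp priorityLe priorityLe_trans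
    priorityLe_total b
  obtain ⟨a, pa, sa, ra⟩ := exists_runs_mergeSortOp arrivalGe arrivalGe_trans arrivalGe_total b
  refine ⟨⟨p, a⟩, ⟨sp, sa, pa.trans pp.symm, fun y hy => hb y (pp.subset hy)⟩, pp, fun k => ?_⟩
  refine Runs.congr ((rp k).bind ((Runs.alloc _ _).bind ((ra _).bind (Runs.pure _ _))))
    rfl rfl ?_ ?_ ?_
  · rw [mul_assoc]; omega
  · omega
  · omega

/-- Bounding all set sizes by one `N` makes the logarithmic factor uniform, so the sorting costs add
up to a multiple of the total number of wedges. -/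
lemma exists_runs_sortSets {δ : T} (S : List (WedgeSet T)) (hS : ∀ s ∈ S, s.Dur δ) (N : ℕ)
    (hN : Multiset.card (S.map WedgeSet.wedges).sum ≤ N) :
    ∃ R : List (SortedSet T), (∀ r ∈ R, r.WF δ) ∧
      R.map SortedSet.wedges = S.map WedgeSet.wedges ∧
      ∀ k, Runs (sortSets S) R (1 + 30 * S.length +
        Multiset.card (S.map WedgeSet.wedges).sum * (26 + 10 * Nat.clog 2 N)) [] k
        (k + (6 * S.length + 2 * Multiset.card (S.map WedgeSet.wedges).sum))
        (k + (3 + 6 * S.length + 7 * Multiset.card (S.map WedgeSet.wedges).sum)) := by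
  induction S with
  | nil =>
    exact ⟨[], by simp, rfl, fun k => Runs.congr ((Runs.tick 1 k).bind (Runs.pure _ k)) rfl rfl
      (by simp) (by simp) (by simp)⟩
  | cons s S ih =>
    rw [List.map_cons, List.sum_cons, Multiset.card_add] at hN ⊢
    obtain ⟨R, wR, eR, rR⟩ := ih (fun r hr => hS r (List.mem_cons_of_mem _ hr)) (by omega)
    obtain ⟨A, wA, pA, rA⟩ := exists_runs_sortSubset s.A (hS s (by simp)).1
    obtain ⟨D, wD, pD, rD⟩ := exists_runs_sortSubset s.D (hS s (by simp)).2
    have cs : Multiset.card s.wedges = s.A.length + s.D.length := by simp [WedgeSet.wedges]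
    have hA : Nat.clog 2 s.A.length ≤ Nat.clog 2 N := Nat.clog_mono_right _ (by omega)
    have hD : Nat.clog 2 s.D.length ≤ Nat.clog 2 N := Nat.clog_mono_right _ (by omega)
    refine ⟨⟨A, D⟩ :: R, ?_, ?_, fun k => ?_⟩
    · intro r hr
      rcases List.mem_cons.1 hr with rfl | hr
      · exact ⟨wA, wD⟩
      · exact wR r hr
    · rw [List.map_cons, eR]
      congr 1
      unfold SortedSet.wedges WedgeSet.wedges
      rw [Multiset.coe_eq_coe.2 pA, Multiset.coe_eq_coe.2 pD]
    · refine Runs.congr ((Runs.alloc 6 k).bind ((rA _).bind ((rD _).bind ((rR _).bind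
        (Runs.pure _ _))))) rfl rfl ?_ ?_ ?_
      · have e1 := Nat.mul_le_mul_left s.A.length hA
        have e2 := Nat.mul_le_mul_left s.D.length hD
        rw [cs, List.length_cons]
        nlinarith only [e1, e2]
      · rw [cs, List.length_cons]; omega
      · rw [cs, List.length_cons]
        simp only [max_le_iff]
        omega

end Combine

/-! ### Combining all sets of one end-vertex. -/

section CombineSets

variable {V T : Type} [LinearOrder V] [AddCommGroup T] [LinearOrder T] [IsOrderedAddMonoid T]

/-- All wedges of the wedge sets of a hash map. -/
def setsWedges (h : HMap V (WedgeSet T)) : Multiset (Bool × T × T) :=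
  HMap.total (fun _ S => S.wedges) h

lemma exists_runs_combineSets (upper : Bool) {δ : T} (Hw : HMap V (WedgeSet T))
    (hH : ∀ p ∈ Hw, p.2.Dur δ) (hne : Hw ≠ []) (N : ℕ)
    (hN : Multiset.card (setsWedges Hw) ≤ N) (hN' : Hw.length ≤ N) :
    ∃ L : List ℕ, (∀ a ∈ L, 1 ≤ a) ∧ 2 * L.sum + Multiset.card (setsWedges Hw) ≤
        Multiset.card (setsWedges Hw) * Multiset.card (setsWedges Hw) ∧
      ∀ C k, Runs (combineSets upper δ Hw C)
        (C + pairs (meet upper δ) (Hw.map fun p => p.2.wedges))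
        (1 + 104 * Hw.length + Multiset.card (setsWedges Hw) * (28 + 53 * Nat.clog 2 N)) L k k
        (k + (15 + 9 * Hw.length + 7 * Multiset.card (setsWedges Hw))) := by
  have e : ((Hw.map Prod.snd).map WedgeSet.wedges).sum = setsWedges Hw := by
    rw [List.map_map]; rfl
  have hpos := List.length_pos_iff.2 hne
  obtain ⟨S, wS, eS, rS⟩ := exists_runs_sortSets (δ := δ) (Hw.map Prod.snd) (by
    intro s hs
    obtain ⟨p, hp, rfl⟩ := List.mem_map.1 hs
    exact hH p hp) N (by rw [e]; exact hN)
  have lS : S.length = Hw.length := by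
    simpa using congrArg List.length eS
  obtain ⟨R, wR, eR, L, p, m, r⟩ := exists_runs_recur upper S wS
    (List.length_pos_iff.1 (by omega))
  rw [eS, e] at eR
  rw [eR] at m
  have cR : R.A.arr.length + R.D.arr.length = Multiset.card (setsWedges Hw) := by
    rw [← eR, SortedSet.wedges, card_tag, wR.A.perm.length_eq, wR.D.perm.length_eq]
    rfl
  rw [e, List.length_map] at rS
  refine ⟨L, p, m, fun C k => ?_⟩
  refine Runs.congr ((rS k).bind ((r C _).bind ((Runs.release _ _).bind (Runs.pure _ _))))
    ?_ ?_ ?_ ?_ ?_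
  · simp only [eS, List.map_map]
    rfl
  · simp
  -- The constants collect sorting, recursion and release: `104 = 30 + 68 + 6`, `28 = 26 + 2` and
  -- `53 = 10 + 43`.
  · have hc : Nat.clog 2 Hw.length ≤ Nat.clog 2 N := Nat.clog_mono_right _ hN'
    have hc' := Nat.mul_le_mul_left (Multiset.card (setsWedges Hw)) hc
    rw [eR, lS]
    simp only [cR]
    have : 34 * (2 * Hw.length - 1) ≤ 68 * Hw.length := by omega
    nlinarith only [hc', this]
  · simp only [cR, lS]
    omega
  · rw [eR, lS]
    simp only [max_le_iff]
    omega

end CombineSets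

/-! ### Collecting the wedges of a start-vertex -/

section Folds

variable {σ ι : Type}

lemma exists_runs_foldlM (l : List ι) (f : σ → ι → Prog σ) (I : σ → Prop) (t : ι → ℕ) (S : ℕ)
    (h : ∀ s, I s → ∀ i ∈ l, ∃ s', I s' ∧ ∀ k, Runs (f s i) s' (t i) [] k k (k + S)) (s : σ)
    (hs : I s) :
    ∃ s', I s' ∧ ∀ k, Runs (l.foldlM f s) s' (l.map t).sum [] k k (k + S) := by
  induction l generalizing s with
  | nil => exact ⟨s, hs, fun k => (Runs.pure s k).mono (by simp) le_rfl (by omega)⟩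
  | cons i l ih =>
    obtain ⟨s₁, h₁, r₁⟩ := h s hs i List.mem_cons_self
    obtain ⟨s₂, h₂, r₂⟩ := ih (fun s hs j hj => h s hs j (List.mem_cons_of_mem _ hj)) s₁ h₁
    refine ⟨s₂, h₂, fun k => ?_⟩
    rw [List.foldlM_cons, List.map_cons, List.sum_cons]
    exact Runs.congr ((r₁ k).bind (r₂ k)) rfl rfl le_rfl le_rfl (by omega)

/-- Each iteration returns to `k` words, so the peak of the fold is that of a single iteration; the
lists `L i` do not depend on the counters. -/
lemma runs_foldlM_counts (l : List ι) (f : Counts → ι → Prog Counts) (cnt : ι → Counts)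
    (t : ι → ℕ) (L : ι → List ℕ) (S : ℕ)
    (h : ∀ i ∈ l, ∀ C k, Runs (f C i) (C + cnt i) (t i) (L i) k k (k + S)) (C : Counts) (k : ℕ) :
    Runs (l.foldlM f C) (C + (l.map cnt).sum) (l.map t).sum (l.flatMap L) k k (k + S) := by
  induction l generalizing C with
  | nil => exact (Runs.pure C k).congr (by simp) rfl (by simp) le_rfl (by omega)
  | cons i l ih =>
    rw [List.foldlM_cons, List.map_cons, List.sum_cons, List.map_cons, List.sum_cons,
      List.flatMap_cons, ← add_assoc]
    exact Runs.congr ((h i List.mem_cons_self C k).bind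
      (ih (fun j hj => h j (List.mem_cons_of_mem _ hj)) _)) rfl rfl le_rfl le_rfl (by omega)

end Folds

/-! ### Double sums over the entries of a hash map. -/

section Labels

variable {α : Type}

variable {κ ν : Type} [DecidableEq κ]

lemma mem_total {g : κ → ν → Multiset α} {h : HMap κ ν} {a : α} :
    a ∈ HMap.total g h ↔ ∃ p ∈ h, a ∈ g p.1 p.2 := by
  induction h with
  | nil => simp
  | cons p h ih => simp [ih]

/-- Pairs of elements with different labels. -/
lemma cross_ne_eq_pairs (f : α → α → Counts) (g : ν → Multiset α) {h : HMap κ ν}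
    (hn : (h.map Prod.fst).Nodup) :
    cross (fun X Y : κ × α => if X.1 ≠ Y.1 then f X.2 Y.2 else 0)
      (HMap.total (fun k a => (g a).map (Prod.mk k)) h)
      (HMap.total (fun k a => (g a).map (Prod.mk k)) h) = pairs f (h.map fun p => g p.2) := by
  induction h with
  | nil => simp [pairs]
  | cons p h ih =>
    rw [List.map_cons, List.nodup_cons] at hn
    have e : (HMap.total (fun k a => (g a).map (Prod.mk k)) h).map Prod.snd =
        (h.map fun p => g p.2).sum := by
      clear hn ih
      induction h with
      | nil => rfl
      | cons q h ih => simp [ih, Multiset.map_map]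
    have ne : ∀ Y ∈ HMap.total (fun k a => (g a).map (Prod.mk k)) h, p.1 ≠ Y.1 := by
      intro Y hY e
      obtain ⟨q, hq, hY⟩ := mem_total.1 hY
      obtain ⟨_, _, rfl⟩ := Multiset.mem_map.1 hY
      exact hn.1 (List.mem_map.2 ⟨q, hq, e.symm⟩)
    have c1 : cross (fun X Y : κ × α => if X.1 ≠ Y.1 then f X.2 Y.2 else 0)
        ((g p.2).map (Prod.mk p.1)) (HMap.total (fun k a => (g a).map (Prod.mk k)) h) =
        cross f (g p.2) (h.map fun p => g p.2).sum := by
      rw [cross_congr (g := fun X Y => f X.2 Y.2), ← e]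
      · simp [cross, Multiset.map_map]
      · intro X hX Y hY
        obtain ⟨_, _, rfl⟩ := Multiset.mem_map.1 hX
        rw [if_pos (ne Y hY)]
    have c2 : cross (fun X Y : κ × α => if X.1 ≠ Y.1 then f X.2 Y.2 else 0)
        (HMap.total (fun k a => (g a).map (Prod.mk k)) h) ((g p.2).map (Prod.mk p.1)) =
        cross f (h.map fun p => g p.2).sum (g p.2) := by
      rw [cross_congr (g := fun X Y => f X.2 Y.2), ← e]
      · simp [cross, Multiset.map_map]
      · intro X hX Y hY
        obtain ⟨_, _, rfl⟩ := Multiset.mem_map.1 hY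
        rw [if_pos (ne X hX).symm]
    have c3 : cross (fun X Y : κ × α => if X.1 ≠ Y.1 then f X.2 Y.2 else 0)
        ((g p.2).map (Prod.mk p.1)) ((g p.2).map (Prod.mk p.1)) = 0 := by
      refine cross_eq_zero fun X hX Y hY => ?_
      obtain ⟨_, _, rfl⟩ := Multiset.mem_map.1 hX
      obtain ⟨_, _, rfl⟩ := Multiset.mem_map.1 hY
      simp
    rw [HMap.total_cons, List.map_cons, pairs, both]
    simp only [cross_add_left, cross_add_right, ih hn.2, c1, c2, c3]
    abel

/-- Pairs of elements with equal labels. -/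
lemma cross_eq_eq_sum (f : α → α → Counts) (g : ν → Multiset α) {h : HMap κ ν}
    (hn : (h.map Prod.fst).Nodup) :
    cross (fun X Y : κ × α => if X.1 = Y.1 then f X.2 Y.2 else 0)
      (HMap.total (fun k a => (g a).map (Prod.mk k)) h)
      (HMap.total (fun k a => (g a).map (Prod.mk k)) h) =
      (h.map fun p => cross f (g p.2) (g p.2)).sum := by
  induction h with
  | nil => simp
  | cons p h ih =>
    rw [List.map_cons, List.nodup_cons] at hn
    have ne : ∀ Y ∈ HMap.total (fun k a => (g a).map (Prod.mk k)) h, p.1 ≠ Y.1 := by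
      intro Y hY e
      obtain ⟨q, hq, hY⟩ := mem_total.1 hY
      obtain ⟨_, _, rfl⟩ := Multiset.mem_map.1 hY
      exact hn.1 (List.mem_map.2 ⟨q, hq, e.symm⟩)
    have c1 : cross (fun X Y : κ × α => if X.1 = Y.1 then f X.2 Y.2 else 0)
        ((g p.2).map (Prod.mk p.1)) (HMap.total (fun k a => (g a).map (Prod.mk k)) h) = 0 := by
      refine cross_eq_zero fun X hX Y hY => ?_
      obtain ⟨_, _, rfl⟩ := Multiset.mem_map.1 hX
      rw [if_neg (ne Y hY)]
    have c2 : cross (fun X Y : κ × α => if X.1 = Y.1 then f X.2 Y.2 else 0)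
        (HMap.total (fun k a => (g a).map (Prod.mk k)) h) ((g p.2).map (Prod.mk p.1)) = 0 := by
      refine cross_eq_zero fun X hX Y hY => ?_
      obtain ⟨_, _, rfl⟩ := Multiset.mem_map.1 hY
      rw [if_neg (ne X hX).symm]
    have c3 : cross (fun X Y : κ × α => if X.1 = Y.1 then f X.2 Y.2 else 0)
        ((g p.2).map (Prod.mk p.1)) ((g p.2).map (Prod.mk p.1)) = cross f (g p.2) (g p.2) := by
      simp [cross, Multiset.map_map]
    rw [HMap.total_cons, List.map_cons, List.sum_cons]
    simp only [cross_add_left, cross_add_right, ih hn.2, c1, c2, c3]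
    abel

end Labels

section Collect

variable {V T : Type} [LinearOrder V] [AddCommGroup T] [LinearOrder T]

/-- The wedges of the sets in a hash map, labelled by their middle-vertices. -/
def setsFlat (h : HMap V (WedgeSet T)) : Multiset (V × Bool × T × T) :=
  HMap.total (fun v S => S.wedges.map (Prod.mk v)) h

/-- The wedges in `H`, labelled by their end-vertices and middle-vertices. -/
def WedgeMap.flat (H : WedgeMap V T) : Multiset (V × V × Bool × T × T) :=
  HMap.total (fun w h => (setsFlat h).map (Prod.mk w)) H

/-- A wedge as it is stored, with start time and arrival time. -/
def orient (t t' : T) : Bool × T × T := if t < t' then (true, t, t') else (false, t', t)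

/-- A wedge occupies `2` words itself and opens at most one inner entry with its wedge set (`4`
words) and one outer entry (`2` words), which explains the constant `8`. -/
structure WedgeMap.WF (δ : T) (H : WedgeMap V T) : Prop where
  nodup : (H.map Prod.fst).Nodup
  nodup' : ∀ p ∈ H, (p.2.map Prod.fst).Nodup
  dur : ∀ p ∈ H, ∀ q ∈ p.2, q.2.Dur δ
  words : H.words ≤ 8 * Multiset.card H.flat

lemma setsWords_eq (h : HMap V (WedgeSet T)) :
    setsWords h = HMap.total (fun _ S => 4 + 2 * (S.A.length + S.D.length)) h := rfl

lemma WedgeMap.words_eq (H : WedgeMap V T) :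
    H.words = HMap.total (fun _ h => 2 + setsWords h) H := rfl

lemma card_setsFlat (h : HMap V (WedgeSet T)) :
    Multiset.card (setsFlat h) = Multiset.card (setsWedges h) := by
  unfold setsFlat setsWedges
  induction h with
  | nil => rfl
  | cons p h ih => simp [ih]

lemma exists_runs_appendWedge [IsOrderedAddMonoid T] {δ : T} {H : WedgeMap V T} (h : H.WF δ)
    (w v : V) {t t' : T} (ht : |t' - t| ≤ δ) :
    ∃ H' : WedgeMap V T, H'.WF δ ∧ H'.flat = (w, v, orient t t') ::ₘ H.flat ∧
      ∀ k, Runs (appendWedge H w v t t') H' 14 [] (k + H.words) (k + H'.words)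
        (k + H'.words) := by
  set inner := H.valueD w [] with hinner
  set S := inner.valueD v ⟨[], []⟩ with hS
  set S' : WedgeSet T := if t < t' then ⟨S.A ++ [(t, t')], S.D⟩ else ⟨S.A, S.D ++ [(t', t)]⟩
    with hS'
  have nin : (inner.map Prod.fst).Nodup := by
    by_cases hw : w ∈ H.map Prod.fst
    · exact h.nodup' _ (HMap.mem_valueD hw [])
    · rw [hinner, HMap.valueD_of_notMem hw]; simp
  have din : ∀ q ∈ inner, q.2.Dur δ := by
    by_cases hw : w ∈ H.map Prod.fst
    · exact h.dur _ (HMap.mem_valueD hw [])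
    · rw [hinner, HMap.valueD_of_notMem hw]; simp
  have dS : S.Dur δ := by
    by_cases hv : v ∈ inner.map Prod.fst
    · exact din _ (HMap.mem_valueD hv _)
    · rw [hS, HMap.valueD_of_notMem hv]
      exact ⟨by simp, by simp⟩
  obtain ⟨a1, a2⟩ := abs_le.1 ht
  have dS' : S'.Dur δ := by
    rw [hS']
    split_ifs
    · refine ⟨fun y hy => ?_, dS.2⟩
      rcases List.mem_append.1 hy with hy | hy
      · exact dS.1 y hy
      · rw [List.mem_singleton.1 hy]
        exact sub_le_iff_le_add'.1 a2
    · refine ⟨dS.1, fun y hy => ?_⟩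
      rcases List.mem_append.1 hy with hy | hy
      · exact dS.2 y hy
      · rw [List.mem_singleton.1 hy]
        have := neg_le_iff_add_nonneg'.1 a1
        rw [← sub_nonneg]
        convert this using 1
        abel
  have wS' : S'.wedges = orient t t' ::ₘ S.wedges := by
    rw [hS', WedgeSet.wedges, WedgeSet.wedges, orient]
    split_ifs <;> simp only [tag, ← Multiset.coe_add, Multiset.map_add, Multiset.coe_singleton,
      Multiset.map_singleton, ← Multiset.singleton_add] <;> abel
  have lS' : S'.A.length + S'.D.length = S.A.length + S.D.length + 1 := by
    rw [hS']
    split_ifs <;> simp <;> omega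
  set inner' := HMap.set inner v S' with hinner'
  have fin : setsFlat inner' = (v, orient t t') ::ₘ setsFlat inner := by
    have := HMap.total_set (fun v (S : WedgeSet T) => S.wedges.map (Prod.mk v)) nin v S' ⟨[], []⟩
      (by simp [WedgeSet.wedges])
    rw [← hS, wS', Multiset.map_cons, Multiset.add_cons, ← Multiset.cons_add] at this
    exact add_right_cancel this
  have win : setsWords inner' = setsWords inner + 2 +
      if v ∈ inner.map Prod.fst then 0 else 4 := by
    rw [setsWords_eq, setsWords_eq]
    split_ifs with hv
    · have := HMap.total_set_of_mem (fun _ (S : WedgeSet T) => 4 + 2 * (S.A.length + S.D.length))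
        nin hv S' ⟨[], []⟩
      rw [← hinner', ← hS] at this
      omega
    · rw [hinner', HMap.total_set_of_notMem _ hv]
      have : S.A.length + S.D.length = 0 := by
        rw [hS, HMap.valueD_of_notMem hv]; rfl
      omega
  have fout : WedgeMap.flat (HMap.set H w inner') = (w, v, orient t t') ::ₘ H.flat := by
    have := HMap.total_set (fun w (h : HMap V (WedgeSet T)) => (setsFlat h).map (Prod.mk w))
      h.nodup w inner' [] (by simp [setsFlat])
    rw [← hinner, fin, Multiset.map_cons, Multiset.add_cons, ← Multiset.cons_add] at this
    exact add_right_cancel this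
  have wout : WedgeMap.words (HMap.set H w inner') = H.words + 2 +
      (if v ∈ inner.map Prod.fst then 0 else 4) + if w ∈ H.map Prod.fst then 0 else 2 := by
    rw [WedgeMap.words_eq, WedgeMap.words_eq]
    by_cases hw : w ∈ H.map Prod.fst
    · have := HMap.total_set_of_mem (fun _ (h : HMap V (WedgeSet T)) => 2 + setsWords h)
        h.nodup hw inner' []
      rw [← hinner] at this
      rw [if_pos hw]
      omega
    · have e : setsWords inner = 0 := by
        rw [hinner, HMap.valueD_of_notMem hw]; rfl
      rw [HMap.total_set_of_notMem _ hw, if_neg hw]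
      omega
  refine ⟨HMap.set H w inner', ⟨HMap.nodup_set h.nodup _ _, ?_, ?_, ?_⟩, fout, fun k => ?_⟩
  · intro p hp
    rcases HMap.mem_set hp with rfl | hp
    · exact HMap.nodup_set nin _ _
    · exact h.nodup' p hp
  · intro p hp
    rcases HMap.mem_set hp with rfl | hp
    · intro q hq
      rcases HMap.mem_set hq with rfl | hq
      · exact dS'
      · exact din q hq
    · exact h.dur p hp
  · rw [fout, wout, Multiset.card_cons]
    have := h.words
    split_ifs <;> omega
  · have rst : ∀ x, Runs (do
        let S ← HMap.get inner v ⟨[], []⟩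
        alloc 2
        tick 1
        let S' : WedgeSet T := if t < t' then ⟨S.A ++ [(t, t')], S.D⟩ else ⟨S.A, S.D ++ [(t', t)]⟩
        let inner' ← HMap.put inner v S'
        HMap.put H w inner') (HMap.set H w inner') 10 [] x
        (x + 2 + (if v ∈ inner.map Prod.fst then 0 else 2) +
          if w ∈ H.map Prod.fst then 0 else 2)
        (x + 2 + (if v ∈ inner.map Prod.fst then 0 else 2) +
          if w ∈ H.map Prod.fst then 0 else 2) := by
      intro x
      refine Runs.congr ((HMap.runs_get _ _ _ _).bind ((Runs.alloc 2 _).bind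
        ((Runs.tick 1 _).bind ((HMap.runs_put _ _ _ _).bind (HMap.runs_put _ _ _ _)))))
        rfl rfl ?_ ?_ ?_ <;> omega
    rw [wout]
    by_cases hv : v ∈ inner.map Prod.fst
    · have r := rst (k + H.words)
      rw [if_pos hv] at r ⊢
      refine Runs.congr ((HMap.runs_get _ _ _ _).bind ((Runs.tick 1 _).bind
        (Runs.ite (fun h' => absurd hv h') (fun _ => r)))) rfl rfl ?_ ?_ ?_ <;> omega
    · have r := rst (k + H.words + 2)
      rw [if_neg hv] at r ⊢
      refine Runs.congr ((HMap.runs_get _ _ _ _).bind ((Runs.tick 1 _).bind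
        (Runs.ite (fun _ => (Runs.alloc 2 _).bind r) (fun h' => absurd hv h'))))
        rfl rfl ?_ ?_ ?_ <;> omega

end Collect

/-! ### The iteration for one start-vertex. -/

section StartVertex

variable {V T : Type} [LinearOrder V] [AddCommGroup T] [LinearOrder T]

/-- The wedges with start-vertex `u` whose first edge is `e`. -/
def wedgesFrom (inp : Input V T) (δ : T) (u : V) (e : V × T) (l : List (V × T)) :
    Multiset (V × V × Bool × T × T) :=
  (l.map fun e' => if higher inp u e'.1 ∧ e.2 ≠ e'.2 ∧ |e'.2 - e.2| ≤ δ then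
    {(e'.1, e.1, orient e.2 e'.2)} else 0).sum

/-- The wedges with start-vertex `u`. -/
def startWedges (inp : Input V T) (adj : V → List (V × T)) (δ : T) (u : V) :
    Multiset (V × V × Bool × T × T) :=
  ((adj u).map fun e => if higher inp u e.1 then wedgesFrom inp δ u e (adj e.1) else 0).sum

/-- The number of pairs of edges that are inspected for the start-vertex `u`. -/
def scanCount (inp : Input V T) (adj : V → List (V × T)) (u : V) : ℕ :=
  ((adj u).map fun e => if higher inp u e.1 then (adj e.1).length else 0).sum

/-- The contribution of the start-vertex whose wedges are `M`. -/
def vertexCount (upper : Bool) (δ : T) (M : Multiset (V × V × Bool × T × T)) : Counts :=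
  cross (fun X Y => if X.1 = Y.1 then
    if X.2.1 ≠ Y.2.1 then meet upper δ X.2.2 Y.2.2 else 0 else 0) M M

lemma card_wedgesFrom_le (inp : Input V T) (δ : T) (u : V) (e : V × T) (l : List (V × T)) :
    Multiset.card (wedgesFrom inp δ u e l) ≤ l.length := by
  unfold wedgesFrom
  induction l with
  | nil => simp
  | cons e' l ih =>
    rw [List.map_cons, List.sum_cons, Multiset.card_add, List.length_cons]
    split_ifs <;> simp only [Multiset.card_singleton, Multiset.card_zero] <;> omega

lemma card_startWedges_le (inp : Input V T) (adj : V → List (V × T)) (δ : T) (u : V) :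
    Multiset.card (startWedges inp adj δ u) ≤ scanCount inp adj u := by
  unfold startWedges scanCount
  induction adj u with
  | nil => simp
  | cons e l ih =>
    rw [List.map_cons, List.sum_cons, Multiset.card_add, List.map_cons, List.sum_cons]
    have := card_wedgesFrom_le inp δ u e (adj e.1)
    split_ifs
    · omega
    · simpa using ih

/-- The collected wedges form a multiset, so sorting the adjacency lists does not change them. -/
lemma startWedges_congr (inp : Input V T) {adj adj' : V → List (V × T)}
    (h : ∀ u, (adj u).Perm (adj' u)) (δ : T) (u : V) :
    startWedges inp adj δ u = startWedges inp adj' δ u := by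
  unfold startWedges wedgesFrom
  rw [((h u).map _).sum_eq]
  congr 1
  refine List.map_congr_left fun e _ => ?_
  split_ifs
  · exact ((h e.1).map _).sum_eq
  · rfl

lemma scanCount_congr (inp : Input V T) {adj adj' : V → List (V × T)}
    (h : ∀ u, (adj u).Perm (adj' u)) (u : V) : scanCount inp adj u = scanCount inp adj' u := by
  unfold scanCount
  rw [((h u).map _).sum_eq]
  congr 1
  refine List.map_congr_left fun e _ => ?_
  rw [(h e.1).length_eq]

variable [IsOrderedAddMonoid T]

lemma exists_runs_appendWedges (inp : Input V T) {δ : T} (u : V) (e : V × T) (l : List (V × T))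
    {H : WedgeMap V T} (h : H.WF δ) :
    ∃ H' : WedgeMap V T, H'.WF δ ∧ H'.flat = wedgesFrom inp δ u e l + H.flat ∧
      ∀ k, Runs (l.foldlM (fun H e' => do
        tick 4
        if higher inp u e'.1 ∧ e.2 ≠ e'.2 ∧ |e'.2 - e.2| ≤ δ then
          appendWedge H e'.1 e.1 e.2 e'.2
        else pure H) H) H' (18 * l.length) [] (k + H.words) (k + H'.words)
        (k + 8 * Multiset.card H'.flat) := by
  induction l generalizing H with
  | nil => exact ⟨H, h, by simp [wedgesFrom], fun k =>
      (Runs.pure H _).mono (by omega) le_rfl (by omega)⟩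
  | cons e' l ih =>
    by_cases hc : higher inp u e'.1 ∧ e.2 ≠ e'.2 ∧ |e'.2 - e.2| ≤ δ
    · obtain ⟨H₁, w₁, f₁, r₁⟩ := exists_runs_appendWedge h e'.1 e.1 hc.2.2
      obtain ⟨H₂, w₂, f₂, r₂⟩ := ih w₁
      refine ⟨H₂, w₂, ?_, fun k => ?_⟩
      · rw [f₂, f₁]
        simp [wedgesFrom, hc, add_comm]
      · rw [List.foldlM_cons]
        have c := congrArg Multiset.card f₂
        rw [Multiset.card_add] at c
        have := w₁.words
        refine Runs.congr (((Runs.tick 4 _).bind (Runs.ite (fun _ => r₁ k)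
          (fun h' => absurd hc h'))).bind (r₂ k)) rfl (by simp) ?_ le_rfl ?_
        · rw [List.length_cons]; omega
        · omega
    · obtain ⟨H₂, w₂, f₂, r₂⟩ := ih h
      refine ⟨H₂, w₂, ?_, fun k => ?_⟩
      · rw [f₂]
        simp [wedgesFrom, hc]
      · rw [List.foldlM_cons]
        refine Runs.congr (((Runs.tick 4 _).bind (Runs.ite (fun h' => absurd h' hc)
          (fun _ => Runs.pure H _))).bind (r₂ k)) rfl (by simp) ?_ le_rfl ?_
        · rw [List.length_cons]; omega
        · omega

lemma exists_runs_collectWedges (inp : Input V T) (adj : V → List (V × T)) (δ : T) (u : V) :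
    ∃ H : WedgeMap V T, H.WF δ ∧ H.flat = startWedges inp adj δ u ∧
      ∀ k, Runs (collectWedges inp adj δ u) H (2 * (adj u).length + 18 * scanCount inp adj u) []
        k (k + H.words) (k + 8 * Multiset.card H.flat) := by
  suffices ∀ (l : List (V × T)) (H : WedgeMap V T), H.WF δ → ∃ H' : WedgeMap V T, H'.WF δ ∧
      H'.flat = (l.map fun e => if higher inp u e.1 then
        wedgesFrom inp δ u e (adj e.1) else 0).sum + H.flat ∧
      ∀ k, Runs (l.foldlM (fun H e => do
        tick 2
        if higher inp u e.1 then
          (adj e.1).foldlM (fun H e' => do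
            tick 4
            if higher inp u e'.1 ∧ e.2 ≠ e'.2 ∧ |e'.2 - e.2| ≤ δ then
              appendWedge H e'.1 e.1 e.2 e'.2
            else pure H) H
        else pure H) H) H' (2 * l.length +
          18 * (l.map fun e => if higher inp u e.1 then (adj e.1).length else 0).sum) []
        (k + H.words) (k + H'.words) (k + 8 * Multiset.card H'.flat) by
    obtain ⟨H, w, f, r⟩ := this (adj u) [] ⟨by simp, by simp, by simp, by simp [WedgeMap.words]⟩
    exact ⟨H, w, f.trans (add_zero _), r⟩
  intro l
  induction l with
  | nil => exact fun H h => ⟨H, h, by simp, fun k =>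
      (Runs.pure H _).mono (by omega) le_rfl (by omega)⟩
  | cons e l ih =>
    intro H h
    by_cases hc : higher inp u e.1
    · obtain ⟨H₁, w₁, f₁, r₁⟩ := exists_runs_appendWedges inp u e (adj e.1) h
      obtain ⟨H₂, w₂, f₂, r₂⟩ := ih H₁ w₁
      refine ⟨H₂, w₂, ?_, fun k => ?_⟩
      · rw [f₂, f₁, List.map_cons, List.sum_cons, if_pos hc]
        abel
      · rw [List.foldlM_cons, List.map_cons, List.sum_cons, if_pos hc, if_pos hc]
        have c := congrArg Multiset.card f₂
        rw [Multiset.card_add] at c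
        refine Runs.congr (((Runs.tick 2 _).bind (r₁ k)).bind (r₂ k)) rfl rfl ?_ le_rfl ?_
        · rw [List.length_cons]; omega
        · omega
    · obtain ⟨H₂, w₂, f₂, r₂⟩ := ih H h
      refine ⟨H₂, w₂, ?_, fun k => ?_⟩
      · rw [f₂, List.map_cons, List.sum_cons, if_neg hc, zero_add]
      · rw [List.foldlM_cons, List.map_cons, List.sum_cons, if_neg hc]
        refine Runs.congr (((Runs.tick 2 _).bind (Runs.pure H _)).bind (r₂ k)) rfl rfl ?_ le_rfl ?_
        · rw [List.length_cons]; omega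
        · omega

/-- The outer key is the end-vertex, which must agree (`cross_eq_eq_sum`); the inner key is the
middle-vertex, which must differ (`cross_ne_eq_pairs`). -/
lemma vertexCount_flat (upper : Bool) {δ : T} {H : WedgeMap V T} (h : H.WF δ) :
    vertexCount upper δ H.flat =
      (H.map fun p => pairs (meet upper δ) (p.2.map fun q => q.2.wedges)).sum := by
  have e := cross_eq_eq_sum (fun X Y : V × Bool × T × T =>
    if X.1 ≠ Y.1 then meet upper δ X.2 Y.2 else 0) setsFlat h.nodup
  refine e.trans (congrArg _ (List.map_congr_left fun p hp => ?_))
  exact cross_ne_eq_pairs (meet upper δ) WedgeSet.wedges (h.nodup' p hp)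

lemma four_length_le_setsWords (h : HMap V (WedgeSet T)) : 4 * h.length ≤ setsWords h := by
  rw [setsWords_eq]
  induction h with
  | nil => simp
  | cons p h ih =>
    rw [HMap.total_cons, List.length_cons]
    omega

/-- The iteration for one start-vertex. The sizes of the inspected arrays do not depend on the
counters. -/
lemma exists_runs_startVertex (inp : Input V T) (adj : V → List (V × T)) (δ : T) (u : V) :
    ∃ L : List ℕ, (∀ a ∈ L, 1 ≤ a) ∧
      2 * L.sum + Multiset.card (startWedges inp adj δ u) ≤
        Multiset.card (startWedges inp adj δ u) * Multiset.card (startWedges inp adj δ u) ∧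
      ∀ C k, Runs (startVertex inp adj δ u C)
        (C + vertexCount (inp.isUpper u) δ (startWedges inp adj δ u))
        (1 + 2 * (adj u).length + 18 * scanCount inp adj u +
          Multiset.card (startWedges inp adj δ u) *
            (244 + 53 * Nat.clog 2 (2 * Multiset.card (startWedges inp adj δ u)))) L k k
        (k + (15 + 33 * Multiset.card (startWedges inp adj δ u))) := by
  obtain ⟨H, w, f, r⟩ := exists_runs_collectWedges inp adj δ u
  rw [← f]
  set n := Multiset.card H.flat with hn
  have cardH : n = (H.map fun p => Multiset.card (setsWedges p.2)).sum := by
    rw [hn, WedgeMap.flat]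
    clear * -
    induction H with
    | nil => rfl
    | cons p H ih => simp [ih, card_setsFlat]
  have each : ∀ p ∈ H, Multiset.card (setsWedges p.2) ≤ n ∧ p.2.length ≤ 2 * n := by
    intro p hp
    constructor
    · rw [cardH]
      exact List.le_sum_of_mem (List.mem_map_of_mem hp)
    · have h1 : 2 + setsWords p.2 ≤ H.words :=
        List.le_sum_of_mem (List.mem_map_of_mem (f := fun p => 2 + setsWords p.2) hp)
      have h2 := w.words
      have h3 := four_length_le_setsWords p.2
      omega
  -- The condition `p ∈ H` stands inside the existential so that `choose` gives a function on all
  -- entries. If there is only one middle-vertex nothing is combined, which agrees with `pairs` of a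
  -- singleton being zero.
  have body : ∀ p, ∃ L : List ℕ, p ∈ H → (∀ a ∈ L, 1 ≤ a) ∧
      2 * L.sum + Multiset.card (setsWedges p.2) ≤
        Multiset.card (setsWedges p.2) * Multiset.card (setsWedges p.2) ∧
      ∀ C k, Runs (do
        tick 1
        if 1 < p.2.length then combineSets (inp.isUpper u) δ p.2 C else pure C)
        (C + pairs (meet (inp.isUpper u) δ) (p.2.map fun q => q.2.wedges))
        (2 + 104 * p.2.length + Multiset.card (setsWedges p.2) * (28 + 53 * Nat.clog 2 (2 * n)))
        L k k (k + (15 + 25 * n)) := by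
    intro p
    by_cases hp : p ∈ H
    · obtain ⟨b1, b2⟩ := each p hp
      by_cases hl : 1 < p.2.length
      · obtain ⟨L, h1, h2, h3⟩ := exists_runs_combineSets (inp.isUpper u) p.2 (w.dur p hp)
          (List.length_pos_iff.1 (by omega)) (2 * n) (by omega) b2
        refine ⟨L, fun _ => ⟨h1, h2, fun C k => ?_⟩⟩
        refine Runs.congr ((Runs.tick 1 _).bind (Runs.ite (fun _ => h3 C k)
          (fun h' => absurd hl h'))) rfl rfl ?_ le_rfl ?_
        · omega
        · omega
      · refine ⟨[], fun _ => ⟨by simp, ?_, fun C k => ?_⟩⟩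
        · rw [List.sum_nil, mul_zero, zero_add]
          exact Nat.le_mul_self _
        · refine Runs.congr ((Runs.tick 1 _).bind (Runs.ite (fun h' => absurd h' hl)
            (fun _ => Runs.pure C k))) ?_ rfl ?_ le_rfl ?_
          · have : pairs (meet (inp.isUpper u) δ) (p.2.map fun q => q.2.wedges) = 0 := by
              match p.2, hl with
              | [], _ => rfl
              | [q], _ => simp [pairs]
              | _ :: _ :: _, hl => simp at hl
            rw [this, add_zero]
          · omega
          · omega
    · exact ⟨[], fun h => absurd h hp⟩
  choose L hL using body
  refine ⟨H.flatMap L, ?_, ?_, fun C k => ?_⟩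
  · intro a ha
    obtain ⟨p, hp, ha⟩ := List.mem_flatMap.1 ha
    exact (hL p hp).1 a ha
  -- The function `n ^ 2 - n` is superadditive, so the bounds for the end-vertices add up to the
  -- bound for all wedges.
  · have key : ∀ H' : WedgeMap V T, (∀ p ∈ H', p ∈ H) →
        2 * (H'.flatMap L).sum + (H'.map fun p => Multiset.card (setsWedges p.2)).sum ≤
        (H'.map fun p => Multiset.card (setsWedges p.2)).sum *
          (H'.map fun p => Multiset.card (setsWedges p.2)).sum := by
      intro H'
      induction H' with
      | nil => simp
      | cons p H' ih =>
        intro hs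
        have i1 := ih fun q hq => hs q (List.mem_cons_of_mem _ hq)
        have i2 := (hL p (hs p List.mem_cons_self)).2.1
        rw [List.flatMap_cons, List.sum_append, List.map_cons, List.sum_cons]
        nlinarith only [i1, i2, Nat.zero_le (Multiset.card (setsWedges p.2) *
          (H'.map fun p => Multiset.card (setsWedges p.2)).sum)]
    have := key H fun p hp => hp
    rwa [← cardH] at this
  · have fold := runs_foldlM_counts H _ _ _ L (15 + 25 * n)
      (fun p hp C k => (hL p hp).2.2 C k) C (k + H.words)
    have hw := w.words
    rw [vertexCount_flat _ w]
    refine Runs.congr ((Runs.tick 1 k).bind ((r k).bind (fold.bind ((Runs.release _ _).bind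
      (Runs.pure _ _))))) rfl ?_ ?_ ?_ ?_
    · simp
    -- The `104` steps per set are paid by the at least `4` words it occupies. With `H.words ≤ 8 n`
    -- this and the final release give `244 = 28 + 26 * 8 + 8`.
    · have time : ∀ H' : WedgeMap V T, (H'.map fun p => 2 + 104 * p.2.length +
          Multiset.card (setsWedges p.2) * (28 + 53 * Nat.clog 2 (2 * n))).sum ≤ 26 * H'.words +
          (H'.map fun p => Multiset.card (setsWedges p.2)).sum *
            (28 + 53 * Nat.clog 2 (2 * n)) := by
        intro H'
        induction H' with
        | nil => simp
        | cons p H' ih =>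
          rw [WedgeMap.words_eq] at ih ⊢
          rw [HMap.total_cons, List.map_cons, List.sum_cons, List.map_cons, List.sum_cons]
          have := four_length_le_setsWords p.2
          nlinarith only [ih, this]
      have time := time H
      rw [← cardH] at time
      nlinarith only [time, hw]
    · omega
    · simp only [max_le_iff]
      omega

end StartVertex

/-! ### The whole run. -/

section Total

variable {V T : Type} [LinearOrder V] [AddCommGroup T] [LinearOrder T]

lemma higher_eq_true (inp : Input V T) (u w : V) : higher inp u w = true ↔
    (inp.adj w).length < (inp.adj u).length ∨
      ((inp.adj w).length = (inp.adj u).length ∧ w < u) := by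
  simp [higher]

lemma not_higher (inp : Input V T) (u w : V) : (!(higher inp u w)) = true ↔
    (inp.adj u).length < (inp.adj w).length ∨
      ((inp.adj u).length = (inp.adj w).length ∧ u ≤ w) := by
  rw [Bool.not_eq_true', ← Bool.not_eq_true, higher_eq_true]
  push Not
  constructor
  · rintro ⟨h1, h2⟩
    rcases h1.lt_or_eq with h | h
    · exact Or.inl h
    · exact Or.inr ⟨h, h2 h.symm⟩
  · rintro (h | ⟨h1, h2⟩)
    · exact ⟨h.le, fun e => absurd e h.ne'⟩
    · exact ⟨h1.le, fun _ => h2⟩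

/-- The time for sorting the edges of a vertex of degree `d`. -/
def sortCost (d : ℕ) : ℕ := 7 + 12 * d + 5 * d * Nat.clog 2 d

/-- Only the permutation is recorded: counts and cost bounds do not depend on the order inside the
adjacency lists. -/
lemma exists_runs_sortEdges (inp : Input V T) (D : ℕ) (hD : ∀ u, (inp.adj u).length ≤ D) :
    ∃ adj : V → List (V × T), (∀ u, (adj u).Perm (inp.adj u)) ∧
      ∀ k, Runs (sortEdges inp) adj
        (inp.vertices.map fun u => sortCost (inp.adj u).length).sum [] k k (k + (3 + 5 * D)) := by
  refine exists_runs_foldlM inp.vertices _ (fun adj : V → List (V × T) => ∀ u, (adj u).Perm (inp.adj u)) _ _ ?_ _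
    (fun u => List.Perm.refl _)
  intro adj hadj u _
  obtain ⟨l, pl, _, rl⟩ := exists_runs_mergeSortOp (fun x y : V × T => !(higher inp x.1 y.1))
    (fun a b c h h' => by
      rw [not_higher] at *
      rcases h with h | ⟨h, h1⟩ <;> rcases h' with h' | ⟨h', h1'⟩
      · exact Or.inl (h.trans h')
      · exact Or.inl (h' ▸ h)
      · exact Or.inl (h ▸ h')
      · exact Or.inr ⟨h.trans h', h1.trans h1'⟩)
    (fun a b => by
      rw [Bool.or_eq_true, not_higher, not_higher]
      rcases lt_trichotomy (inp.adj a.1).length (inp.adj b.1).length with h | h | h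
      · exact Or.inl (Or.inl h)
      · exact (le_total a.1 b.1).imp (fun h' => Or.inr ⟨h, h'⟩) (fun h' => Or.inr ⟨h.symm, h'⟩)
      · exact Or.inr (Or.inl h)) (adj u)
  refine ⟨Function.update adj u l, fun w => ?_, fun k => ?_⟩
  · by_cases h : w = u
    · subst h
      rw [Function.update_self]
      exact pl.trans (hadj w)
    · rw [Function.update_of_ne h]
      exact hadj w
  · have e := (hadj u).length_eq
    have := hD u
    refine Runs.congr ((Runs.tick 1 k).bind ((rl k).bind (Runs.pure _ k))) rfl rfl ?_ le_rfl ?_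
    · rw [sortCost, e]; omega
    · rw [e]; omega

variable [IsOrderedAddMonoid T]

/-- The number of wedges with start-vertex `u`. -/
def wedgeNum (inp : Input V T) (δ : T) (u : V) : ℕ :=
  Multiset.card (startWedges inp inp.adj δ u)

/-- The time of the iteration for `u` apart from the search in the arrays. -/
def vertexCost (inp : Input V T) (δ : T) (u : V) : ℕ :=
  1 + 2 * (inp.adj u).length + 18 * scanCount inp inp.adj u +
    wedgeNum inp δ u * (244 + 53 * Nat.clog 2 (2 * wedgeNum inp δ u))

lemma searchCost_flatMap (l : List V) (L : V → List ℕ) :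
    searchCost (l.flatMap L) = (l.map fun u => searchCost (L u)).sum := by
  induction l with
  | nil => rfl
  | cons u l ih => rw [List.flatMap_cons, searchCost_append, ih, List.map_cons, List.sum_cons]

/-- The result and the resources of a run. -/
theorem exists_run (inp : Input V T) (δ : T) (D N : ℕ) (hD : ∀ u, (inp.adj u).length ≤ D)
    (hN : ∀ u, wedgeNum inp δ u ≤ N) :
    ∃ L : V → List ℕ, (∀ u, ∀ a ∈ L u, 1 ≤ a) ∧
      (∀ u, 2 * (L u).sum + wedgeNum inp δ u ≤ wedgeNum inp δ u * wedgeNum inp δ u) ∧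
      (∀ u, probes inp δ u = (L u).length) ∧
      output inp δ = (inp.vertices.map fun u =>
        vertexCount (inp.isUpper u) δ (startWedges inp inp.adj δ u)).sum ∧
      runTime inp δ ≤ 6 + (inp.vertices.map fun u => sortCost (inp.adj u).length).sum +
        (inp.vertices.map (vertexCost inp δ)).sum +
        (inp.vertices.map fun u => searchCost (L u)).sum ∧
      runSpace inp δ ≤ inp.words + 24 + 5 * D + 33 * N := by
  obtain ⟨adj, ha, ra⟩ := exists_runs_sortEdges inp D hD
  have e1 := startWedges_congr inp ha δ
  have e2 := scanCount_congr inp ha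
  choose L h1 h2 h3 using exists_runs_startVertex inp adj δ
  simp only [e1, e2, (ha _).length_eq] at h2 h3
  have all : Runs (tbcPlus inp δ) _ _ _ 0 _ _ := (Runs.alloc 6 0).bind ((ra _).bind
    (runs_foldlM_counts inp.vertices (fun C u => startVertex inp adj δ u C)
      (fun u => vertexCount (inp.isUpper u) δ (startWedges inp inp.adj δ u)) (vertexCost inp δ) L
      (15 + 33 * N) (fun u _ C k => (h3 u C k).mono le_rfl le_rfl (by
        have := hN u
        rw [wedgeNum] at this
        omega)) (fun _ => 0) _))
  obtain ⟨a1, a2, a3, a4⟩ := all ⟨0, inp.words, inp.words, 0⟩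
  refine ⟨L, h1, h2, fun u => ?_, ?_, ?_, ?_⟩
  -- The measured iteration starts with zero counters, but `L u` is the same for all counters, so
  -- `probes` is the length of the list from the full run.
  · have one := Runs.bind (f := fun adj => startVertex inp adj δ u fun _ => 0) (ra 0)
      (h3 u (fun _ => 0) 0)
    exact (one ⟨0, inp.words, inp.words, 0⟩).2.2.1.trans (by simp)
  · refine a1.trans ?_
    exact zero_add _
  · refine a2.trans ?_
    simp only [List.nil_append, searchCost_flatMap]
    omega
  · refine ((a4 inp.words le_rfl).2).trans ?_
    simp only
    omega

end Total

/-! ### The cost of searching -/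

lemma log_two_ge : (2 / 3 : ℝ) ≤ Real.log 2 := by
  have := Real.log_two_gt_d9
  linarith

lemma two_mul_natLog_le (a : ℕ) : (2 * Nat.log 2 a : ℝ) ≤ 3 * Real.log a := by
  have h := Real.natLog_le_logb a 2
  have h2 := log_two_ge
  have h3 : 0 ≤ Real.log a := Real.log_natCast_nonneg a
  rw [Nat.cast_ofNat, Real.logb, le_div_iff₀ (by linarith)] at h
  nlinarith [h, mul_le_mul_of_nonneg_left h2 (Nat.cast_nonneg (α := ℝ) (Nat.log 2 a))]

/-- The inequality `log a ≤ a / c + log c` is concavity of the logarithm; it trades the individual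
sizes for their number and their sum, with `c` free. -/
lemma searchCost_le_of_pos (L : List ℕ) (hL : ∀ a ∈ L, 1 ≤ a) {c : ℝ} (hc : 0 < c) :
    (searchCost L : ℝ) ≤ L.length * (8 + 3 * Real.log c) + 3 * (L.sum / c) := by
  induction L with
  | nil => simp
  | cons a L ih =>
    have ih := ih fun b hb => hL b (List.mem_cons_of_mem _ hb)
    have ha := hL a List.mem_cons_self
    have h1 := two_mul_natLog_le a
    have ha' : (0 : ℝ) < a := by exact_mod_cast ha
    have h2 : Real.log a ≤ a / c + Real.log c := by
      have := Real.log_le_sub_one_of_pos (div_pos ha' hc)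
      rw [Real.log_div ha'.ne' hc.ne'] at this
      linarith
    have e : searchCost (a :: L) = 8 + 2 * Nat.log 2 a + searchCost L := by simp [searchCost]
    rw [e, List.sum_cons, List.length_cons]
    simp only [Nat.cast_add, Nat.cast_mul, Nat.cast_ofNat, Nat.cast_one]
    rw [add_div]
    nlinarith [h1, h2, ih]

lemma length_le_sum {L : List ℕ} (hL : ∀ a ∈ L, 1 ≤ a) : L.length ≤ L.sum := by
  induction L with
  | nil => simp
  | cons a L ih =>
    have := ih fun b hb => hL b (List.mem_cons_of_mem _ hb)
    have := hL a List.mem_cons_self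
    rw [List.length_cons, List.sum_cons]
    omega

/-- The function `n ^ 2 - n` is monotone, so the number of wedges may be replaced by `W`. -/
lemma two_mul_sum_le {L : List ℕ} {n W : ℕ} (h : 2 * L.sum + n ≤ n * n) (hn : n ≤ W) :
    2 * L.sum + W ≤ W * W := by
  obtain ⟨k, rfl⟩ := Nat.exists_eq_add_of_le hn
  rcases Nat.eq_zero_or_pos k with rfl | hk
  · simpa using h
  · nlinarith only [h, hk, Nat.zero_le (n * k), Nat.le_mul_self k, Nat.le_mul_of_pos_right n hk]

lemma max_le_of_sum {L : List ℕ} (hL : ∀ a ∈ L, 1 ≤ a) {W : ℕ} (hW : 0 < W)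
    (h : 2 * L.sum + W ≤ W * W) : max 1 ((L.length : ℝ) / W) ≤ W := by
  have hW' : (0 : ℝ) < W := by exact_mod_cast hW
  refine max_le (by exact_mod_cast hW) ?_
  rw [div_le_iff₀ hW']
  have := length_le_sum hL
  exact_mod_cast (by omega : L.length ≤ W * W)

/-- The choice `c = W / α` balances the two terms: there are at most `W α` arrays, and the sum of
sizes over `c` is at most `W α / 2`. The constant term `8 + 3 / 2` is absorbed by `log c ≥ 1 / 2`,
so `22 = 2 * 9.5 + 3`. -/
lemma searchCost_le {L : List ℕ} (hL : ∀ a ∈ L, 1 ≤ a) {W : ℕ} (hW : 0 < W)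
    (h : 2 * L.sum + W ≤ W * W) :
    (searchCost L : ℝ) ≤ 22 * ((W : ℝ) * (max 1 ((L.length : ℝ) / W) *
      Real.log ((W : ℝ) / max 1 ((L.length : ℝ) / W)))) := by
  have hW' : (0 : ℝ) < W := by exact_mod_cast hW
  have hmax := max_le_of_sum hL hW h
  set α := max 1 ((L.length : ℝ) / W) with hα
  have h1 : 1 ≤ α := le_max_left _ _
  have hα0 : 0 < α := by linarith
  have hQ : (L.length : ℝ) ≤ W * α := by
    have : (L.length : ℝ) / W ≤ α := le_max_right _ _
    rw [div_le_iff₀ hW'] at this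
    linarith
  -- Without probes `W / α` may be `1`, so the logarithm has no positive lower bound; with a probe,
  -- `W ≥ 2` and `α ≤ W / 2`.
  by_cases hl : L = []
  · subst hl
    have : 0 ≤ Real.log (W / α) := Real.log_nonneg ((one_le_div hα0).2 hmax)
    simp only [searchCost_nil, Nat.cast_zero]
    positivity
  · have hlen := List.length_pos_iff.2 hl
    have hls := length_le_sum hL
    have hW2 : 2 ≤ W := by nlinarith only [h, hlen, hls, hW]
    have hc : 2 ≤ W / α := by
      rw [le_div_iff₀ hα0]
      have : α ≤ W / 2 := by
        refine max_le ?_ ?_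
        · have : (2 : ℝ) ≤ W := by exact_mod_cast hW2
          linarith
        · rw [div_le_iff₀ hW']
          have : (2 * L.length : ℝ) ≤ W * W := by exact_mod_cast (by omega : 2 * L.length ≤ W * W)
          linarith
      linarith
    have hlog : 1 / 2 ≤ Real.log (W / α) := by
      have := Real.log_le_log two_pos hc
      have := log_two_ge
      linarith
    have hM : (L.sum : ℝ) / (W / α) ≤ W * α / 2 := by
      have : (2 * L.sum : ℝ) ≤ W * W := by exact_mod_cast (by omega : 2 * L.sum ≤ W * W)
      rw [div_le_iff₀ (by positivity)]
      have e : (W : ℝ) * α / 2 * (W / α) = W * W / 2 := by field_simp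
      rw [e]
      linarith
    have := searchCost_le_of_pos L hL (c := W / α) (by positivity)
    have hWα : 0 < W * α := by positivity
    have h8 : (L.length : ℝ) * (8 + 3 * Real.log (W / α)) ≤
        W * α * (8 + 3 * Real.log (W / α)) :=
      mul_le_mul_of_nonneg_right hQ (by linarith)
    nlinarith [mul_le_mul_of_nonneg_left hlog hWα.le]

lemma clog_le_log {d : ℕ} (hd : 1 ≤ d) :
    (Nat.clog 2 (1 + d) : ℝ) ≤ 3 * Real.log (1 + d) ∧ 1 ≤ 2 * Real.log (1 + (d : ℝ)) := by
  have h2 := log_two_ge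
  have hd' : (1 : ℝ) ≤ d := by exact_mod_cast hd
  have hl : Real.log 2 ≤ Real.log (1 + d) := Real.log_le_log two_pos (by linarith)
  refine ⟨?_, by linarith⟩
  have h1 : Nat.clog 2 (1 + d) ≤ Nat.log 2 d + 1 := by
    apply Nat.clog_le_of_le_pow
    have := Nat.lt_pow_succ_log_self one_lt_two d
    rw [Nat.succ_eq_add_one] at this
    omega
  have h3 : (Nat.log 2 d : ℝ) * Real.log 2 ≤ Real.log (1 + d) := by
    have h := Real.natLog_le_logb d 2
    rw [Nat.cast_ofNat, Real.logb, le_div_iff₀ (by linarith)] at h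
    exact h.trans (Real.log_le_log (by linarith) (by linarith))
  have h4 : (Nat.clog 2 (1 + d) : ℝ) ≤ Nat.log 2 d + 1 := by exact_mod_cast h1
  nlinarith [mul_le_mul_of_nonneg_left h2 (Nat.cast_nonneg (α := ℝ) (Nat.log 2 d))]

lemma sortCost_le {d : ℕ} (hd : 1 ≤ d) : (sortCost d : ℝ) ≤ 53 * (d * Real.log (1 + d)) := by
  obtain ⟨h1, h2⟩ := clog_le_log hd
  have h3 : (Nat.clog 2 d : ℝ) ≤ 3 * Real.log (1 + d) :=
    le_trans (by exact_mod_cast Nat.clog_mono_right 2 (by omega : d ≤ 1 + d)) h1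
  have hd' : (1 : ℝ) ≤ d := by exact_mod_cast hd
  have h4 := mul_le_mul_of_nonneg_left h3 (zero_le_one.trans hd')
  have h5 := mul_le_mul_of_nonneg_left h2 (zero_le_one.trans hd')
  rw [sortCost]
  push_cast
  nlinarith [h4, h5]

/-- At most `d ^ 2` wedges start at a vertex of degree `d`, so logarithms of their number are `O(log
(1 + d))`. -/
lemma clog_two_mul_le {d n : ℕ} (hd : 1 ≤ d) (hn : n ≤ d * d) :
    (Nat.clog 2 (2 * n) : ℝ) ≤ 8 * Real.log (1 + d) := by
  obtain ⟨h1, h2⟩ := clog_le_log hd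
  have : Nat.clog 2 (2 * n) ≤ 2 * Nat.clog 2 (1 + d) + 1 := by
    apply Nat.clog_le_of_le_pow
    have h3 := Nat.le_pow_clog one_lt_two (1 + d)
    have h4 : d ≤ 2 ^ Nat.clog 2 (1 + d) := by omega
    rw [pow_succ, two_mul (Nat.clog 2 (1 + d)), pow_add]
    have := Nat.mul_le_mul h4 h4
    omega
  have h3 : (Nat.clog 2 (2 * n) : ℝ) ≤ 2 * Nat.clog 2 (1 + d) + 1 := by exact_mod_cast this
  linarith

/-! ### Degrees -/

section Degrees

variable {V T : Type} [Fintype V] [LinearOrder V] [AddCommGroup T] [LinearOrder T]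
  {G : TemporalBipartiteGraph V T} {inp : Input V T}

open TemporalBipartiteGraph

lemma TemporalBipartiteGraph.endpoints_ne (G : TemporalBipartiteGraph V T) {e : V × V × T}
    (he : e ∈ G.E) : e.1 ≠ e.2.1 := by
  obtain ⟨h1, h2⟩ := G.bip e he
  exact fun h => Finset.disjoint_left.1 G.disj h1 (h ▸ h2)

/-- The entries of `adj u` correspond bijectively to the edges at `u`; injectivity needs that `u`
cannot lie in both layers. -/
lemma Input.Represents.sum_adj (h : inp.Represents G) (u : V) (f : V → ℕ) :
    ((inp.adj u).map fun p => f p.1).sum = ∑ e ∈ G.incident u, f (other u e) := by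
  obtain ⟨hn, hm⟩ := h.2.2.2 u
  rw [← List.sum_toFinset _ hn]
  symm
  refine Finset.sum_bij (fun e _ => (other u e, e.2.2)) ?_ ?_ ?_ ?_
  · rintro ⟨a, b, t⟩ hi
    obtain ⟨he, hu⟩ := Finset.mem_filter.1 hi
    rw [List.mem_toFinset, hm]
    simp only [other]
    split_ifs with ha
    · subst ha; exact Or.inl he
    · simp only at ha hu
      rw [hu.resolve_left ha] at he
      exact Or.inr he
  · rintro ⟨a, b, t⟩ he ⟨a', b', t'⟩ he' e
    obtain ⟨he, hu⟩ := Finset.mem_filter.1 he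
    obtain ⟨he', hu'⟩ := Finset.mem_filter.1 he'
    have h1 := G.bip _ he
    have h2 := G.bip _ he'
    simp only [other, Prod.mk.injEq] at e hu hu' h1 h2
    obtain ⟨e, rfl⟩ := e
    have d : ∀ {x}, x ∈ G.U → x ∈ G.L → False := fun h h' => Finset.disjoint_left.1 G.disj h h'
    split_ifs at e with ha ha' ha'
    · rw [ha, ha', e]
    · have := hu'.resolve_left ha'
      exact (d (ha ▸ h1.1) (this ▸ h2.2)).elim
    · have := hu.resolve_left ha
      exact (d (ha' ▸ h2.1) (this ▸ h1.2)).elim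
    · rw [e, hu.resolve_left ha, hu'.resolve_left ha']
  · rintro ⟨v, t⟩ hv
    rw [List.mem_toFinset, hm] at hv
    rcases hv with hv | hv
    · exact ⟨(u, v, t), Finset.mem_filter.2 ⟨hv, Or.inl rfl⟩, by simp [other]⟩
    · refine ⟨(v, u, t), Finset.mem_filter.2 ⟨hv, Or.inr rfl⟩, ?_⟩
      have := G.endpoints_ne hv
      simp only at this
      simp [other, this]
  · intro e _
    rfl

lemma Input.Represents.length_adj (h : inp.Represents G) (u : V) :
    (inp.adj u).length = G.deg u := by
  have := h.sum_adj u fun _ => 1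
  simpa [deg] using this

lemma Input.Represents.sum_vertices (h : inp.Represents G) {M : Type*} [AddCommMonoid M]
    (f : V → M) : (inp.vertices.map f).sum = ∑ u, f u := by
  rw [← List.sum_toFinset f h.1]
  congr 1
  ext u
  simp [h.2.1 u]

lemma Input.Represents.scanCount_le_W (h : inp.Represents G) (u : V) :
    scanCount inp inp.adj u ≤ G.W u := by
  have := h.sum_adj u fun v => if G.deg v ≤ G.deg u then G.deg v else 0
  rw [W, Finset.sum_filter, ← this, scanCount]
  refine List.sum_le_sum fun p _ => ?_
  by_cases hp : higher inp u p.1 = true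
  · rw [if_pos hp, h.length_adj]
    rw [higher_eq_true, h.length_adj, h.length_adj] at hp
    rw [if_pos (by omega)]
  · rw [if_neg hp]
    exact Nat.zero_le _

/-- Each of the `d` first edges leads to a middle-vertex of lower priority, hence of degree at most
`d`. -/
lemma Input.Represents.scanCount_le_sq (h : inp.Represents G) (u : V) :
    scanCount inp inp.adj u ≤ G.deg u * G.deg u := by
  have e : scanCount inp inp.adj u ≤ ((inp.adj u).map fun _ => G.deg u).sum := by
    refine List.sum_le_sum fun p _ => ?_
    split_ifs with hp
    · rw [h.length_adj]
      rw [higher_eq_true, h.length_adj, h.length_adj] at hp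
      omega
    · exact Nat.zero_le _
  refine e.trans (le_of_eq ?_)
  simp [h.length_adj]

lemma Input.Represents.wedgeNum_le (h : inp.Represents G) (δ : T) (u : V) :
    wedgeNum inp δ u ≤ G.W u ∧ wedgeNum inp δ u ≤ G.deg u * G.deg u :=
  ⟨(card_startWedges_le inp inp.adj δ u).trans (h.scanCount_le_W u),
    (card_startWedges_le inp inp.adj δ u).trans (h.scanCount_le_sq u)⟩

lemma TemporalBipartiteGraph.deg_le (G : TemporalBipartiteGraph V T) (u : V) :
    G.deg u ≤ G.E.card := Finset.card_le_card (Finset.filter_subset _ _)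

lemma TemporalBipartiteGraph.sum_deg_le (G : TemporalBipartiteGraph V T) :
    ∑ u, G.deg u ≤ 2 * G.E.card := by
  simp only [deg, incident, Finset.card_filter]
  rw [Finset.sum_comm, mul_comm, ← smul_eq_mul]
  refine Finset.sum_le_card_nsmul _ _ _ fun e _ => ?_
  rw [← Finset.card_filter]
  refine (Finset.card_le_card (t := {e.1, e.2.1}) fun u hu => ?_).trans Finset.card_le_two
  simpa [eq_comm] using (Finset.mem_filter.1 hu).2

/-- Split the left side over the edges. An edge contributes the logarithms at its two endpoints, at
most twice the one at the endpoint of larger degree; there the edge is counted in `W`, with weight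
at least `1` because no vertex is isolated. -/
lemma TemporalBipartiteGraph.sum_deg_mul_log_le (G : TemporalBipartiteGraph V T)
    (hG : ∀ u, 0 < G.deg u) :
    ∑ u, (G.deg u : ℝ) * Real.log (1 + (G.deg u : ℝ)) ≤
      2 * ∑ u, (G.W u : ℝ) * Real.log (1 + (G.deg u : ℝ)) := by
  set l : V → ℝ := fun u => Real.log (1 + (G.deg u : ℝ)) with hl
  have lmono : ∀ u v, G.deg u ≤ G.deg v → l u ≤ l v := fun u v h => by
    have : (G.deg u : ℝ) ≤ G.deg v := by exact_mod_cast h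
    exact Real.log_le_log (by positivity) (by linarith)
  have l0 : ∀ u, 0 ≤ l u := fun u => Real.log_nonneg (by simp)
  have hW : ∀ u, (((G.incident u).filter fun e => G.deg (other u e) ≤ G.deg u).card : ℝ) ≤
      G.W u := fun u => by
    have : ((G.incident u).filter fun e => G.deg (other u e) ≤ G.deg u).card ≤ G.W u := by
      rw [W, Finset.card_eq_sum_ones]
      exact Finset.sum_le_sum fun e _ => hG _
    exact_mod_cast this
  have h1 : ∑ u, (G.deg u : ℝ) * l u =
      ∑ e ∈ G.E, ∑ u, if e.1 = u ∨ e.2.1 = u then l u else 0 := by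
    rw [Finset.sum_comm]
    refine Finset.sum_congr rfl fun u _ => ?_
    rw [← Finset.sum_filter, Finset.sum_const, nsmul_eq_mul]
    rfl
  have h2 : ∑ u, (((G.incident u).filter fun e => G.deg (other u e) ≤ G.deg u).card : ℝ) * l u =
      ∑ e ∈ G.E, ∑ u, if (e.1 = u ∨ e.2.1 = u) ∧ G.deg (other u e) ≤ G.deg u then l u else 0 := by
    rw [Finset.sum_comm]
    refine Finset.sum_congr rfl fun u _ => ?_
    rw [incident, Finset.filter_filter, ← Finset.sum_filter, Finset.sum_const, nsmul_eq_mul]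
  have h3 : ∑ u, (((G.incident u).filter fun e => G.deg (other u e) ≤ G.deg u).card : ℝ) * l u ≤
      ∑ u, (G.W u : ℝ) * l u :=
    Finset.sum_le_sum fun u _ => mul_le_mul_of_nonneg_right (hW u) (l0 u)
  rw [h1]
  refine le_trans ?_ (mul_le_mul_of_nonneg_left h3 two_pos.le)
  rw [h2, Finset.mul_sum]
  refine Finset.sum_le_sum fun e he => ?_
  have hne := G.endpoints_ne he
  have le1 : (∑ u, if e.1 = u ∨ e.2.1 = u then l u else 0) ≤ l e.1 + l e.2.1 := by
    have : ∀ u, (if e.1 = u ∨ e.2.1 = u then l u else 0) ≤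
        (if e.1 = u then l u else 0) + if e.2.1 = u then l u else 0 := by
      intro u
      have := l0 u
      split_ifs <;> simp_all
    refine (Finset.sum_le_sum fun u _ => this u).trans ?_
    rw [Finset.sum_add_distrib]
    simp
  have nn : ∀ u ∈ Finset.univ, (0 : ℝ) ≤
      if (e.1 = u ∨ e.2.1 = u) ∧ G.deg (other u e) ≤ G.deg u then l u else 0 := fun u _ => by
    split_ifs
    · exact l0 u
    · exact le_rfl
  rcases le_total (G.deg e.2.1) (G.deg e.1) with h | h
  · have := Finset.single_le_sum nn (Finset.mem_univ e.1)
    rw [if_pos ⟨Or.inl rfl, by simpa [other] using h⟩] at this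
    have := lmono _ _ h
    linarith
  · have := Finset.single_le_sum nn (Finset.mem_univ e.2.1)
    rw [if_pos ⟨Or.inr rfl, by simpa [other, hne] using h⟩] at this
    have := lmono _ _ h
    linarith

end Degrees

/-! ### Types of butterflies -/

section Types

variable {T : Type} [LinearOrder T]

/-- The type of two wedges in any order. -/
def pairType (p q r s : T) : Fin 6 :=
  if min p q < min r s then arcType p q r s else arcType r s p q

def Distinct (p q r s : T) : Prop := p ≠ q ∧ p ≠ r ∧ p ≠ s ∧ q ≠ r ∧ q ≠ s ∧ r ≠ s

lemma Distinct.min_ne {p q r s : T} (h : Distinct p q r s) : min p q ≠ min r s := by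
  obtain ⟨_, h2, h3, h4, h5, _⟩ := h
  rcases min_choice p q with e | e <;> rcases min_choice r s with e' | e' <;> rw [e, e'] <;>
    assumption

lemma Distinct.swap_wedges {p q r s : T} (h : Distinct p q r s) : Distinct r s p q := by
  obtain ⟨h1, h2, h3, h4, h5, h6⟩ := h
  exact ⟨h6, h2.symm, h4.symm, h3.symm, h5.symm, h1⟩

lemma Distinct.swap_ends {p q r s : T} (h : Distinct p q r s) : Distinct q p s r := by
  obtain ⟨h1, h2, h3, h4, h5, h6⟩ := h
  exact ⟨h1.symm, h5, h4, h3, h2, h6.symm⟩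

lemma Distinct.transpose {p q r s : T} (h : Distinct p q r s) : Distinct p r q s := by
  obtain ⟨h1, h2, h3, h4, h5, h6⟩ := h
  exact ⟨h2, h1, h3, h4.symm, h6, h5⟩

lemma pairType_swap_wedges {p q r s : T} (h : Distinct p q r s) :
    pairType r s p q = pairType p q r s := by
  unfold pairType
  rcases lt_or_gt_of_ne h.min_ne with h' | h'
  · rw [if_pos h', if_neg h'.not_gt]
  · rw [if_pos h', if_neg h'.not_gt]

lemma arcType_swap_ends {p q r s : T} (h : Distinct p q r s) :
    arcType q p s r = arcType p q r s := by
  obtain ⟨h1, _, _, _, _, h6⟩ := h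
  unfold arcType
  rw [min_comm s r, max_comm q p, max_comm s r]
  have : (q < p ↔ s < r) ↔ (p < q ↔ r < s) := by
    rcases lt_or_gt_of_ne h1 with h | h <;> rcases lt_or_gt_of_ne h6 with h' | h' <;>
      simp [h, h', h.not_gt, h'.not_gt]
  simp only [this]

lemma pairType_swap_ends {p q r s : T} (h : Distinct p q r s) :
    pairType q p s r = pairType p q r s := by
  unfold pairType
  rw [min_comm q p, min_comm s r, arcType_swap_ends h, arcType_swap_ends h.swap_wedges]

set_option maxHeartbeats 2000000 in
-- Cutting the same four edges at the other layer exchanges the times `q` and `r`. The sign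
-- comparisons leave the orderings of four distinct times, and each is checked.
lemma pairType_transpose {p q r s : T} (h : Distinct p q r s) :
    pairType p r q s = convert false (pairType p q r s) := by
  obtain ⟨h1, h2, h3, h4, h5, h6⟩ := h
  unfold pairType arcType convert
  rcases lt_or_gt_of_ne h1 with h1 | h1 <;> rcases lt_or_gt_of_ne h2 with h2 | h2 <;>
  rcases lt_or_gt_of_ne h3 with h3 | h3 <;> rcases lt_or_gt_of_ne h4 with h4 | h4 <;>
  rcases lt_or_gt_of_ne h5 with h5 | h5 <;> rcases lt_or_gt_of_ne h6 with h6 | h6 <;>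
  first
  | order
  | (simp [h1, h2, h3, h4, h5, h6, h1.le, h2.le, h5.le, h6.le, h1.not_gt, h2.not_gt,
      h3.not_gt, h4.not_gt, h5.not_gt, h6.not_gt])

variable [AddCommGroup T] [IsOrderedAddMonoid T]

lemma hit_apply (upper : Bool) (c₁ c₂ c₃ : Fin 6) {a b c d : T} (i : Fin 6) :
    hit upper c₁ c₂ c₃ (a, b) (c, d) i = if (b ≠ c ∧ b ≠ d ∨ b < c) ∧
      convert upper (if b < c then c₁ else if b < d then c₂ else c₃) = i then 1 else 0 := by
  unfold hit
  rcases lt_trichotomy b c with h | h | h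
  · simp [h, Pi.single_apply, eq_comm]
  · simp [h]
  · rcases lt_trichotomy b d with h' | h' | h'
    · simp [h, h', h.not_gt, h.ne', h'.ne, Pi.single_apply, eq_comm]
    · subst h'
      simp [h.not_gt]
    · simp [h, h', h.not_gt, h'.not_gt, h.ne', h'.ne', Pi.single_apply, eq_comm]

open Classical in
-- Exactly one of the two orders of a pair of wedges passes the test on start times, so a butterfly
-- is counted once in the double sum.
lemma meet_orient (upper : Bool) (δ : T) {p q r s : T} (hpq : p ≠ q) (hrs : r ≠ s) (i : Fin 6) :
    meet upper δ (orient p q) (orient r s) i =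
      if min p q < min r s ∧ max r s ≤ min p q + δ ∧ Distinct p q r s ∧
        convert upper (pairType p q r s) = i then 1 else 0 := by
  have e : ∀ {p q : T}, p ≠ q → orient p q = (decide (p < q), min p q, max p q) := by
    intro p q h
    unfold orient
    rcases lt_or_gt_of_ne h with h | h
    · simp [h, h.le]
    · simp [h.not_gt, h.le]
  rw [e hpq, e hrs]
  unfold meet meetAny
  by_cases h1 : min p q < min r s ∧ max r s ≤ min p q + δ
  · rw [if_pos h1]
    -- Given that the first wedge starts strictly earlier, the only possible coincidences involve
    -- its arrival time, and these are the cases where `hit` vanishes.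
    have hd : Distinct p q r s ↔ (max p q ≠ min r s ∧ max p q ≠ max r s ∨ max p q < min r s) := by
      have h := h1.1
      unfold Distinct
      rcases lt_or_gt_of_ne hpq with g | g <;> rcases lt_or_gt_of_ne hrs with g' | g' <;>
        simp only [min_eq_left g.le, min_eq_right g.le, max_eq_left g.le, max_eq_right g.le,
          min_eq_left g'.le, min_eq_right g'.le, max_eq_left g'.le, max_eq_right g'.le] at h ⊢ <;>
        grind
    have ha : pairType p q r s = arcType p q r s := if_pos h1.1
    simp only [h1.1, h1.2, true_and, ha, hd]
    by_cases h2 : p < q ↔ r < s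
    · rw [if_pos (by simpa using h2)]
      simp only [hit_apply, arcType, if_pos h2]
    · rw [if_neg (by simpa using h2)]
      simp only [hit_apply, arcType, if_neg h2]
  · rw [if_neg h1, if_neg (fun h => h1 ⟨h.1, h.2.1⟩)]
    rfl

end Types

/-! ### Butterflies as sets of edges -/

section EdgeSets

variable {V T : Type}

/-- The edges of two wedges from `u` to `w` through `v` at `p, q` and through `x` at `r, s`. -/
def quad (u w v x : V) (p q r s : T) : Set (V × V × T) :=
  {(u, v, p), (w, v, q), (u, x, r), (w, x, s)}

/-- The edge with its endpoints in the order of the layers. -/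
def place (upper : Bool) (e : V × V × T) : V × V × T :=
  if upper then e else (e.2.1, e.1, e.2.2)

lemma place_injective (upper : Bool) : Function.Injective (place upper : V × V × T → V × V × T) := by
  rintro ⟨a, b, t⟩ ⟨a', b', t'⟩ h
  cases upper <;> simp [place] at h <;> simp [h]

lemma quad_swap_wedges (u w v x : V) (p q r s : T) : quad u w x v r s p q = quad u w v x p q r s := by
  ext e
  simp only [quad, Set.mem_insert_iff, Set.mem_singleton_iff]
  tauto

lemma quad_swap_ends (u w v x : V) (p q r s : T) : quad w u v x q p s r = quad u w v x p q r s := by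
  ext e
  simp only [quad, Set.mem_insert_iff, Set.mem_singleton_iff]
  tauto

lemma place_true_image (S : Set (V × V × T)) : place true '' S = S :=
  (Set.image_congr fun _ _ => rfl).trans (Set.image_id S)

lemma place_false_image_quad (u w v x : V) (p q r s : T) :
    place false '' quad u w v x p q r s = quad v x u w p r q s := by
  ext e
  simp only [quad, place, Set.image_insert_eq, Set.image_singleton, Set.mem_insert_iff,
    Set.mem_singleton_iff, Bool.false_eq_true, if_false]
  tauto

lemma exists_mem_place_image_quad (upper : Bool) (u w v x : V) (p q r s : T) (y : V) :
    (∃ e ∈ place upper '' quad u w v x p q r s, e.1 = y ∨ e.2.1 = y) ↔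
      y = u ∨ y = w ∨ y = v ∨ y = x := by
  cases upper <;> simp [quad, place] <;> tauto

/-- With the vertex `u` fixed, the edge set determines the two wedges up to their order. -/
lemma quad_eq_quad {u w v x w' v' x' : V} {p q r s p' q' r' s' : T} (hw : u ≠ w) (hv : v ≠ x)
    (hw' : u ≠ w') (hv' : v' ≠ x') (h : quad u w v x p q r s = quad u w' v' x' p' q' r' s') :
    (w = w' ∧ v = v' ∧ x = x' ∧ p = p' ∧ q = q' ∧ r = r' ∧ s = s') ∨
      (p = r' ∧ q = s' ∧ r = p' ∧ s = q') := by
  have h1 : (u, v, p) ∈ quad u w' v' x' p' q' r' s' := h ▸ by simp [quad]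
  have h2 : (w, v, q) ∈ quad u w' v' x' p' q' r' s' := h ▸ by simp [quad]
  have h3 : (u, x, r) ∈ quad u w' v' x' p' q' r' s' := h ▸ by simp [quad]
  have h4 : (w, x, s) ∈ quad u w' v' x' p' q' r' s' := h ▸ by simp [quad]
  simp only [quad, Set.mem_insert_iff, Set.mem_singleton_iff, Prod.mk.injEq, hw', hw.symm,
    false_and, true_and, or_false, false_or] at h1 h2 h3 h4
  grind

variable [AddCommGroup T] [LinearOrder T]

/-- `S` is the set of the edges of a butterfly of type `i`. -/
def IsButterflySet (G : TemporalBipartiteGraph V T) (δ : T) (i : Fin 6) (S : Set (V × V × T)) :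
    Prop :=
  (∀ e ∈ S, e ∈ G.E) ∧ (∃ m, ∀ e ∈ S, m ≤ e.2.2 ∧ e.2.2 ≤ m + δ) ∧
    ∃ (a b v x : V) (p q r s : T), a ≠ b ∧ v ≠ x ∧ Distinct p q r s ∧
      S = quad a b v x p q r s ∧ pairType p q r s = i

variable [IsOrderedAddMonoid T] {G : TemporalBipartiteGraph V T} {δ : T}

lemma IsTemporalButterfly.strictMono {e : Fin 4 → V × V × T} (h : IsTemporalButterfly G δ e) :
    StrictMono fun k => (e k).2.2 := by
  obtain ⟨_, ⟨h1, h2, h3⟩, _⟩ := h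
  rw [Fin.strictMono_iff_lt_succ]
  intro k
  fin_cases k
  · exact h1
  · exact h2
  · exact h3

/-- Increasing timestamps fix the order of the edges, so sequences may be replaced by edge sets. -/
lemma injOn_range_butterflies (i : Fin 6) :
    Set.InjOn Set.range {e : Fin 4 → V × V × T | IsTemporalButterfly G δ e ∧ HasType e i} := by
  rintro e ⟨he, _⟩ e' ⟨he', _⟩ h
  have ht : (fun k => (e k).2.2) = fun k => (e' k).2.2 := by
    refine (he.strictMono.range_inj he'.strictMono).1 ?_
    exact (Set.range_comp (fun z : V × V × T => z.2.2) e).trans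
      ((congrArg _ h).trans (Set.range_comp (fun z : V × V × T => z.2.2) e').symm)
  funext k
  obtain ⟨j, hj⟩ : e k ∈ Set.range e' := h ▸ Set.mem_range_self k
  have : j = k := he'.strictMono.injective (by
    rw [hj, ← congrFun ht k])
  rw [← hj, this]

/-- The four listed edges differ in an endpoint, and edges of the sequence with equal timestamps
coincide; hence the four times are distinct. -/
lemma IsTemporalButterfly.isButterflySet {e : Fin 4 → V × V × T} (h : IsTemporalButterfly G δ e)
    {i : Fin 6} (hi : HasType e i) : IsButterflySet G δ i (Set.range e) := by
  have hm := h.strictMono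
  obtain ⟨hE, _, hδ, _⟩ := h
  refine ⟨?_, ⟨(e 0).2.2, ?_⟩, ?_⟩
  · rintro _ ⟨k, rfl⟩
    exact hE k
  · rintro _ ⟨k, rfl⟩
    exact ⟨hm.monotone (Fin.zero_le k), (hm.monotone (Fin.le_last k)).trans (sub_le_iff_le_add'.1 hδ)⟩
  · obtain ⟨a, b, v, x, p, q, r, s, hab, hvx, hS, hlt, ha⟩ := hi
    have inj : ∀ y ∈ Set.range e, ∀ z ∈ Set.range e, y.2.2 = z.2.2 → y = z := by
      rintro _ ⟨k, rfl⟩ _ ⟨j, rfl⟩ h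
      rw [hm.injective h]
    rw [hS] at inj
    simp only [Set.mem_insert_iff, Set.mem_singleton_iff, forall_eq_or_imp, forall_eq,
      Prod.mk.injEq] at inj
    refine ⟨a, b, v, x, p, q, r, s, hab, hvx, ?_, hS, (if_pos hlt).trans ha⟩
    unfold Distinct
    grind

/-- The sequence is obtained by enumerating the four distinct times increasingly and taking the edge
at each time. If the second wedge starts first, the roles of `v` and `x` are exchanged. -/
lemma IsButterflySet.exists_range {i : Fin 6} {S : Set (V × V × T)} (h : IsButterflySet G δ i S) :
    ∃ e : Fin 4 → V × V × T, (IsTemporalButterfly G δ e ∧ HasType e i) ∧ Set.range e = S := by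
  obtain ⟨hE, ⟨m, hm⟩, a, b, v, x, p, q, r, s, hab, hvx, hd, hS, hi⟩ := h
  obtain ⟨h1, h2, h3, h4, h5, h6⟩ := id hd
  have hc : ({p, q, r, s} : Finset T).card = 4 := by
    rw [Finset.card_insert_of_notMem, Finset.card_insert_of_notMem, Finset.card_insert_of_notMem,
      Finset.card_singleton] <;> simp [*]
  set f := Finset.orderEmbOfFin _ hc
  have hf : Set.range f = {p, q, r, s} := by
    rw [Finset.range_orderEmbOfFin]; simp
  have inj : ∀ y ∈ S, ∀ z ∈ S, y.2.2 = z.2.2 → y = z := by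
    subst hS
    simp only [quad, Set.mem_insert_iff, Set.mem_singleton_iff, forall_eq_or_imp, forall_eq]
    simp [h1, h2, h3, h4, h5, h6, h1.symm, h2.symm, h3.symm, h4.symm, h5.symm, h6.symm]
  have hT : ∀ t, t ∈ Set.range f ↔ ∃ y ∈ S, y.2.2 = t := by
    intro t
    rw [hf, hS]
    simp [quad, eq_comm]
  have hex : ∀ k, ∃ y ∈ S, y.2.2 = f k := fun k => (hT _).1 ⟨k, rfl⟩
  choose e he het using hex
  have hr : Set.range e = S := by
    refine Set.Subset.antisymm (by rintro _ ⟨k, rfl⟩; exact he k) fun y hy => ?_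
    obtain ⟨k, hk⟩ := (hT y.2.2).2 ⟨y, hy, rfl⟩
    exact ⟨k, inj _ (he k) _ hy ((het k).trans hk)⟩
  have lt : ∀ {k j : Fin 4}, k < j → (e k).2.2 < (e j).2.2 := fun {k j} h => by
    rw [het, het]; exact f.strictMono h
  have hbip : ∀ y ∈ S, y.1 ∈ G.U ∧ y.2.1 ∈ G.L := fun y hy => G.bip y (hE y hy)
  refine ⟨e, ⟨⟨fun k => hE _ (he k), ⟨lt (by decide), lt (by decide), lt (by decide)⟩, ?_, ?_⟩, ?_⟩,
    hr⟩
  · rw [sub_le_iff_le_add']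
    exact (hm _ (he 3)).2.trans (by gcongr; exact (hm _ (he 0)).1)
  · rw [hS] at hbip
    refine ⟨a, (hbip (a, v, p) (by simp [quad])).1, b, (hbip (b, v, q) (by simp [quad])).1,
      v, (hbip (a, v, p) (by simp [quad])).2, x, (hbip (a, x, r) (by simp [quad])).2, hab, hvx, ?_⟩
    rw [show (fun k => ((e k).1, (e k).2.1)) = (fun y : V × V × T => (y.1, y.2.1)) ∘ e from rfl,
      Set.range_comp, hr, hS]
    simp [quad, Set.image_insert_eq]
  · rw [pairType] at hi
    split_ifs at hi with hlt
    · exact ⟨a, b, v, x, p, q, r, s, hab, hvx, hr.trans hS, hlt, hi⟩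
    · refine ⟨a, b, x, v, r, s, p, q, hab, hvx.symm,
        hr.trans (hS.trans (quad_swap_wedges a b v x p q r s).symm), ?_, hi⟩
      exact lt_of_le_of_ne (not_lt.1 hlt) hd.min_ne.symm

lemma butterflyCount_eq (G : TemporalBipartiteGraph V T) (δ : T) (i : Fin 6) :
    butterflyCount G δ i = Set.ncard {S | IsButterflySet G δ i S} := by
  rw [butterflyCount, ← (injOn_range_butterflies i).ncard_image]
  congr 1
  ext S
  constructor
  · rintro ⟨e, ⟨he, hi⟩, rfl⟩
    exact he.isButterflySet hi
  · exact fun h => h.exists_range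

end EdgeSets

/-! ### Correctness of the counts -/

section Correctness

variable {V T : Type} [LinearOrder V] [AddCommGroup T] [LinearOrder T]

/-- The pairs of edges that form a wedge with start-vertex `u`. -/
def wedgeFinset (inp : Input V T) (δ : T) (u : V) : Finset (Σ _ : V × T, V × T) :=
  ((inp.adj u).toFinset.sigma fun e => (inp.adj e.1).toFinset).filter fun z =>
    higher inp u z.1.1 ∧ higher inp u z.2.1 ∧ z.1.2 ≠ z.2.2 ∧ |z.2.2 - z.1.2| ≤ δ

lemma mem_wedgeFinset {inp : Input V T} {δ : T} {u v w : V} {p q : T} :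
    (⟨(v, p), (w, q)⟩ : Σ _ : V × T, V × T) ∈ wedgeFinset inp δ u ↔
      ((v, p) ∈ inp.adj u ∧ (w, q) ∈ inp.adj v) ∧
        higher inp u v ∧ higher inp u w ∧ p ≠ q ∧ |q - p| ≤ δ := by
  simp [wedgeFinset]

lemma startWedges_eq (inp : Input V T) (h : ∀ u, (inp.adj u).Nodup) (δ : T) (u : V) :
    startWedges inp inp.adj δ u = (wedgeFinset inp δ u).val.map
      fun z => (z.2.1, z.1.1, orient z.1.2 z.2.2) := by
  have e : (wedgeFinset inp δ u).val.map (fun z => (z.2.1, z.1.1, orient z.1.2 z.2.2)) =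
      ∑ z ∈ wedgeFinset inp δ u, {(z.2.1, z.1.1, orient z.1.2 z.2.2)} := by
    exact (Multiset.sum_map_singleton _).symm.trans (by rw [Multiset.map_map]; rfl)
  rw [e, wedgeFinset, Finset.sum_filter, Finset.sum_sigma, List.sum_toFinset _ (h u), startWedges]
  congr 1
  refine List.map_congr_left fun y _ => ?_
  rw [List.sum_toFinset _ (h y.1)]
  by_cases hy : higher inp u y.1 = true
  · simp only [hy, if_true, true_and, wedgesFrom]
  · simp [hy]

/-- The two wedges, in the order of their start times, form a butterfly of type `i` with
start-vertex `t.1`. -/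
def IsDouble (inp : Input V T) (δ : T) (i : Fin 6) (t : Σ _ : V, (Σ _ : V × T, V × T) ×
    (Σ _ : V × T, V × T)) : Prop :=
  t.2.1.2.1 = t.2.2.2.1 ∧ t.2.1.1.1 ≠ t.2.2.1.1 ∧
    min t.2.1.1.2 t.2.1.2.2 < min t.2.2.1.2 t.2.2.2.2 ∧
    max t.2.2.1.2 t.2.2.2.2 ≤ min t.2.1.1.2 t.2.1.2.2 + δ ∧
    Distinct t.2.1.1.2 t.2.1.2.2 t.2.2.1.2 t.2.2.2.2 ∧
    convert (inp.isUpper t.1) (pairType t.2.1.1.2 t.2.1.2.2 t.2.2.1.2 t.2.2.2.2) = i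

variable [Fintype V] [IsOrderedAddMonoid T]

open Classical in
/-- The pairs of wedges that are counted for the type `i`. -/
noncomputable def doubles (inp : Input V T) (δ : T) (i : Fin 6) :
    Finset (Σ _ : V, (Σ _ : V × T, V × T) × (Σ _ : V × T, V × T)) :=
  (Finset.univ.sigma fun u => wedgeFinset inp δ u ×ˢ wedgeFinset inp δ u).filter
    (IsDouble inp δ i)

/-- The adjacency lists have no repetitions, so the multiset sums are sums over finsets and the
`0`-`1` summands of `meet_orient` count `doubles`. -/
lemma sum_vertexCount (inp : Input V T) (h : ∀ u, (inp.adj u).Nodup) (δ : T) (i : Fin 6) :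
    (∑ u, vertexCount (inp.isUpper u) δ (startWedges inp inp.adj δ u)) i =
      (doubles inp δ i).card := by
  classical
  rw [doubles, Finset.card_filter, Finset.sum_sigma, Finset.sum_apply]
  refine Finset.sum_congr rfl fun u _ => ?_
  rw [vertexCount, cross, startWedges_eq inp h, Finset.sum_product, Multiset.map_map]
  change (∑ z ∈ wedgeFinset inp δ u, _ : Counts) i = _
  rw [Finset.sum_apply]
  refine Finset.sum_congr rfl fun z hz => ?_
  simp only [Function.comp_apply, Multiset.map_map]
  change (∑ z' ∈ wedgeFinset inp δ u, _ : Counts) i = _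
  rw [Finset.sum_apply]
  refine Finset.sum_congr rfl fun z' hz' => ?_
  have h1 := (Finset.mem_filter.1 hz).2.2.2.1
  have h2 := (Finset.mem_filter.1 hz').2.2.2.1
  unfold IsDouble
  simp only
  by_cases e1 : z.2.1 = z'.2.1
  · by_cases e2 : z.1.1 = z'.1.1
    · simp [e2]
    · simp only [e1, if_true, e2, ne_eq, not_false_eq_true, true_and]
      exact meet_orient (inp.isUpper u) δ h1 h2 i
  · simp [e1]

/-- The edges of two wedges. -/
def doubleEdges (inp : Input V T) (t : Σ _ : V, (Σ _ : V × T, V × T) × (Σ _ : V × T, V × T)) :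
    Set (V × V × T) :=
  place (inp.isUpper t.1) '' quad t.1 t.2.1.2.1 t.2.1.1.1 t.2.2.1.1 t.2.1.1.2 t.2.1.2.2
    t.2.2.1.2 t.2.2.2.2

open Classical in
lemma mem_doubles {inp : Input V T} {δ : T} {i : Fin 6} {u v w x w' : V} {p q r s : T} :
    (⟨u, ⟨(v, p), (w, q)⟩, ⟨(x, r), (w', s)⟩⟩ :
      Σ _ : V, (Σ _ : V × T, V × T) × (Σ _ : V × T, V × T)) ∈ doubles inp δ i ↔
      ((((v, p) ∈ inp.adj u ∧ (w, q) ∈ inp.adj v) ∧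
        higher inp u v ∧ higher inp u w ∧ p ≠ q ∧ |q - p| ≤ δ) ∧
      (((x, r) ∈ inp.adj u ∧ (w', s) ∈ inp.adj x) ∧
        higher inp u x ∧ higher inp u w' ∧ r ≠ s ∧ |s - r| ≤ δ)) ∧
      w = w' ∧ v ≠ x ∧ min p q < min r s ∧ max r s ≤ min p q + δ ∧ Distinct p q r s ∧
        convert (inp.isUpper u) (pairType p q r s) = i := by
  unfold doubles
  rw [Finset.mem_filter, Finset.mem_sigma, Finset.mem_product, mem_wedgeFinset, mem_wedgeFinset]
  simp [IsDouble]

lemma higher_asymm {inp : Input V T} {u w : V} (h : higher inp u w = true)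
    (h' : higher inp w u = true) : False := by
  rw [higher_eq_true] at h h'
  rcases h with h | ⟨h, g⟩ <;> rcases h' with h' | ⟨h', g'⟩
  · omega
  · omega
  · omega
  · exact g.not_gt g'

/-- The start-vertex is the vertex of highest priority on the edge set, so it can be recovered. Then
`quad_eq_quad` leaves only an exchange of the two wedges, which contradicts the order of their start
times. -/
lemma injOn_doubleEdges (inp : Input V T) (δ : T) (i : Fin 6) :
    Set.InjOn (doubleEdges inp) (doubles inp δ i) := by
  rintro ⟨u, ⟨⟨v, p⟩, w, q⟩, ⟨x, r⟩, y, s⟩ h ⟨u', ⟨⟨v', p'⟩, w', q'⟩, ⟨x', r'⟩, y', s'⟩ h' e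
  rw [Finset.mem_coe, mem_doubles] at h h'
  obtain ⟨⟨⟨_, a1, a2, _⟩, ⟨_, a3, _⟩⟩, rfl, a4, a5, _⟩ := h
  obtain ⟨⟨⟨_, b1, b2, _⟩, ⟨_, b3, _⟩⟩, rfl, b4, b5, _⟩ := h'
  have irr : ∀ {y z : V}, higher inp y z = true → y ≠ z := by
    rintro y _ hy rfl
    exact higher_asymm hy hy
  simp only [doubleEdges] at e
  obtain rfl : u = u' := by
    have m1 := (exists_mem_place_image_quad (inp.isUpper u) u w v x p q r s u').1
      (by rw [e, exists_mem_place_image_quad]; exact Or.inl rfl)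
    have m2 := (exists_mem_place_image_quad (inp.isUpper u') u' w' v' x' p' q' r' s' u).1
      (by rw [← e, exists_mem_place_image_quad]; exact Or.inl rfl)
    by_contra hne
    have c1 : higher inp u u' = true := by
      rcases m1 with h | h | h | h
      · exact absurd h.symm hne
      all_goals rw [h]; assumption
    have c2 : higher inp u' u = true := by
      rcases m2 with h | h | h | h
      · exact absurd h hne
      all_goals rw [h]; assumption
    exact higher_asymm c1 c2
  rcases quad_eq_quad (irr a2) a4 (irr b2) b4 ((place_injective _).image_injective e) with
    ⟨rfl, rfl, rfl, rfl, rfl, rfl, rfl⟩ | ⟨rfl, rfl, rfl, rfl⟩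
  · rfl
  · exact absurd a5 b5.not_gt

variable {inp : Input V T} {G : TemporalBipartiteGraph V T}

lemma Input.Represents.mem_adj (h : inp.Represents G) {u v : V} {t : T} (hu : inp.isUpper u = true) :
    ((v, t) ∈ inp.adj u ↔ (u, v, t) ∈ G.E) ∧ ((u, t) ∈ inp.adj v ↔ (u, v, t) ∈ G.E) := by
  have : (v, u, t) ∉ G.E := fun h' =>
    Finset.disjoint_left.1 G.disj ((h.2.2.1 u).1 hu) (G.bip _ h').2
  rw [(h.2.2.2 u).2, (h.2.2.2 v).2]
  simp [this]

lemma exists_highest (inp : Input V T) {S : Finset V} (hS : S.Nonempty) :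
    ∃ u ∈ S, ∀ w ∈ S, w ≠ u → higher inp u w = true := by
  obtain ⟨u, hu, hm⟩ := S.exists_max_image (fun u => toLex ((inp.adj u).length, u)) hS
  refine ⟨u, hu, fun w hw hne => ?_⟩
  have := lt_of_le_of_ne (hm w hw) fun e => hne (congrArg (fun z => (ofLex z).2) e)
  rw [Prod.Lex.lt_iff] at this
  exact (higher_eq_true inp u w).2 this

lemma convert_convert (upper : Bool) (i : Fin 6) : convert upper (convert upper i) = i := by
  revert i upper
  decide

/-- The wedge with the earlier start is put first; `pairType` does not see this exchange. -/
lemma exists_double_of_forall_higher {δ : T} {u w v x : V} {p q r s m : T}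
    {upper : Bool} (hu : inp.isUpper u = upper) (hv : higher inp u v = true) (hw : higher inp u w = true)
    (hx : higher inp u x = true) (hvx : v ≠ x) (hd : Distinct p q r s)
    (h1 : (v, p) ∈ inp.adj u) (h2 : (w, q) ∈ inp.adj v) (h3 : (x, r) ∈ inp.adj u)
    (h4 : (w, s) ∈ inp.adj x) (hp : m ≤ p ∧ p ≤ m + δ) (hq : m ≤ q ∧ q ≤ m + δ)
    (hr : m ≤ r ∧ r ≤ m + δ) (hs : m ≤ s ∧ s ≤ m + δ) :
    ∃ t ∈ doubles inp δ (convert upper (pairType p q r s)),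
      doubleEdges inp t = place upper '' quad u w v x p q r s := by
  have hb : ∀ {y z : T}, (m ≤ y ∧ y ≤ m + δ) → (m ≤ z ∧ z ≤ m + δ) → |z - y| ≤ δ := by
    intro y z hy hz
    rw [abs_sub_le_iff, sub_le_iff_le_add', sub_le_iff_le_add']
    exact ⟨hz.2.trans (by gcongr; exact hy.1), hy.2.trans (by gcongr; exact hz.1)⟩
  have hmm : ∀ {p q r s : T}, (m ≤ p ∧ p ≤ m + δ) → (m ≤ q ∧ q ≤ m + δ) → (m ≤ r ∧ r ≤ m + δ) →
      (m ≤ s ∧ s ≤ m + δ) → max r s ≤ min p q + δ := fun hp hq hr hs =>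
    (max_le hr.2 hs.2).trans (by gcongr; exact le_min hp.1 hq.1)
  obtain ⟨d1, _, _, _, _, d6⟩ := id hd
  rcases lt_or_gt_of_ne hd.min_ne with hlt | hlt
  · exact ⟨⟨u, ⟨(v, p), (w, q)⟩, ⟨(x, r), (w, s)⟩⟩, mem_doubles.2 ⟨⟨⟨⟨h1, h2⟩, hv, hw, d1, hb hp hq⟩,
      ⟨h3, h4⟩, hx, hw, d6, hb hr hs⟩, rfl, hvx, hlt, hmm hp hq hr hs, hd, by rw [hu]⟩,
      by rw [doubleEdges, hu]⟩
  · exact ⟨⟨u, ⟨(x, r), (w, s)⟩, ⟨(v, p), (w, q)⟩⟩, mem_doubles.2 ⟨⟨⟨⟨h3, h4⟩, hx, hw, d6, hb hr hs⟩,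
      ⟨h1, h2⟩, hv, hw, d1, hb hp hq⟩, rfl, hvx.symm, hlt, hmm hr hs hp hq, hd.swap_wedges,
      by rw [hu, pairType_swap_wedges hd]⟩, by rw [doubleEdges, hu, quad_swap_wedges]⟩

/-- Take the vertex of highest priority as start-vertex. In the layer `U` the symmetries of `quad`
suffice; in the layer `L` the times are transposed and the involution `convert` undoes the change of
type. -/
lemma IsButterflySet.exists_double (h : inp.Represents G) {δ : T} {i : Fin 6} {S : Set (V × V × T)}
    (hS : IsButterflySet G δ i S) : ∃ t ∈ doubles inp δ i, doubleEdges inp t = S := by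
  obtain ⟨hE, ⟨m, hm⟩, a, b, v, x, p, q, r, s, hab, hvx, hd, rfl, rfl⟩ := hS
  obtain ⟨u, hu, hmax⟩ := exists_highest inp (S := {a, b, v, x}) ⟨a, by simp⟩
  simp only [quad, Set.mem_insert_iff, Set.mem_singleton_iff, forall_eq_or_imp, forall_eq]
    at hE hm
  obtain ⟨e1, e2, e3, e4⟩ := hE
  obtain ⟨m1, m2, m3, m4⟩ := hm
  have ua := (h.2.2.1 a).2 (G.bip _ e1).1
  have ub := (h.2.2.1 b).2 (G.bip _ e2).1
  have lw : ∀ {y : V}, y ∈ G.L → inp.isUpper y = false := fun {y} hy => by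
    rw [← Bool.not_eq_true, h.2.2.1]
    exact fun hy' => Finset.disjoint_left.1 G.disj hy' hy
  have lv := lw (G.bip _ e1).2
  have lx := lw (G.bip _ e3).2
  have av : a ≠ v := G.endpoints_ne e1
  have bv : b ≠ v := G.endpoints_ne e2
  have ax : a ≠ x := G.endpoints_ne e3
  have bx : b ≠ x := G.endpoints_ne e4
  have a1 := h.mem_adj (v := v) (t := p) ua
  have a2 := h.mem_adj (v := v) (t := q) ub
  have a3 := h.mem_adj (v := x) (t := r) ua
  have a4 := h.mem_adj (v := x) (t := s) ub
  simp only [Finset.mem_insert, Finset.mem_singleton, forall_eq_or_imp, forall_eq] at hu hmax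
  obtain ⟨ha, hb, hv, hx⟩ := hmax
  have key := pairType_transpose hd
  rcases hu with rfl | rfl | rfl | rfl
  · obtain ⟨t, ht, ht'⟩ := exists_double_of_forall_higher ua (hv av.symm) (hb hab.symm) (hx ax.symm) hvx hd
      (a1.1.2 e1) (a2.2.2 e2) (a3.1.2 e3) (a4.2.2 e4) m1 m2 m3 m4
    exact ⟨t, ht, ht'.trans (place_true_image _)⟩
  · obtain ⟨t, ht, ht'⟩ := exists_double_of_forall_higher ub (hv bv.symm) (ha hab) (hx bx.symm) hvx
      hd.swap_ends (a2.1.2 e2) (a1.2.2 e1) (a4.1.2 e4) (a3.2.2 e3) m2 m1 m4 m3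
    rw [pairType_swap_ends hd] at ht
    exact ⟨t, ht, ht'.trans ((place_true_image _).trans (quad_swap_ends _ _ _ _ _ _ _ _))⟩
  · obtain ⟨t, ht, ht'⟩ := exists_double_of_forall_higher lv (ha av) (hx hvx.symm) (hb bv) hab
      hd.transpose (a1.2.2 e1) (a3.1.2 e3) (a2.2.2 e2) (a4.1.2 e4) m1 m3 m2 m4
    rw [key, convert_convert] at ht
    exact ⟨t, ht, ht'.trans (place_false_image_quad _ _ _ _ _ _ _ _)⟩
  · obtain ⟨t, ht, ht'⟩ := exists_double_of_forall_higher lx (ha ax) (hv hvx) (hb bx) hab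
      hd.swap_wedges.transpose (a3.2.2 e3) (a1.1.2 e1) (a4.2.2 e4) (a2.1.2 e2) m3 m1 m4 m2
    rw [pairType_transpose hd.swap_wedges, convert_convert, pairType_swap_wedges hd] at ht
    exact ⟨t, ht, ht'.trans ((place_false_image_quad _ _ _ _ _ _ _ _).trans
      (quad_swap_wedges _ _ _ _ _ _ _ _))⟩

lemma isButterflySet_doubleEdges (h : inp.Represents G) {δ : T} {i : Fin 6}
    {t : Σ _ : V, (Σ _ : V × T, V × T) × (Σ _ : V × T, V × T)} (ht : t ∈ doubles inp δ i) :
    IsButterflySet G δ i (doubleEdges inp t) := by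
  obtain ⟨u, ⟨⟨v, p⟩, w, q⟩, ⟨x, r⟩, y, s⟩ := t
  rw [mem_doubles] at ht
  obtain ⟨⟨⟨⟨c1, c2⟩, a1, a2, _, hpq⟩, ⟨⟨c3, c4⟩, a3, _⟩⟩, rfl, hvx, hlt, hmax, hd, hi⟩ := ht
  have huw : u ≠ w := by
    rintro rfl
    exact higher_asymm a2 a2
  have hδ : (min p q ≤ p ∧ p ≤ min p q + δ) ∧ (min p q ≤ q ∧ q ≤ min p q + δ) ∧
      (min p q ≤ r ∧ r ≤ min p q + δ) ∧ min p q ≤ s ∧ s ≤ min p q + δ := by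
    rw [abs_sub_le_iff, sub_le_iff_le_add', sub_le_iff_le_add'] at hpq
    -- Nonnegativity of `δ` follows from the existence of a wedge within duration `δ`.
    have h0 : 0 ≤ δ := by
      rcases le_total p q with g | g
      · exact le_of_add_le_add_left ((add_zero p).le.trans (g.trans hpq.1))
      · exact le_of_add_le_add_left ((add_zero q).le.trans (g.trans hpq.2))
    refine ⟨⟨min_le_left _ _, ?_⟩, ⟨min_le_right _ _, ?_⟩,
      ⟨hlt.le.trans (min_le_left _ _), (le_max_left _ _).trans hmax⟩,
      hlt.le.trans (min_le_right _ _), (le_max_right _ _).trans hmax⟩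
    · rcases min_choice p q with g | g <;> rw [g]
      · exact le_add_of_nonneg_right h0
      · exact hpq.2
    · rcases min_choice p q with g | g <;> rw [g]
      · exact hpq.1
      · exact le_add_of_nonneg_right h0
  rw [doubleEdges]
  simp only
  cases hu : inp.isUpper u with
  | true =>
    have e1 := (h.mem_adj hu).1.1 c1
    have e3 := (h.mem_adj hu).1.1 c3
    have hw : inp.isUpper w = true := by
      rw [h.2.2.1]
      rcases ((h.2.2.2 v).2 w q).1 c2 with g | g
      · exact (Finset.disjoint_left.1 G.disj (G.bip _ g).1 (G.bip _ e1).2).elim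
      · exact (G.bip _ g).1
    have e2 := (h.mem_adj hw).2.1 c2
    have e4 := (h.mem_adj hw).2.1 c4
    rw [place_true_image]
    refine ⟨?_, ⟨min p q, ?_⟩, u, w, v, x, p, q, r, s, huw, hvx, hd, rfl, ?_⟩
    · simpa [quad] using ⟨e1, e2, e3, e4⟩
    · simp only [quad, Set.mem_insert_iff, Set.mem_singleton_iff, forall_eq_or_imp, forall_eq]
      exact hδ
    · rw [← hi, hu]
      rfl
  | false =>
    have up : ∀ {y : V} {t : T}, (y, t) ∈ inp.adj u → inp.isUpper y = true := by
      intro y t hy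
      rw [h.2.2.1]
      rcases ((h.2.2.2 u).2 y t).1 hy with g | g
      · exact absurd ((h.2.2.1 u).2 (G.bip _ g).1) (by simp [hu])
      · exact (G.bip _ g).1
    have e1 := (h.mem_adj (up c1)).2.1 c1
    have e3 := (h.mem_adj (up c3)).2.1 c3
    have e2 := (h.mem_adj (up c1)).1.1 c2
    have e4 := (h.mem_adj (up c3)).1.1 c4
    rw [place_false_image_quad]
    refine ⟨?_, ⟨min p q, ?_⟩, v, x, u, w, p, r, q, s, hvx, huw, hd.transpose, rfl, ?_⟩
    · simpa [quad] using ⟨e1, e3, e2, e4⟩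
    · simp only [quad, Set.mem_insert_iff, Set.mem_singleton_iff, forall_eq_or_imp, forall_eq]
      exact ⟨hδ.1, hδ.2.2.1, hδ.2.1, hδ.2.2.2⟩
    · rw [pairType_transpose hd, ← hi, hu]

lemma Input.Represents.sum_vertexCount (h : inp.Represents G) (δ : T) (i : Fin 6) :
    (inp.vertices.map fun u => vertexCount (inp.isUpper u) δ (startWedges inp inp.adj δ u)).sum i =
      butterflyCount G δ i := by
  rw [h.sum_vertices, TemporalButterfly.sum_vertexCount inp (fun u => (h.2.2.2 u).1),
    butterflyCount_eq, ← Set.ncard_coe_finset, ← (injOn_doubleEdges inp δ i).ncard_image]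
  congr 1
  ext S
  constructor
  · rintro ⟨t, ht, rfl⟩
    exact isButterflySet_doubleEdges h ht
  · exact fun hS => IsButterflySet.exists_double h hS

end Correctness

/-! ### Time and space -/

section Bounds

variable {V T : Type} [Fintype V] [LinearOrder V] [AddCommGroup T] [LinearOrder T]
  [IsOrderedAddMonoid T] {inp : Input V T} {G : TemporalBipartiteGraph V T}

lemma half_le_mul_log {d : ℕ} (hd : 1 ≤ d) : (1 : ℝ) ≤ 2 * (d * Real.log (1 + d)) := by
  have h1 := (clog_le_log hd).2
  have h2 : (1 : ℝ) ≤ d := by exact_mod_cast hd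
  nlinarith

/-- All terms are converted with `1 ≤ 2 log (1 + d)`: `912 = 2 * 244 + 53 * 8` for the wedges, `36 =
2 * 18` for the scan, and `6 = 2 + 4` for the remaining terms. -/
lemma Input.Represents.vertexCost_le (h : inp.Represents G) (δ : T) {u : V} (hu : 0 < G.deg u) :
    (vertexCost inp δ u : ℝ) ≤ 6 * (G.deg u * Real.log (1 + G.deg u)) +
      948 * (G.W u * Real.log (1 + G.deg u)) := by
  obtain ⟨w1, w2⟩ := h.wedgeNum_le δ u
  have s1 := h.scanCount_le_W u
  have l1 := (clog_le_log hu).2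
  have l2 := half_le_mul_log hu
  have l3 := clog_two_mul_le hu w2
  rw [vertexCost, h.length_adj]
  push_cast
  have s1' : (scanCount inp inp.adj u : ℝ) ≤ G.W u := by exact_mod_cast s1
  have w1' : (wedgeNum inp δ u : ℝ) ≤ G.W u := by exact_mod_cast w1
  set ℓ := Real.log (1 + (G.deg u : ℝ))
  set W : ℝ := (G.W u : ℝ)
  set d : ℝ := (G.deg u : ℝ)
  have hd : (0 : ℝ) ≤ d := Nat.cast_nonneg _
  have hW : (0 : ℝ) ≤ W := Nat.cast_nonneg _
  have a1 : 2 * d ≤ 4 * (d * ℓ) := by nlinarith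
  have a2 : (scanCount inp inp.adj u : ℝ) ≤ 2 * (W * ℓ) := by nlinarith
  have a3 : (wedgeNum inp δ u : ℝ) * (244 + 53 * (Nat.clog 2 (2 * wedgeNum inp δ u) : ℝ)) ≤
      W * (912 * ℓ) := by
    refine mul_le_mul w1' ?_ (by positivity) hW
    linarith
  linarith

lemma Input.Represents.words_le (h : inp.Represents G) (hd : ∀ u, 0 < G.deg u) :
    inp.words ≤ 12 * G.E.card := by
  rw [Input.words, h.sum_vertices]
  calc ∑ u, (4 + 2 * (inp.adj u).length) ≤ ∑ u, 6 * G.deg u := Finset.sum_le_sum fun u _ => by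
        have := hd u
        rw [h.length_adj]; omega
    _ = 6 * ∑ u, G.deg u := by rw [Finset.mul_sum]
    _ ≤ 12 * G.E.card := by have := G.sum_deg_le; omega

lemma Input.Represents.correct_and_bounded (h : inp.Represents G) (δ : T) (hE : G.E.Nonempty)
    (hd : ∀ u, 0 < G.deg u) :
    (∀ i, output inp δ i = butterflyCount G δ i) ∧
    (∀ u, 0 < G.W u → 1 ≤ alpha G inp δ u ∧ alpha G inp δ u ≤ (G.W u : ℝ)) ∧
    (runTime inp δ : ℝ) ≤ 1090 * ∑ u, (G.W u : ℝ) * (Real.log (1 + (G.deg u : ℝ)) +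
      alpha G inp δ u * Real.log ((G.W u : ℝ) / alpha G inp δ u)) ∧
    (runSpace inp δ : ℝ) ≤
      1090 * ((G.E.card : ℝ) + ((Finset.univ.sup fun u => G.W u : ℕ) : ℝ)) := by
  obtain ⟨L, hL, hsum, hprobes, hout, htime, hspace⟩ := exists_run inp δ G.E.card
    (Finset.univ.sup fun u => G.W u) (fun u => (h.length_adj u).trans_le (G.deg_le u))
    (fun u => (h.wedgeNum_le δ u).1.trans (Finset.le_sup (f := fun u => G.W u) (Finset.mem_univ u)))
  have hsumW : ∀ u, 2 * (L u).sum + G.W u ≤ G.W u * G.W u := fun u =>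
    two_mul_sum_le (hsum u) (h.wedgeNum_le δ u).1
  have halpha : ∀ u, alpha G inp δ u = max 1 ((L u).length / (G.W u : ℝ)) := fun u => by
    rw [alpha, hprobes]
  refine ⟨fun i => hout ▸ h.sum_vertexCount δ i, fun u hu => ?_, ?_, ?_⟩
  · rw [halpha]
    exact ⟨le_max_left _ _, max_le_of_sum (hL u) hu (hsumW u)⟩
  · have hsearch : ∀ u, (searchCost (L u) : ℝ) ≤ 22 * (G.W u *
        (alpha G inp δ u * Real.log (G.W u / alpha G inp δ u))) := by
      intro u
      rcases Nat.eq_zero_or_pos (G.W u) with h0 | h0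
      · have h1 := length_le_sum (hL u)
        have h2 := hsumW u
        rw [h0] at h2
        have : L u = [] := List.length_eq_zero_iff.1 (by omega)
        rw [this, h0]
        simp [searchCost]
      · rw [halpha]
        exact searchCost_le (hL u) h0 (hsumW u)
    have hne : (Finset.univ : Finset V).Nonempty := by
      obtain ⟨e, _⟩ := hE
      exact ⟨e.1, Finset.mem_univ _⟩
    have h6 : (1 : ℝ) ≤ 2 * ∑ u, (G.deg u * Real.log (1 + G.deg u) : ℝ) := by
      obtain ⟨u, hu⟩ := hne
      have := half_le_mul_log (hd u)
      have h' := Finset.single_le_sum (f := fun u => (G.deg u * Real.log (1 + G.deg u) : ℝ))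
        (fun u _ => mul_nonneg (Nat.cast_nonneg _) (Real.log_nonneg (by simp))) hu
      linarith
    have hdW := G.sum_deg_mul_log_le hd
    rw [h.sum_vertices, h.sum_vertices, h.sum_vertices] at htime
    have htime' : (runTime inp δ : ℝ) ≤ ((6 + ∑ u, sortCost (inp.adj u).length +
        ∑ u, vertexCost inp δ u + ∑ u, searchCost (L u) : ℕ) : ℝ) := by exact_mod_cast htime
    push_cast at htime'
    have t1 : ∑ u, (sortCost (inp.adj u).length : ℝ) ≤
        53 * ∑ u, (G.deg u * Real.log (1 + G.deg u) : ℝ) := by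
      rw [Finset.mul_sum]
      exact Finset.sum_le_sum fun u _ => by rw [h.length_adj]; exact sortCost_le (hd u)
    have t2 : ∑ u, (vertexCost inp δ u : ℝ) ≤
        6 * ∑ u, (G.deg u * Real.log (1 + G.deg u) : ℝ) +
          948 * ∑ u, (G.W u * Real.log (1 + G.deg u) : ℝ) := by
      rw [Finset.mul_sum, Finset.mul_sum, ← Finset.sum_add_distrib]
      exact Finset.sum_le_sum fun u _ => h.vertexCost_le δ (hd u)
    have t3 : ∑ u, (searchCost (L u) : ℝ) ≤ 22 * ∑ u, (G.W u *
        (alpha G inp δ u * Real.log (G.W u / alpha G inp δ u)) : ℝ) := by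
      rw [Finset.mul_sum]
      exact Finset.sum_le_sum fun u _ => hsearch u
    have t4 : 0 ≤ ∑ u, (G.W u * (alpha G inp δ u * Real.log (G.W u / alpha G inp δ u)) : ℝ) := by
      refine Finset.sum_nonneg fun u _ => ?_
      have := hsearch u
      have h0 : (0 : ℝ) ≤ searchCost (L u) := Nat.cast_nonneg _
      linarith
    simp only [mul_add, Finset.sum_add_distrib]
    -- The degree sums have coefficient `2 * 6 + 53 + 6 = 71`, which `hdW` doubles; together with
    -- `948` this gives `1090`.
    linarith
  · have hw := h.words_le hd
    have hc := hE.card_pos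
    have : runSpace inp δ ≤ 1090 * (G.E.card + Finset.univ.sup fun u => G.W u) := by omega
    exact_mod_cast this

end Bounds

end TemporalButterfly

theorem mainTheorem3 :
    ∃ c : ℝ, 0 < c ∧
      ∀ (V T : Type) [Fintype V] [LinearOrder V]
        [AddCommGroup T] [LinearOrder T] [IsOrderedAddMonoid T]
        (G : TemporalButterfly.TemporalBipartiteGraph V T) (δ : T)
        (inp : TemporalButterfly.Input V T),
        inp.Represents G → G.E.Nonempty → (∀ u, 0 < G.deg u) →
        (∀ i, TemporalButterfly.output inp δ i = TemporalButterfly.butterflyCount G δ i) ∧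
        (∀ u, 0 < G.W u →
          1 ≤ TemporalButterfly.alpha G inp δ u ∧
          TemporalButterfly.alpha G inp δ u ≤ (G.W u : ℝ)) ∧
        (TemporalButterfly.runTime inp δ : ℝ) ≤
          c * ∑ u, (G.W u : ℝ) *
            (Real.log (1 + (G.deg u : ℝ)) +
              TemporalButterfly.alpha G inp δ u *
                Real.log ((G.W u : ℝ) / TemporalButterfly.alpha G inp δ u)) ∧
        (TemporalButterfly.runSpace inp δ : ℝ) ≤
          c * ((G.E.card : ℝ) + ((Finset.univ.sup fun u => G.W u : ℕ) : ℝ)) := by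
  exact ⟨1090, by norm_num, fun _ _ _ _ _ _ _ _ δ _ h hE hd => h.correct_and_bounded δ hE hd⟩
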